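/- Conventions. All manifolds, functions, forms and vector fields are smooth, and manifolds are finite-dimensional without boundary. A contact form is a $1$-form $\eta$ with $\eta_x\neq 0$ for all $x$ and $d\eta$ nondegenerate on $\ker\eta$. Its Reeb field $\mathcal R$ is given by $i_{\mathcal R}d\eta=0$, $\eta(\mathcal R)=1$, and the contact Hamiltonian vector field $X_{\mathscr H}$ of a function $\mathscr H$ by $i_{X_{\mathscr H}}d\eta=d\mathscr H-\mathcal R(\mathscr H)\,\eta$, $\eta(X_{\mathscr H})=-\mathscr H$. On a symplectic manifold, $i_{X_H}\omega=-dH$. Let $(M,\omega)$ be a (Hausdorff) symplectic manifold, $H:M\to\mathbb R$ a function, and $D$ a complete vector field on $M$ with $L_D\omega=\omega$ and $L_DH=H$ (a scaling symmetry of degree one). Assume that the orbit space $C=M/D$ is a manifold, i.e. that there is a surjective submersion $\pi:M\to C$ whose fibres are exactly the orbits of $D$. Let $\rho:M\to\mathbb R\setminus\{0\}$ be a scaling function, $L_D\rho=\rho$, and put $\lambda=i_D\omega$. On $N=\mathbb R\times M$, with coordinate $t$ on $\mathbb R$, let $$\eta=e^{-t}(\lambda+d\rho)-dt,\qquad \tilde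 D=\partial_t+D,\qquad K=e^{-t}H .$$ Then: (i) $\eta$ is a contact form on $N$, $L_{\tilde D}\eta=0$, and $\tilde D$ generates a smooth $\mathbb R$-action $(\psi_s)$ on $N$ by exact contactomorphisms: $\psi_s^*\eta=\eta$ for all $s$. (ii) $K\circ\psi_s=K$ for all $s$. (iii) There are a contact form $\eta_C$ and a function $\mathscr H$ on $C$ with $\pi^*\eta_C=\lambda/\rho$ and $\pi^*\mathscr H=-H/\rho$; moreover $\ker\eta_C=\pi_*\ker\lambda$, and the contact Hamiltonian vector field $X_{\mathscr H}$ on $(C,\eta_C)$ is $\pi_*X_H$. Suppose in addition that $\rho>0$ on $M$. Then $J_0=\{i_{\tilde D}\eta=0\}\subset N$ is an embedded submanifold to which $\tilde D$ is tangent, and $P_0=J_0/\tilde D$ is a manifold, i.e. there is a surjective submersion $\pi_0:J_0\to P_0$ whose fibres are exactly the orbits of $\tilde D$. Let $\iota_0:J_0\to N$ be the inclusion. The following holds for every realization of $J_0$ as an embedded submanifold and of $P_0$ as such a quotient manifold. There are a contact form $\bar\eta$ and a function $\bar K$ on $P_0$ with $\pi_0^*\bar\eta=\iota_0^*\eta$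 and $\pi_0^*\bar K=\iota_0^*K$; the contact Hamiltonian vector field $X_K$ of $(N,\eta)$ is tangent to $J_0$, and there it projects under $\pi_0$ to the contact Hamiltonian vector field $X_{\bar K}$ of $(P_0,\bar\eta)$. Moreover there is a diffeomorphism $\Phi:C\to P_0$ with $\Phi(\pi(m))=\pi_0(t,m)$ for all $(t,m)\in J_0$ and $$\Phi^*\bar\eta=\eta_C,\qquad \Phi^*\bar K=-\mathscr H,\qquad \Phi_*X_{\mathscr H}=-X_{\bar K}.$$ In particular $C$ and $P_0$ are contactomorphic, and the reduced dynamics of $e^{-t}H$ on $P_0$ is the contact Hamiltonian dynamics on $C$ of the function $-\mathscr H$, whose pullback to $M$ is $H/\rho$ (equivalently, the reduced dynamics of $-e^{-t}H$ is that of $\mathscr H$). -/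

import Mathlib

open Manifold
open scoped ContDiff

noncomputable section

namespace ContactReduction

/-! ### Vector fields and differential forms on smooth manifolds without boundary -/

section Basic

variable {E H : Type*} [NormedAddCommGroup E] [NormedSpace ℝ E] [TopologicalSpace H]
  (I : ModelWithCorners ℝ E H) (M : Type*) [TopologicalSpace M] [ChartedSpace H M]

/-- Vector fields (not necessarily smooth) on `M`. -/
abbrev VField := (x : M) → TangentSpace I x

/-- Differential `k`-forms (not necessarily smooth) on `M`. -/
abbrev DForm (k : ℕ) := (x : M) → TangentSpace I x [⋀^Fin k]→L[ℝ] ℝ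

variable {M}

/-- Smoothness of a vector field. -/
def IsSmoothVField [IsManifold I ∞ M] (X : VField I M) : Prop :=
  ContMDiff I I.tangent ∞ (fun x ↦ (⟨x, X x⟩ : TangentBundle I M))

/-- The expression of a form in the preferred chart around `x₀`, i.e. its pullback under the
inverse of that chart; it is meaningful on the target of the chart. -/
def chartRep {k : ℕ} (α : DForm I M k) (x₀ : M) (y : E) : E [⋀^Fin k]→L[ℝ] ℝ :=
  ContinuousAlternatingMap.compContinuousLinearMap (M' := E) (α ((extChartAt I x₀).symm y))
    (mfderiv 𝓘(ℝ, E) I (extChartAt I x₀).symm y)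

/-- Smoothness of a form: all its expressions in charts are smooth. -/
def IsSmoothForm {k : ℕ} (α : DForm I M k) : Prop :=
  ∀ x₀ : M, ContDiffOn ℝ ∞ (chartRep I α x₀) (extChartAt I x₀).target

/-- The exterior derivative, computed at `x` in the preferred chart around `x`. -/
def extD {k : ℕ} (α : DForm I M k) : DForm I M (k + 1) := fun x ↦
  ContinuousAlternatingMap.compContinuousLinearMap (M := E)
    (extDeriv (chartRep I α x) (extChartAt I x x)) (mfderiv I 𝓘(ℝ, E) (extChartAt I x) x)

/-- The differential of a function, as a `1`-form. -/
def dFun (f : M → ℝ) : DForm I M 1 := fun x ↦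
  ContinuousAlternatingMap.ofSubsingleton ℝ (TangentSpace I x) ℝ (0 : Fin 1)
    (mfderiv I 𝓘(ℝ, ℝ) f x)

/-- The Lie derivative of a function along a vector field. -/
def lieFun (X : VField I M) (f : M → ℝ) (x : M) : ℝ := dFun I f x ![X x]

/-- The interior product `i_X α = α(X, ⋅, …, ⋅)`. -/
def interior {k : ℕ} (X : VField I M) (α : DForm I M (k + 1)) : DForm I M k := fun x ↦
  ContinuousAlternatingMap.curryLeft (E := E) (α x) (X x)

/-- The Lie derivative of a form of positive degree, `L_X α = i_X dα + d i_X α`. -/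
def lieForm {k : ℕ} (X : VField I M) (α : DForm I M (k + 1)) : DForm I M (k + 1) :=
  interior I X (extD I α) + extD I (interior I X α)

/-- Two points lie on a common integral curve (defined on all of `ℝ`) of the vector field `X`.
This is used for complete vector fields. -/
def SameOrbit (X : VField I M) (x y : M) : Prop :=
  ∃ γ : ℝ → M, IsMIntegralCurve γ X ∧ γ 0 = x ∧ ∃ s : ℝ, γ s = y

/-- Completeness of a vector field: through each point there is an integral curve on `ℝ`. -/
def IsCompleteVField (X : VField I M) : Prop :=
  ∀ x : M, ∃ γ : ℝ → M, IsMIntegralCurve γ X ∧ γ 0 = x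

/-- `ψ` is a smooth `ℝ`-action on `M` whose infinitesimal generator is `X`. -/
structure IsFlow (X : VField I M) (ψ : ℝ → M → M) : Prop where
  smooth : ContMDiff (𝓘(ℝ, ℝ).prod I) I ∞ (fun q : ℝ × M ↦ ψ q.1 q.2)
  zero : ∀ x, ψ 0 x = x
  add : ∀ s t x, ψ (s + t) x = ψ s (ψ t x)
  generator : ∀ x, IsMIntegralCurve (fun s ↦ ψ s x) X

/-! ### Symplectic and contact Hamiltonian systems -/

/-- A symplectic form: a smooth, closed, nondegenerate `2`-form. -/
structure IsSymplecticForm (Ω : DForm I M 2) : Prop where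
  smooth : IsSmoothForm I Ω
  closed : extD I Ω = 0
  nondegenerate : ∀ (x : M) (v : TangentSpace I x),
    (∀ w : TangentSpace I x, Ω x ![v, w] = 0) → v = 0

/-- `X` is the Hamiltonian vector field of `h`: `i_X Ω = -dh`. -/
structure IsHamiltonianVField [IsManifold I ∞ M] (Ω : DForm I M 2) (h : M → ℝ) (X : VField I M) : Prop where
  smooth : IsSmoothVField I X
  eq : interior I X Ω = - dFun I h

/-- A contact `1`-form: `ker η` is a hyperplane field and `dη` is nondegenerate on it. -/
structure IsContactForm (η : DForm I M 1) : Prop where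
  smooth : IsSmoothForm I η
  ne_zero : ∀ x : M, η x ≠ 0
  nondegenerate : ∀ (x : M) (v : TangentSpace I x), η x ![v] = 0 →
    (∀ w : TangentSpace I x, η x ![w] = 0 → extD I η x ![v, w] = 0) → v = 0

/-- `R` is the Reeb vector field of `η`: `i_R dη = 0` and `i_R η = 1`. -/
structure IsReebVField [IsManifold I ∞ M] (η : DForm I M 1) (R : VField I M) : Prop where
  smooth : IsSmoothVField I R
  interior_d : interior I R (extD I η) = 0
  eta : ∀ x, η x ![R x] = 1

/-- `X` is the contact Hamiltonian vector field of `h` with respect to `η`: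
`i_X dη = dh - R(h) η` and `i_X η = -h`, where `R` is the Reeb vector field of `η`. -/
structure IsContactHamiltonianVField [IsManifold I ∞ M] (η : DForm I M 1) (h : M → ℝ) (X : VField I M) : Prop where
  smooth : IsSmoothVField I X
  eta : ∀ x, η x ![X x] = - h x
  interior_d : ∃ R : VField I M, IsReebVField I η R ∧
    ∀ x, interior I X (extD I η) x = dFun I h x - lieFun I R h x • η x

/-- `D` is a scaling symmetry of degree `Λ` of the Hamiltonian system `(M, Ω, h)`. -/
structure IsScalingSymmetry [IsManifold I ∞ M] (Ω : DForm I M 2) (h : M → ℝ) (D : VField I M) (Λ : ℝ) : Prop where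
  smooth : IsSmoothVField I D
  form : lieForm I D Ω = Ω
  fn : ∀ x, lieFun I D h x = Λ * h x

/-- `ρ` is a (smooth) scaling function for `D`. -/
structure IsScalingFunction (D : VField I M) (ρ : M → ℝ) : Prop where
  smooth : ContMDiff I 𝓘(ℝ, ℝ) ∞ ρ
  eq : ∀ x, lieFun I D ρ x = ρ x

end Basic

/-! ### Pullbacks, quotients and reduction -/

section Maps

variable {E H : Type*} [NormedAddCommGroup E] [NormedSpace ℝ E] [TopologicalSpace H]
  (I : ModelWithCorners ℝ E H) {M : Type*} [TopologicalSpace M] [ChartedSpace H M]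
  {E' H' : Type*} [NormedAddCommGroup E'] [NormedSpace ℝ E'] [TopologicalSpace H']
  (I' : ModelWithCorners ℝ E' H') {M' : Type*} [TopologicalSpace M'] [ChartedSpace H' M']
  {E'' H'' : Type*} [NormedAddCommGroup E''] [NormedSpace ℝ E''] [TopologicalSpace H'']
  (I'' : ModelWithCorners ℝ E'' H'') {M'' : Type*} [TopologicalSpace M''] [ChartedSpace H'' M'']

/-- The pullback of a form under a map. -/
def pullback {k : ℕ} (f : M → M') (α : DForm I' M' k) : DForm I M k := fun x ↦
  (α (f x)).compContinuousLinearMap (mfderiv I I' f x)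

/-- `X` and `Y` are `f`-related, i.e. `f_* X = Y` along `f`. -/
def IsRelated (f : M → M') (X : VField I M) (Y : VField I' M') : Prop :=
  ∀ x : M, mfderiv I I' f x (X x) = Y (f x)

/-- `π : M → M'` exhibits the manifold `M'` as the quotient `M / X` by the orbits of the complete
vector field `X`: it is a surjective submersion whose fibres are exactly the orbits of `X`. -/
structure IsOrbitQuotient (X : VField I M) (π : M → M') : Prop where
  submersion : IsSubmersion I I' ∞ π
  surjective : Function.Surjective π
  fibres : ∀ x y : M, π x = π y ↔ SameOrbit I X x y

/-- The spaces in the contact reduction of `(N, η) = (M, η)` by an infinitesimal symmetry `X`: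
`ι₀ : M' → M` exhibits the manifold `M'` as the embedded submanifold `J₀ = (i_X η)⁻¹(0)`, to which
`X` is tangent, and `π₀ : M' → M''` exhibits the manifold `M''` as the quotient `P₀ = J₀ / X`. -/
structure IsZeroLevelQuotient [IsManifold I' ∞ M'] (η : DForm I M 1) (X : VField I M) (ι₀ : M' → M) (π₀ : M' → M'') :
    Prop where
  embedding : IsSmoothEmbedding I' I ∞ ι₀
  range : Set.range ι₀ = {p : M | η p ![X p] = 0}
  quotient : ∃ X₀ : VField I' M', IsSmoothVField I' X₀ ∧ IsRelated I' I ι₀ X₀ X ∧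
    IsOrbitQuotient I' I'' X₀ π₀

end Maps

/-! ### The extended system on `N = ℝ × M` -/

section Extended

variable {E H : Type*} [NormedAddCommGroup E] [NormedSpace ℝ E] [TopologicalSpace H]
  (I : ModelWithCorners ℝ E H) {M : Type*} [TopologicalSpace M] [ChartedSpace H M]

/-- The `1`-form `e^{-t} (λ + dρ) - dt` on `ℝ × M`, where `t` is the coordinate on `ℝ`. -/
def extendedForm (lam : DForm I M 1) (ρ : M → ℝ) : DForm (𝓘(ℝ, ℝ).prod I) (ℝ × M) 1 := fun p ↦
  Real.exp (-p.1) • pullback (𝓘(ℝ, ℝ).prod I) I Prod.snd (lam + dFun I ρ) p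
    - dFun (𝓘(ℝ, ℝ).prod I) Prod.fst p

/-- The vector field `∂_t + D` on `ℝ × M`. -/
def extendedField (D : VField I M) : VField (𝓘(ℝ, ℝ).prod I) (ℝ × M) := fun p ↦
  ((1 : ℝ), D p.2)

/-- The function `e^{-t} h` on `ℝ × M`. -/
def extendedHamiltonian (h : M → ℝ) (p : ℝ × M) : ℝ := Real.exp (-p.1) * h p.2

end Extended

end ContactReduction

end

noncomputable section

namespace ContactReduction

/-! ### Charts: differentials and forms in coordinates -/

section Charts

variable {E H : Type*} [NormedAddCommGroup E] [NormedSpace ℝ E] [TopologicalSpace H]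
  {I : ModelWithCorners ℝ E H} [I.Boundaryless]
  {M : Type*} [TopologicalSpace M] [ChartedSpace H M]
  {E' H' : Type*} [NormedAddCommGroup E'] [NormedSpace ℝ E'] [TopologicalSpace H']
  {I' : ModelWithCorners ℝ E' H'} [I'.Boundaryless]
  {M' : Type*} [TopologicalSpace M'] [ChartedSpace H' M']

/-! Everything rests on one global trivialization. Along an integral curve of D the function ρ is
multiplied by e^t, so log|ρ| is a time parameter on each orbit (`Real.log` is log|·|, so the sign of
ρ plays no role). Hence Θ = (π, log|ρ|) is a diffeomorphism from M onto C × ℝ that turns D into the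
derivative along ℝ (`IsOrbitQuotient.exists_trivialization`). Injectivity and surjectivity are
immediate; for the differential one needs ker dπ = ℝD, which follows because log|ρ| is injective on
fibres, so that a submersion slice of a fibre has dimension at most one.

With Θ available, a one-form μ satisfying μ(D) = 0 and i_D dμ = 0 has coefficients independent of
the ℝ-coordinate, hence is a pullback from C (`IsTrivialization.pullback_pullback`). This applies to
λ/ρ: λ(D) = ω(D, D) = 0, dλ = ω, and d(λ/ρ) = ω/ρ - dρ∧λ/ρ² is killed by D. The identities λ(X_H) =
H and λ(X_ρ) = ρ do the rest. They show that η_C is contact, that its Reeb field is π_*X_ρ, and that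
π_*X_H satisfies the equations of the contact Hamiltonian field of -H/ρ. These equations determine a
vector at each point of C, so the projected vectors agree along each fibre, with no bracket
computation (`IsTrivialization.exists_contactHamiltonian`).

On N direct computation gives dη = e^{-t}(ω - dt∧(λ+dρ)), the Reeb field -∂_t + X_ρ - D, and X_K =
-e^{-t}X_H(ρ)∂_t - X_H. The flow of D is translation of log|ρ| in the trivialization. It fixes π and
rescales ρ, so it rescales λ = ρ·π^*η_C; the time translation compensates this in η and in K.

For ρ > 0 one has i_{D̃}η = e^{-t}ρ - 1, so J₀ is the graph t = log ρ, a copy of M on which D̃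
becomes D. There e^{-t} = 1/ρ and dt = dρ/ρ, so η restricts to λ/ρ and K to H/ρ = -ℋ. Any
realization of P₀ is therefore again a quotient of M by D, and the theorem on C applies to it
verbatim. Comparing the two trivializations gives Φ, and all identities are checked after pulling
back to M (`IsTrivialization.exists_reduction`). The minus sign comes from the horizontal part -X_H
of X_K. -/

omit [I.Boundaryless] in
-- All tangent spaces are the model space `E` by definition, so one tuple of vectors makes sense at
-- two points known only to be propositionally equal.
lemma form_congr {k : ℕ} (α : DForm I M k) {p q : M} (h : p = q) (v : Fin k → E) :
    α p (v : Fin k → TangentSpace I p) = α q (v : Fin k → TangentSpace I q) := by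
  subst h; rfl

lemma contMDiffAt_chart_symm [IsManifold I ∞ M] {x₀ : M} {y : E}
    (hy : y ∈ (extChartAt I x₀).target) :
    ContMDiffAt 𝓘(ℝ, E) I ∞ (extChartAt I x₀).symm y :=
  (contMDiffOn_extChartAt_symm x₀).contMDiffAt ((isOpen_extChartAt_target x₀).mem_nhds hy)

omit [I.Boundaryless] in
lemma contMDiffAt_chart [IsManifold I ∞ M] {x₀ x : M} (hx : x ∈ (extChartAt I x₀).source) :
    ContMDiffAt I 𝓘(ℝ, E) ∞ (extChartAt I x₀) x :=
  contMDiffAt_extChartAt' (by rwa [extChartAt_source] at hx)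

lemma mfderiv_chart_mfderiv_symm [IsManifold I ∞ M] {x₀ : M} {y : E}
    (hy : y ∈ (extChartAt I x₀).target) (v : E) :
    mfderiv I 𝓘(ℝ, E) (extChartAt I x₀) ((extChartAt I x₀).symm y)
      (mfderiv 𝓘(ℝ, E) I (extChartAt I x₀).symm y v) = v := by
  have h := mfderiv_extChartAt_comp_mfderivWithin_extChartAt_symm (I := I) hy
  rw [I.range_eq_univ, mfderivWithin_univ] at h
  exact DFunLike.congr_fun h v

lemma mfderiv_symm_mfderiv_chart [IsManifold I ∞ M] {x₀ : M} {y : E}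
    (hy : y ∈ (extChartAt I x₀).target) (v : TangentSpace I ((extChartAt I x₀).symm y)) :
    mfderiv 𝓘(ℝ, E) I (extChartAt I x₀).symm y
      (mfderiv I 𝓘(ℝ, E) (extChartAt I x₀) ((extChartAt I x₀).symm y) v) = v := by
  have h := mfderivWithin_extChartAt_symm_comp_mfderiv_extChartAt (I := I) hy
  rw [I.range_eq_univ, mfderivWithin_univ] at h
  exact DFunLike.congr_fun h v

/-- A map between manifolds read in the preferred charts around `x₀` and `z₀`. -/
def inCharts (I : ModelWithCorners ℝ E H) (I' : ModelWithCorners ℝ E' H') (f : M → M')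
    (x₀ : M) (z₀ : M') (y : E) : E' :=
  extChartAt I' z₀ (f ((extChartAt I x₀).symm y))

omit [I'.Boundaryless] in
lemma contDiffAt_inCharts [IsManifold I ∞ M] [IsManifold I' ∞ M'] {f : M → M'} {x₀ : M} {z₀ : M'}
    {y : E} (hy : y ∈ (extChartAt I x₀).target)
    (hf : ContMDiffAt I I' ∞ f ((extChartAt I x₀).symm y))
    (hz : f ((extChartAt I x₀).symm y) ∈ (extChartAt I' z₀).source) :
    ContDiffAt ℝ ∞ (inCharts I I' f x₀ z₀) y := by
  rw [← contMDiffAt_iff_contDiffAt]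
  exact (contMDiffAt_chart hz).comp y (hf.comp y (contMDiffAt_chart_symm hy))

/-- Near `y`, f after the source parametrization equals the target parametrization after the
coordinate expression of f. The chain rule is applied to both sides. -/
lemma mfderiv_mfderiv_chart_symm [IsManifold I ∞ M] [IsManifold I' ∞ M'] {f : M → M'} {x₀ : M}
    {z₀ : M'} {y : E} (hy : y ∈ (extChartAt I x₀).target)
    (hf : ContMDiffAt I I' ∞ f ((extChartAt I x₀).symm y))
    (hz : f ((extChartAt I x₀).symm y) ∈ (extChartAt I' z₀).source) (v : E) :
    (mfderiv I I' f ((extChartAt I x₀).symm y) (mfderiv 𝓘(ℝ, E) I (extChartAt I x₀).symm y v) : E')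
      = (mfderiv 𝓘(ℝ, E') I' (extChartAt I' z₀).symm (inCharts I I' f x₀ z₀ y)
          (fderiv ℝ (inCharts I I' f x₀ z₀) y v) : E') := by
  have hσ := contMDiffAt_chart_symm (I := I) hy
  have hg := contDiffAt_inCharts (I := I) (I' := I') hy hf hz
  have hgy : inCharts I I' f x₀ z₀ y ∈ (extChartAt I' z₀).target :=
    (extChartAt I' z₀).map_source hz
  have hτ := contMDiffAt_chart_symm (I := I') hgy
  have h1 := mfderiv_comp y (hf.mdifferentiableAt (by simp)) (hσ.mdifferentiableAt (by simp))
  have h2 := mfderiv_comp y (hτ.mdifferentiableAt (by simp))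
    ((contMDiffAt_iff_contDiffAt.2 hg).mdifferentiableAt (by simp))
  have h3 : (f ∘ (extChartAt I x₀).symm) =ᶠ[nhds y]
      ((extChartAt I' z₀).symm ∘ inCharts I I' f x₀ z₀) := by
    have : ∀ᶠ y' in nhds y, f ((extChartAt I x₀).symm y') ∈ (extChartAt I' z₀).source :=
      (hf.continuousAt.comp hσ.continuousAt).eventually
        ((isOpen_extChartAt_source z₀).mem_nhds hz)
    filter_upwards [this] with y' hy'
    exact ((extChartAt I' z₀).left_inv hy').symm
  have h4 := h3.mfderiv_eq (I := 𝓘(ℝ, E)) (I' := I')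
  rw [mfderiv_eq_fderiv] at h2
  have h5 := DFunLike.congr_fun h1 v
  have h6 := DFunLike.congr_fun h2 v
  refine h5.symm.trans (Eq.trans ?_ h6)
  rw [h4]
  rfl

lemma chartRep_pullback [IsManifold I ∞ M] [IsManifold I' ∞ M'] {k : ℕ} {f : M → M'}
    (α : DForm I' M' k) {x₀ : M}
    {z₀ : M'} {y : E} (hy : y ∈ (extChartAt I x₀).target)
    (hf : ContMDiffAt I I' ∞ f ((extChartAt I x₀).symm y))
    (hz : f ((extChartAt I x₀).symm y) ∈ (extChartAt I' z₀).source) :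
    chartRep I (pullback I I' f α) x₀ y =
      (chartRep I' α z₀ (inCharts I I' f x₀ z₀ y)).compContinuousLinearMap
        (fderiv ℝ (inCharts I I' f x₀ z₀) y) := by
  ext v
  have h1 := form_congr α ((extChartAt I' z₀).left_inv hz)
  refine Eq.trans ?_ (h1 _).symm
  refine congrArg (α (f ((extChartAt I x₀).symm y))) ?_
  funext i
  exact mfderiv_mfderiv_chart_symm hy hf hz (v i)

/-- A one-form on a vector space as a linear functional. -/
def toLin (E : Type*) [NormedAddCommGroup E] [NormedSpace ℝ E] :
    (E [⋀^Fin 1]→L[ℝ] ℝ) ≃ₗᵢ[ℝ] (E →L[ℝ] ℝ) :=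
  (ContinuousAlternatingMap.ofSubsingletonLIE (𝕜 := ℝ) (E := E) (F := ℝ) (0 : Fin 1)).symm

lemma toLin_apply (a : E [⋀^Fin 1]→L[ℝ] ℝ) (v : E) : toLin E a v = a ![v] := by
  obtain ⟨b, rfl⟩ := (toLin E).symm.surjective a
  rw [LinearIsometryEquiv.apply_symm_apply]
  rfl

lemma toLin_symm_apply (a : E →L[ℝ] ℝ) (v : E) : (toLin E).symm a ![v] = a v := by
  rw [← toLin_apply]; simp

/-- For constant vectors v, w no bracket term appears, so only the two directional derivatives of
the coefficients remain. -/
lemma extDeriv_one {θ : E → E [⋀^Fin 1]→L[ℝ] ℝ} {y : E} (v w : E) :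
    extDeriv θ y ![v, w] = fderiv ℝ θ y v ![w] - fderiv ℝ θ y w ![v] := by
  rw [extDeriv, ContinuousAlternatingMap.alternatizeUncurryFin_apply, Fin.sum_univ_two]
  have h0 : (0 : Fin 2).removeNth ![v, w] = ![w] := by
    ext i; fin_cases i; rfl
  have h1 : (1 : Fin 2).removeNth ![v, w] = ![v] := by
    ext i; fin_cases i; rfl
  simp [h0, h1, sub_eq_add_neg]

end Charts

/-! ### Smooth forms: sums, multiples, pullbacks and the exterior derivative -/

section FormOps

variable {E H : Type*} [NormedAddCommGroup E] [NormedSpace ℝ E] [TopologicalSpace H]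
  {I : ModelWithCorners ℝ E H} [I.Boundaryless]
  {M : Type*} [TopologicalSpace M] [ChartedSpace H M]
  {E' H' : Type*} [NormedAddCommGroup E'] [NormedSpace ℝ E'] [TopologicalSpace H']
  {I' : ModelWithCorners ℝ E' H'} [I'.Boundaryless]
  {M' : Type*} [TopologicalSpace M'] [ChartedSpace H' M']

lemma IsSmoothForm.contDiffAt {k : ℕ} {α : DForm I M k} (hα : IsSmoothForm I α) {x₀ : M} {y : E}
    (hy : y ∈ (extChartAt I x₀).target) : ContDiffAt ℝ ∞ (chartRep I α x₀) y :=
  (hα x₀).contDiffAt ((isOpen_extChartAt_target x₀).mem_nhds hy)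

omit [I.Boundaryless] in
lemma isSmoothForm_of_contDiffAt {k : ℕ} {α : DForm I M k}
    (h : ∀ x₀ : M, ∀ y ∈ (extChartAt I x₀).target, ContDiffAt ℝ ∞ (chartRep I α x₀) y) :
    IsSmoothForm I α :=
  fun x₀ y hy ↦ (h x₀ y hy).contDiffWithinAt

omit [I.Boundaryless] in
lemma chartRep_add {k : ℕ} (α β : DForm I M k) (x₀ : M) :
    chartRep I (α + β) x₀ = chartRep I α x₀ + chartRep I β x₀ := by
  funext y; ext v; rfl

omit [I.Boundaryless] in
lemma chartRep_sub {k : ℕ} (α β : DForm I M k) (x₀ : M) :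
    chartRep I (α - β) x₀ = chartRep I α x₀ - chartRep I β x₀ := by
  funext y; ext v; rfl

omit [I.Boundaryless] in
lemma chartRep_smul {k : ℕ} (f : M → ℝ) (α : DForm I M k) (x₀ : M) :
    chartRep I (fun x ↦ f x • α x) x₀ =
      fun y ↦ f ((extChartAt I x₀).symm y) • chartRep I α x₀ y := by
  funext y; ext v; rfl

lemma contDiffAt_comp_chart_symm [IsManifold I ∞ M] {f : M → ℝ} (hf : ContMDiff I 𝓘(ℝ, ℝ) ∞ f)
    {x₀ : M} {y : E} (hy : y ∈ (extChartAt I x₀).target) :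
    ContDiffAt ℝ ∞ (fun y ↦ f ((extChartAt I x₀).symm y)) y := by
  rw [← contMDiffAt_iff_contDiffAt]
  exact (hf _).comp y (contMDiffAt_chart_symm hy)

omit [I.Boundaryless] in
lemma IsSmoothForm.add {k : ℕ} {α β : DForm I M k} (hα : IsSmoothForm I α)
    (hβ : IsSmoothForm I β) : IsSmoothForm I (α + β) := fun x₀ ↦ by
  rw [chartRep_add]; exact (hα x₀).add (hβ x₀)

omit [I.Boundaryless] in
lemma IsSmoothForm.sub {k : ℕ} {α β : DForm I M k} (hα : IsSmoothForm I α)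
    (hβ : IsSmoothForm I β) : IsSmoothForm I (α - β) := fun x₀ ↦ by
  rw [chartRep_sub]; exact (hα x₀).sub (hβ x₀)

omit [I.Boundaryless] in
lemma IsSmoothForm.neg {k : ℕ} {α : DForm I M k} (hα : IsSmoothForm I α) :
    IsSmoothForm I (-α) := fun x₀ ↦ by
  have h : chartRep I (-α) x₀ = -chartRep I α x₀ := by
    funext y; ext v; rfl
  rw [h]; exact (hα x₀).neg

lemma IsSmoothForm.smul [IsManifold I ∞ M] {k : ℕ} {f : M → ℝ} {α : DForm I M k}
    (hf : ContMDiff I 𝓘(ℝ, ℝ) ∞ f) (hα : IsSmoothForm I α) :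
    IsSmoothForm I (fun x ↦ f x • α x) := by
  refine isSmoothForm_of_contDiffAt fun x₀ y hy ↦ ?_
  rw [chartRep_smul]
  exact (contDiffAt_comp_chart_symm hf hy).smul (hα.contDiffAt hy)

omit [I.Boundaryless] in
lemma dFun_apply (f : M → ℝ) (x : M) (v : TangentSpace I x) :
    dFun I f x ![v] = mfderiv I 𝓘(ℝ, ℝ) f x v := rfl

lemma chartRep_dFun [IsManifold I ∞ M] {f : M → ℝ} (hf : ContMDiff I 𝓘(ℝ, ℝ) ∞ f) {x₀ : M}
    {y : E} (hy : y ∈ (extChartAt I x₀).target) :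
    chartRep I (dFun I f) x₀ y =
      (toLin E).symm (fderiv ℝ (fun y ↦ f ((extChartAt I x₀).symm y)) y) := by
  have h := mfderiv_comp y ((hf _).mdifferentiableAt (by simp))
    ((contMDiffAt_chart_symm (I := I) hy).mdifferentiableAt (by simp))
  rw [mfderiv_eq_fderiv] at h
  ext v
  exact (DFunLike.congr_fun h (v 0)).symm

lemma isSmoothForm_dFun [IsManifold I ∞ M] {f : M → ℝ} (hf : ContMDiff I 𝓘(ℝ, ℝ) ∞ f) :
    IsSmoothForm I (dFun I f) := by
  intro x₀
  have h : ContDiffOn ℝ ∞ (fun y ↦ (toLin E).symm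
      (fderiv ℝ (fun y ↦ f ((extChartAt I x₀).symm y)) y)) (extChartAt I x₀).target := by
    intro y hy
    exact ((toLin E).symm.contDiff.contDiffAt.comp y
      ((contDiffAt_comp_chart_symm hf hy).fderiv_right (m := ∞) (by simp))).contDiffWithinAt
  exact h.congr fun y hy ↦ chartRep_dFun hf hy

lemma toLin_compContinuousLinearMap (a : E' [⋀^Fin 1]→L[ℝ] ℝ) (g : E →L[ℝ] E') :
    toLin E (a.compContinuousLinearMap g) = (toLin E' a).comp g := by
  ext v
  rw [toLin_apply, ContinuousLinearMap.comp_apply, toLin_apply,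
    ContinuousAlternatingMap.compContinuousLinearMap_apply]
  congr 1
  ext i; fin_cases i; rfl

lemma eventually_mem_chart_target {x₀ : M} {y : E}
    (hy : y ∈ (extChartAt I x₀).target) :
    ∀ᶠ y' in nhds y, y' ∈ (extChartAt I x₀).target :=
  (isOpen_extChartAt_target x₀).mem_nhds hy

lemma chartRep_pullback_eventuallyEq [IsManifold I ∞ M] [IsManifold I' ∞ M'] {k : ℕ} {f : M → M'}
    (α : DForm I' M' k) (hf : ContMDiff I I' ∞ f) {x₀ : M} {z₀ : M'} {y : E}
    (hy : y ∈ (extChartAt I x₀).target)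
    (hz : f ((extChartAt I x₀).symm y) ∈ (extChartAt I' z₀).source) :
    chartRep I (pullback I I' f α) x₀ =ᶠ[nhds y] fun y ↦
      (chartRep I' α z₀ (inCharts I I' f x₀ z₀ y)).compContinuousLinearMap
        (fderiv ℝ (inCharts I I' f x₀ z₀) y) := by
  have : ∀ᶠ y' in nhds y, f ((extChartAt I x₀).symm y') ∈ (extChartAt I' z₀).source :=
    ((hf _).continuousAt.comp (contMDiffAt_chart_symm (I := I) hy).continuousAt).eventually
      ((isOpen_extChartAt_source z₀).mem_nhds hz)
  filter_upwards [this, eventually_mem_chart_target hy] with y' h1 h2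
  exact chartRep_pullback α h2 (hf _) h1

lemma IsSmoothForm.pullback [IsManifold I ∞ M] [IsManifold I' ∞ M'] {f : M → M'}
    {α : DForm I' M' 1} (hα : IsSmoothForm I' α) (hf : ContMDiff I I' ∞ f) :
    IsSmoothForm I (pullback I I' f α) := by
  refine isSmoothForm_of_contDiffAt fun x₀ y hy ↦ ?_
  set z₀ := f ((extChartAt I x₀).symm y) with hz₀
  have hz : f ((extChartAt I x₀).symm y) ∈ (extChartAt I' z₀).source := mem_extChartAt_source z₀
  refine ContDiffAt.congr_of_eventuallyEq ?_ (chartRep_pullback_eventuallyEq α hf hy hz)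
  have hg := contDiffAt_inCharts (I := I) (I' := I') hy (hf _) hz
  have h1 : ContDiffAt ℝ ∞ (fun y ↦ toLin E' (chartRep I' α z₀ (inCharts I I' f x₀ z₀ y))) y :=
    (toLin E').contDiff.contDiffAt.comp (f := fun y ↦ chartRep I' α z₀ (inCharts I I' f x₀ z₀ y)) y
      ((hα.contDiffAt ((extChartAt I' z₀).map_source hz)).comp
        (f := inCharts I I' f x₀ z₀) y hg)
  have h2 := h1.clm_comp (hg.fderiv_right (m := ∞) (by simp))
  refine ((toLin E).symm.contDiff.contDiffAt.comp y h2).congr_of_eventuallyEq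
    (Filter.Eventually.of_forall fun y' ↦ ?_)
  rw [Function.comp_apply, ← toLin_compContinuousLinearMap, LinearIsometryEquiv.symm_apply_apply]

omit [I.Boundaryless] in
-- The preferred chart at `x` has identity differential at `x`, so the pullback in the definition of
-- `extD` disappears there.
lemma extD_apply [IsManifold I ∞ M] {k : ℕ} (α : DForm I M k) (x : M) (v : Fin (k + 1) → E) :
    extD I α x (v : Fin (k + 1) → TangentSpace I x) =
      extDeriv (chartRep I α x) (extChartAt I x x) v := by
  have h : mfderiv I 𝓘(ℝ, E) (extChartAt I x) x = ContinuousLinearMap.id ℝ E :=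
    mfderiv_extChartAt_self
  refine congrArg (extDeriv (chartRep I α x) (extChartAt I x x)) ?_
  funext i
  exact DFunLike.congr_fun h (v i)

lemma minSmoothness_two_le_infty : minSmoothness ℝ 2 ≤ (∞ : ℕ∞ω) := by
  rw [minSmoothness_of_isRCLikeNormedField]
  exact WithTop.coe_le_coe.2 (le_top : (2 : ℕ∞) ≤ ⊤)

/-- Naturality of d on vector spaces, applied to the coordinate expression of f in the preferred
charts at x and f x, which are the charts that `extD` uses on the two sides. -/
lemma extD_pullback [IsManifold I ∞ M] [IsManifold I' ∞ M'] {k : ℕ} {f : M → M'}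
    {α : DForm I' M' k} (hα : IsSmoothForm I' α) (hf : ContMDiff I I' ∞ f) :
    extD I (pullback I I' f α) = pullback I I' f (extD I' α) := by
  funext x
  refine ContinuousAlternatingMap.ext fun (v : Fin (k + 1) → E) ↦ ?_
  have hy : extChartAt I x x ∈ (extChartAt I x).target := mem_extChartAt_target x
  have hx : (extChartAt I x).symm (extChartAt I x x) = x := extChartAt_to_inv x
  have hz : f ((extChartAt I x).symm (extChartAt I x x)) ∈ (extChartAt I' (f x)).source := by
    rw [hx]; exact mem_extChartAt_source (f x)
  have hg := contDiffAt_inCharts (I := I) (I' := I') hy (hf _) hz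
  have hgx : inCharts I I' f x (f x) (extChartAt I x x) = extChartAt I' (f x) (f x) := by
    rw [inCharts, hx]
  have key := (chartRep_pullback_eventuallyEq α hf hy hz).extDeriv_eq.trans
    (extDeriv_pullback (r := ∞) ((hα.contDiffAt ((extChartAt I' _).map_source hz)).differentiableAt
      (by simp)) hg minSmoothness_two_le_infty)
  rw [hgx] at key
  refine (extD_apply _ x v).trans ((DFunLike.congr_fun key v).trans ?_)
  refine Eq.trans ?_ (extD_apply α (f x) _).symm
  refine congrArg (extDeriv (chartRep I' α (f x)) (extChartAt I' (f x) (f x))) ?_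
  funext i
  have h1 : mfderiv I I' f x = fderivWithin ℝ (writtenInExtChartAt I I' x f) (Set.range I)
      (extChartAt I x x) := ((hf x).mdifferentiableAt (by simp)).mfderiv
  rw [I.range_eq_univ, fderivWithin_univ] at h1
  exact (DFunLike.congr_fun h1 (v i)).symm

lemma extD_add [IsManifold I ∞ M] {k : ℕ} {α β : DForm I M k} (hα : IsSmoothForm I α)
    (hβ : IsSmoothForm I β) : extD I (α + β) = extD I α + extD I β := by
  funext x
  refine ContinuousAlternatingMap.ext fun (v : Fin (k + 1) → E) ↦ ?_
  have hy : extChartAt I x x ∈ (extChartAt I x).target := mem_extChartAt_target x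
  have key := extDeriv_add ((hα.contDiffAt hy).differentiableAt (by simp))
    ((hβ.contDiffAt hy).differentiableAt (by simp))
  rw [← chartRep_add] at key
  refine (extD_apply _ x v).trans ((DFunLike.congr_fun key v).trans ?_)
  exact congrArg₂ (· + ·) (extD_apply α x v).symm (extD_apply β x v).symm

lemma chartRep_self [IsManifold I ∞ M] {k : ℕ} (α : DForm I M k) (x : M) (v : Fin k → E) :
    chartRep I α x (extChartAt I x x) v = α x (v : Fin k → TangentSpace I x) := by
  have h := mfderivWithin_range_extChartAt_symm (I := I) (x := x)
  rw [I.range_eq_univ, mfderivWithin_univ] at h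
  refine Eq.trans ?_ (form_congr α (extChartAt_to_inv (I := I) x) v)
  refine congrArg (α ((extChartAt I x).symm (extChartAt I x x))) ?_
  funext i
  exact DFunLike.congr_fun h (v i)

lemma extD_smul_apply [IsManifold I ∞ M] {f : M → ℝ} {α : DForm I M 1}
    (hf : ContMDiff I 𝓘(ℝ, ℝ) ∞ f) (hα : IsSmoothForm I α) (x : M) (v w : TangentSpace I x) :
    extD I (fun x ↦ f x • α x) x ![v, w] =
      dFun I f x ![v] * α x ![w] - dFun I f x ![w] * α x ![v] + f x * extD I α x ![v, w] := by
  suffices key : ∀ v w : E, extD I (fun x ↦ f x • α x) x ![(v : TangentSpace I x), w] =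
      dFun I f x ![(v : TangentSpace I x)] * α x ![(w : TangentSpace I x)] -
        dFun I f x ![(w : TangentSpace I x)] * α x ![(v : TangentSpace I x)] +
        f x * extD I α x ![(v : TangentSpace I x), w] from key v w
  intro v w
  have hy : extChartAt I x x ∈ (extChartAt I x).target := mem_extChartAt_target x
  have h0 (u : E) : chartRep I α x (extChartAt I x x) ![u] = α x ![(u : TangentSpace I x)] :=
    (chartRep_self α x _).trans (congrArg (α x) (by funext i; fin_cases i; rfl))
  have h1 (u : E) : dFun I f x ![(u : TangentSpace I x)] =
      fderiv ℝ (fun y ↦ f ((extChartAt I x).symm y)) (extChartAt I x x) u := by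
    refine Eq.trans ?_ (toLin_symm_apply _ u)
    rw [← chartRep_dFun hf hy]
    exact (congrArg (dFun I f x) (by funext i; fin_cases i; rfl)).trans
      (chartRep_self (dFun I f) x ![u]).symm
  have h2 (β : DForm I M 1) : extD I β x ![(v : TangentSpace I x), w] =
      extDeriv (chartRep I β x) (extChartAt I x x) ![v, w] :=
    (congrArg (extD I β x) (by funext i; fin_cases i <;> rfl)).trans (extD_apply β x _)
  have h3 := fderiv_fun_smul ((contDiffAt_comp_chart_symm hf hy).differentiableAt (by simp))
    ((hα.contDiffAt hy).differentiableAt (by simp))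
  rw [h2, h2, chartRep_smul, extDeriv_one, extDeriv_one, h3, h1, h1, ← h0, ← h0]
  simp only [add_apply, smul_apply,
    ContinuousLinearMap.smulRight_apply, ContinuousAlternatingMap.add_apply,
    ContinuousAlternatingMap.smul_apply, smul_eq_mul, extChartAt_to_inv]
  ring

lemma extD_dFun [IsManifold I ∞ M] {f : M → ℝ} (hf : ContMDiff I 𝓘(ℝ, ℝ) ∞ f) :
    extD I (dFun I f) = 0 := by
  funext x
  refine ContinuousAlternatingMap.ext fun (v : Fin 2 → E) ↦ ?_
  have hy : extChartAt I x x ∈ (extChartAt I x).target := mem_extChartAt_target x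
  -- In the chart df is the exterior derivative of f viewed as a 0-form, so the claim becomes d² = 0
  -- on a vector space.
  have h1 : chartRep I (dFun I f) x =ᶠ[nhds (extChartAt I x x)]
      extDeriv (fun y ↦ ContinuousAlternatingMap.constOfIsEmpty ℝ E (Fin 0)
        (f ((extChartAt I x).symm y))) := by
    filter_upwards [eventually_mem_chart_target hy] with y hy'
    rw [chartRep_dFun hf hy', extDeriv_constOfIsEmpty]
    rfl
  have h2 := h1.extDeriv_eq.trans (extDeriv_extDeriv_apply (r := ∞)
    ((ContinuousAlternatingMap.constOfIsEmptyLIE ℝ E ℝ (Fin 0)).contDiff.contDiffAt.comp _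
      (contDiffAt_comp_chart_symm hf hy)) minSmoothness_two_le_infty)
  exact (extD_apply _ x v).trans (DFunLike.congr_fun h2 v)

end FormOps

/-! ### Vector fields in charts, contraction, and inversion of a symplectic form -/

section VectorFields

variable {E H : Type*} [NormedAddCommGroup E] [NormedSpace ℝ E] [TopologicalSpace H]
  {I : ModelWithCorners ℝ E H} [I.Boundaryless]
  {M : Type*} [TopologicalSpace M] [ChartedSpace H M]

omit [I.Boundaryless] in
lemma chartRep_apply_one (α : DForm I M 1) (x₀ : M) (y w : E) :
    chartRep I α x₀ y ![w] =
      α ((extChartAt I x₀).symm y) ![mfderiv 𝓘(ℝ, E) I (extChartAt I x₀).symm y w] :=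
  congrArg (α ((extChartAt I x₀).symm y)) (by funext i; fin_cases i; rfl)

omit [I.Boundaryless] in
lemma chartRep_apply_two (α : DForm I M 2) (x₀ : M) (y v w : E) :
    chartRep I α x₀ y ![v, w] =
      α ((extChartAt I x₀).symm y) ![mfderiv 𝓘(ℝ, E) I (extChartAt I x₀).symm y v,
        mfderiv 𝓘(ℝ, E) I (extChartAt I x₀).symm y w] :=
  congrArg (α ((extChartAt I x₀).symm y)) (by funext i; fin_cases i <;> rfl)

omit [I.Boundaryless] in
lemma interior_apply_one (X : VField I M) (α : DForm I M 2) (x : M) (w : TangentSpace I x) :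
    interior I X α x ![w] = α x ![X x, w] := rfl

/-- A vector field read in the preferred chart around `x₀`. -/
def vfRep (I : ModelWithCorners ℝ E H) (X : VField I M) (x₀ : M) (y : E) : E :=
  mfderiv I 𝓘(ℝ, E) (extChartAt I x₀) ((extChartAt I x₀).symm y) (X ((extChartAt I x₀).symm y))

omit [I.Boundaryless] in
-- The tangent bundle trivialization at `x₀` is, fibrewise, the differential of the chart at `x₀`.
-- Smoothness as a section thus becomes smoothness of the coordinate expression.
lemma isSmoothVField_iff [IsManifold I ∞ M] {X : VField I M} :
    IsSmoothVField I X ↔ ∀ x₀, ContDiffOn ℝ ∞ (vfRep I X x₀) (extChartAt I x₀).target := by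
  have key (x₀ : M) : ContMDiffOn I I.tangent ∞ (fun x ↦ (⟨x, X x⟩ : TangentBundle I M))
      (extChartAt I x₀).source ↔ ContDiffOn ℝ ∞ (vfRep I X x₀) (extChartAt I x₀).target := by
    have hb : (trivializationAt E (TangentSpace I) x₀).baseSet = (extChartAt I x₀).source := by
      rw [TangentBundle.trivializationAt_baseSet, extChartAt_source]
    have h1 : ContMDiffOn I I.tangent ∞ (fun x ↦ (⟨x, X x⟩ : TangentBundle I M))
        (extChartAt I x₀).source ↔
        ContMDiffOn I 𝓘(ℝ, E) ∞ (fun x ↦ (mfderiv I 𝓘(ℝ, E) (extChartAt I x₀) x (X x) : E))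
          (extChartAt I x₀).source := by
      have := (trivializationAt E (TangentSpace I) x₀).contMDiffOn_section_baseSet_iff
        (IB := I) (n := ∞) (s := X)
      rw [hb] at this
      refine this.trans (contMDiffOn_congr fun x hx ↦ ?_)
      rw [extChartAt_source] at hx
      rw [← TangentBundle.continuousLinearMapAt_trivializationAt hx]
      exact ((trivializationAt E (TangentSpace I) x₀).coe_linearMapAt_of_mem (R := ℝ)
        (by simpa using hx) ▸ rfl)
    rw [h1, ← contMDiffOn_iff_contDiffOn]
    constructor
    · intro h
      exact h.comp (contMDiffOn_extChartAt_symm x₀) fun y hy ↦ (extChartAt I x₀).map_target hy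
    · intro h
      have h2 : ContMDiffOn I 𝓘(ℝ, E) ∞ (extChartAt I x₀) (extChartAt I x₀).source :=
        fun x hx ↦ (contMDiffAt_chart hx).contMDiffWithinAt
      refine (h.comp h2 fun x hx ↦ (extChartAt I x₀).map_source hx).congr fun x hx ↦ ?_
      rw [Function.comp_apply, vfRep, (extChartAt I x₀).left_inv hx]
  constructor
  · intro h x₀
    exact (key x₀).1 h.contMDiffOn
  · intro h x
    exact ((key x).2 (h x)).contMDiffAt (extChartAt_source_mem_nhds x)

lemma contDiff_curryLeft :
    ContDiff ℝ ∞ (fun b : E [⋀^Fin 2]→L[ℝ] ℝ ↦ ContinuousAlternatingMap.curryLeft (n := 1) b) := by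
  exact LinearIsometry.contDiff (𝕜 := ℝ) (E := E [⋀^Fin 2]→L[ℝ] ℝ) (F := E →L[ℝ] E [⋀^Fin 1]→L[ℝ] ℝ)
    (ContinuousAlternatingMap.curryLeftLI (𝕜 := ℝ) (E := E) (F := ℝ) (n := 1))

lemma IsSmoothForm.interior [IsManifold I ∞ M] {X : VField I M} {α : DForm I M 2}
    (hα : IsSmoothForm I α) (hX : IsSmoothVField I X) : IsSmoothForm I (interior I X α) := by
  intro x₀
  have h1 : ContDiffOn ℝ ∞ (fun y ↦ (chartRep I α x₀ y).curryLeft (vfRep I X x₀ y))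
      (extChartAt I x₀).target :=
    (contDiff_curryLeft.comp_contDiffOn (hα x₀)).clm_apply (isSmoothVField_iff.1 hX x₀)
  refine h1.congr fun y hy ↦ ?_
  apply (toLin E).injective
  ext w
  rw [toLin_apply, toLin_apply, chartRep_apply_one]
  refine Eq.trans ?_ (chartRep_apply_two α x₀ y _ w).symm
  rw [vfRep, mfderiv_symm_mfderiv_chart hy]
  rfl

/-- A two-form on a vector space as a linear map to the dual. -/
def flat (b : E [⋀^Fin 2]→L[ℝ] ℝ) : E →L[ℝ] (E →L[ℝ] ℝ) :=
  ((toLin E).toContinuousLinearEquiv : (E [⋀^Fin 1]→L[ℝ] ℝ) →L[ℝ] (E →L[ℝ] ℝ)).comp b.curryLeft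

lemma flat_apply (b : E [⋀^Fin 2]→L[ℝ] ℝ) (v w : E) : flat b v w = b ![v, w] :=
  toLin_apply _ _

/-- Nondegeneracy is injectivity of v ↦ b(v, ·), and a finite-dimensional space and its dual have
equal dimension. -/
lemma exists_flat_eq [FiniteDimensional ℝ E] {b : E [⋀^Fin 2]→L[ℝ] ℝ}
    (hb : ∀ v, (∀ w, b ![v, w] = 0) → v = 0) :
    ∃ e : E ≃L[ℝ] (E →L[ℝ] ℝ), (e : E →L[ℝ] (E →L[ℝ] ℝ)) = flat b := by
  have hinj : Function.Injective (flat b : E →ₗ[ℝ] (E →L[ℝ] ℝ)) := by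
    rw [← LinearMap.ker_eq_bot, LinearMap.ker_eq_bot']
    intro v hv
    exact hb v fun w ↦ by rw [← flat_apply]; exact DFunLike.congr_fun hv w
  have hdim : Module.finrank ℝ E = Module.finrank ℝ (E →L[ℝ] ℝ) := by
    rw [← (LinearMap.toContinuousLinearMap (𝕜 := ℝ) (E := E) (F' := ℝ)).finrank_eq]
    exact Subspace.dual_finrank_eq.symm
  refine ⟨(LinearEquiv.ofInjectiveOfFinrankEq (flat b : E →ₗ[ℝ] (E →L[ℝ] ℝ)) hinj
    hdim).toContinuousLinearEquiv, ?_⟩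
  ext v w
  rfl

lemma exists_eq_of_nondegenerate [FiniteDimensional ℝ E] {b : E [⋀^Fin 2]→L[ℝ] ℝ}
    (hb : ∀ v, (∀ w, b ![v, w] = 0) → v = 0) (a : E [⋀^Fin 1]→L[ℝ] ℝ) :
    ∃ v, ∀ w, b ![v, w] = a ![w] := by
  obtain ⟨e, he⟩ := exists_flat_eq hb
  refine ⟨e.symm (toLin E a), fun w ↦ ?_⟩
  rw [← flat_apply, ← he, e.coe_coe, e.apply_symm_apply, toLin_apply]

/-- The vector field dual to a one-form under a symplectic form. -/
lemma IsSymplecticForm.exists_interior_eq [FiniteDimensional ℝ E] [IsManifold I ∞ M]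
    {Ω : DForm I M 2} (hΩ : IsSymplecticForm I Ω) {α : DForm I M 1} (hα : IsSmoothForm I α) :
    ∃ X : VField I M, IsSmoothVField I X ∧ interior I X Ω = α := by
  have hpt (x : M) : ∃ v : TangentSpace I x, ∀ w : TangentSpace I x, Ω x ![v, w] = α x ![w] := by
    exact exists_eq_of_nondegenerate (E := E) (b := Ω x) (hΩ.nondegenerate x) (α x)
  choose X hX using hpt
  refine ⟨X, isSmoothVField_iff.2 fun x₀ y hy ↦ ContDiffAt.contDiffWithinAt ?_, ?_⟩
  · have hnd (y : E) (hy : y ∈ (extChartAt I x₀).target) (v : E)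
        (hv : ∀ w, chartRep I Ω x₀ y ![v, w] = 0) : v = 0 := by
      rw [← mfderiv_chart_mfderiv_symm (I := I) hy v, hΩ.nondegenerate _
        (mfderiv 𝓘(ℝ, E) I (extChartAt I x₀).symm y v), map_zero]
      · rfl
      intro w
      rw [← mfderiv_symm_mfderiv_chart hy w]
      exact (chartRep_apply_two Ω x₀ y v _).symm.trans (hv _)
    obtain ⟨e, he⟩ := exists_flat_eq (hnd y hy)
    have hflat : ContDiffAt ℝ ∞ (fun y ↦ flat (chartRep I Ω x₀ y)) y := by
      have h1 : ContDiffAt ℝ ∞ (fun y ↦ (chartRep I Ω x₀ y).curryLeft) y :=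
        contDiff_curryLeft.contDiffAt.comp y (hΩ.smooth.contDiffAt hy)
      exact contDiffAt_const.clm_comp h1
    -- Inversion of continuous linear maps is smooth at an invertible one, so solving for the vector
    -- in coordinates preserves smoothness.
    have hinv : ContDiffAt ℝ ∞ (fun y ↦ (flat (chartRep I Ω x₀ y)).inverse
        (toLin E (chartRep I α x₀ y))) y := by
      refine ContDiffAt.clm_apply ?_ ((toLin E).contDiff.contDiffAt.comp y (hα.contDiffAt hy))
      have := contDiffAt_map_inverse (n := ∞) e
      rw [he] at this
      exact this.comp y hflat
    refine hinv.congr_of_eventuallyEq ?_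
    filter_upwards [eventually_mem_chart_target hy] with y' hy'
    obtain ⟨e', he'⟩ := exists_flat_eq (hnd y' hy')
    rw [← he', ContinuousLinearMap.inverse_equiv, ContinuousLinearEquiv.coe_coe,
      ContinuousLinearEquiv.eq_symm_apply, ← e'.coe_coe, he']
    ext w
    rw [flat_apply, toLin_apply, chartRep_apply_one, chartRep_apply_two, vfRep,
      mfderiv_symm_mfderiv_chart hy', hX]
  · funext x
    refine ContinuousAlternatingMap.ext fun v ↦ ?_
    have hv : v = ![v 0] := by funext i; fin_cases i; rfl
    rw [hv]
    exact hX x (v 0)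

lemma extD_interior_one [IsManifold I ∞ M] {X : VField I M} {α : DForm I M 1}
    (hg : ContMDiff I 𝓘(ℝ, ℝ) ∞ (fun x ↦ α x ![X x])) :
    extD I (interior I X α) = dFun I (fun x ↦ α x ![X x]) := by
  funext x
  refine ContinuousAlternatingMap.ext fun (v : Fin 1 → E) ↦ ?_
  refine (extD_apply _ x v).trans ?_
  have h1 : chartRep I (interior I X α) x = fun y ↦
      ContinuousAlternatingMap.constOfIsEmpty ℝ E (Fin 0)
        (α ((extChartAt I x).symm y) ![X ((extChartAt I x).symm y)]) := by
    funext y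
    refine ContinuousAlternatingMap.ext fun w ↦ ?_
    exact congrArg (α ((extChartAt I x).symm y)) (by funext i; fin_cases i; rfl)
  rw [h1, extDeriv_constOfIsEmpty]
  refine Eq.trans ?_ (chartRep_self (dFun I _) x v)
  rw [chartRep_dFun hg (mem_extChartAt_target x)]
  rfl

end VectorFields

/-! ### From a smooth bijection to a diffeomorphism -/

section InverseFunction

variable {E H : Type*} [NormedAddCommGroup E] [NormedSpace ℝ E] [TopologicalSpace H]
  {I : ModelWithCorners ℝ E H} [I.Boundaryless]
  {M : Type*} [TopologicalSpace M] [ChartedSpace H M]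
  {E' H' : Type*} [NormedAddCommGroup E'] [NormedSpace ℝ E'] [TopologicalSpace H']
  {I' : ModelWithCorners ℝ E' H'} [I'.Boundaryless]
  {M' : Type*} [TopologicalSpace M'] [ChartedSpace H' M']

omit [I'.Boundaryless] in
lemma fderiv_inCharts_self [IsManifold I ∞ M] [IsManifold I' ∞ M'] {f : M → M'} {x : M}
    (hf : ContMDiffAt I I' ∞ f x) (v : E) :
    fderiv ℝ (inCharts I I' f x (f x)) (extChartAt I x x) v = (mfderiv I I' f x v : E') := by
  have h1 : mfderiv I I' f x = fderivWithin ℝ (writtenInExtChartAt I I' x f) (Set.range I)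
      (extChartAt I x x) := (hf.mdifferentiableAt (by simp)).mfderiv
  rw [I.range_eq_univ, fderivWithin_univ] at h1
  exact (DFunLike.congr_fun h1 v).symm

omit [I.Boundaryless] [I'.Boundaryless] in
lemma mfderiv_congr_base (f : M → M') {p q : M} (h : p = q) (v : E) :
    (mfderiv I I' f p v : E') = mfderiv I I' f q v := by
  subst h; rfl

omit [I'.Boundaryless] in
/-- A smooth bijection whose differentials are isomorphisms is a diffeomorphism. -/
lemma exists_diffeomorph_of_bijective [CompleteSpace E] [IsManifold I ∞ M] [IsManifold I' ∞ M']
    {f : M → M'} (hf : ContMDiff I I' ∞ f) (hbij : Function.Bijective f)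
    (h' : ∀ x, ∃ e : E ≃L[ℝ] E', ∀ v : E, (mfderiv I I' f x v : E') = e v) :
    ∃ Φ : Diffeomorph I I' M M' ∞, ⇑Φ = f := by
  let G := (Equiv.ofBijective f hbij).symm
  have hG : ∀ x, G (f x) = x := (Equiv.ofBijective f hbij).symm_apply_apply
  have hsmooth : ContMDiff I' I ∞ G := by
    intro z
    obtain ⟨x, rfl⟩ := hbij.2 z
    obtain ⟨e, he⟩ := h' x
    have hy : extChartAt I x x ∈ (extChartAt I x).target := mem_extChartAt_target x
    have hx : (extChartAt I x).symm (extChartAt I x x) = x := extChartAt_to_inv x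
    set g := inCharts I I' f x (f x) with hgdef
    have hgx : g (extChartAt I x x) = extChartAt I' (f x) (f x) := by rw [hgdef, inCharts, hx]
    have hg : ContDiffAt ℝ ∞ g (extChartAt I x x) :=
      contDiffAt_inCharts hy (hf _) (by rw [hx]; exact mem_extChartAt_source (f x))
    have hg' : HasFDerivAt g (e : E →L[ℝ] E') (extChartAt I x x) := by
      have : (e : E →L[ℝ] E') = fderiv ℝ g (extChartAt I x x) := by
        ext v
        rw [fderiv_inCharts_self (hf x)]
        exact (he v).symm
      rw [this]
      exact (hg.differentiableAt (by simp)).hasFDerivAt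
    set l := hg.localInverse hg' (by simp)
    have hl : ContDiffAt ℝ ∞ l (extChartAt I' (f x) (f x)) := by
      rw [← hgx]; exact hg.to_localInverse hg' (by simp)
    have hlx : l (extChartAt I' (f x) (f x)) = extChartAt I x x := by
      rw [← hgx]; exact hg.localInverse_apply_image hg' (by simp)
    have hgl : ∀ᶠ z in nhds (extChartAt I' (f x) (f x)), g (l z) = z := by
      rw [← hgx]
      exact (hg.hasStrictFDerivAt' hg' (by simp)).eventually_right_inverse
    have hκ : ContMDiffAt I' 𝓘(ℝ, E') ∞ (extChartAt I' (f x)) (f x) := contMDiffAt_extChartAt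
    have hlκ : ContMDiffAt I' 𝓘(ℝ, E) ∞ (fun z ↦ l (extChartAt I' (f x) z)) (f x) :=
      (contMDiffAt_iff_contDiffAt.2 hl).comp (f x) hκ
    have hσ : ContMDiffAt I' I ∞
        (fun z ↦ (extChartAt I x).symm (l (extChartAt I' (f x) z))) (f x) := by
      refine ContMDiffAt.comp (g := (extChartAt I x).symm) (f x) ?_ hlκ
      rw [hlx]
      exact contMDiffAt_chart_symm hy
    -- The global inverse agrees near `f x` with the local inverse read in charts: f sends the local
    -- candidate back to z, and `G` undoes f.
    refine hσ.congr_of_eventuallyEq ?_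
    have hfσ : ContinuousAt (fun z ↦ f ((extChartAt I x).symm (l (extChartAt I' (f x) z)))) (f x) :=
      hf.continuous.continuousAt.comp hσ.continuousAt
    have hsrc : ∀ᶠ z in nhds (f x), f ((extChartAt I x).symm (l (extChartAt I' (f x) z))) ∈
        (extChartAt I' (f x)).source := by
      refine hfσ.eventually ?_
      simp only [hlx, hx]
      exact extChartAt_source_mem_nhds _
    filter_upwards [hsrc, extChartAt_source_mem_nhds (I := I') (f x),
      hκ.continuousAt.eventually hgl] with z h1 h2 h3
    have h4 : f ((extChartAt I x).symm (l (extChartAt I' (f x) z))) = z :=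
      (extChartAt I' (f x)).injOn h1 h2 h3
    rw [← hG ((extChartAt I x).symm (l (extChartAt I' (f x) z))), h4]
  exact ⟨⟨Equiv.ofBijective f hbij, hf, hsmooth⟩, rfl⟩

end InverseFunction

/-! ### Submersions: fibre dimension and surjectivity of the differential -/

section Submersion

variable {E H : Type*} [NormedAddCommGroup E] [NormedSpace ℝ E] [TopologicalSpace H]
  {I : ModelWithCorners ℝ E H} [I.Boundaryless]
  {M : Type*} [TopologicalSpace M] [ChartedSpace H M]
  {E' H' : Type*} [NormedAddCommGroup E'] [NormedSpace ℝ E'] [TopologicalSpace H']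
  {I' : ModelWithCorners ℝ E' H'} [I'.Boundaryless]
  {M' : Type*} [TopologicalSpace M'] [ChartedSpace H' M']

/-- A continuous function that is injective on an open subset of a real normed space forces
the space to be at most one-dimensional. -/
lemma finrank_le_one_of_injOn {F : Type*} [NormedAddCommGroup F] [NormedSpace ℝ F]
    [FiniteDimensional ℝ F] {U : Set F} (hU : IsOpen U) {b : F} (hb : b ∈ U) {k : F → ℝ}
    (hk : ContinuousOn k U) (hinj : Set.InjOn k U) : Module.finrank ℝ F ≤ 1 := by
  by_contra! hF
  have hrank : 1 < Module.rank ℝ F := by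
    rw [← Module.finrank_eq_rank]; exact_mod_cast hF
  have : Nontrivial F := Module.nontrivial_of_finrank_pos (R := ℝ) (by omega)
  obtain ⟨r, hr, hball⟩ := Metric.isOpen_iff.1 hU b hb
  have hmem (v : F) (hv : v ∈ Metric.sphere (0 : F) (r / 2)) : b + v ∈ U ∧ b - v ∈ U := by
    rw [mem_sphere_zero_iff_norm] at hv
    constructor <;> apply hball <;> simp [hv, dist_eq_norm] <;> linarith
  -- This function is odd on a sphere, which is connected in dimension at least two, so it has a
  -- zero there. A zero w gives k(b+w) = k(b-w), hence w = 0 by injectivity, although w lies on a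
  -- sphere of positive radius.
  set g : F → ℝ := fun v ↦ k (b + v) - k (b - v)
  have hg : ContinuousOn g (Metric.sphere (0 : F) (r / 2)) :=
    (hk.comp (by fun_prop) fun v hv ↦ (hmem v hv).1).sub
      (hk.comp (by fun_prop) fun v hv ↦ (hmem v hv).2)
  obtain ⟨v, hv⟩ := NormedSpace.sphere_nonempty (E := F) (x := 0) (r := r / 2) |>.2 (by positivity)
  have hv' : -v ∈ Metric.sphere (0 : F) (r / 2) := by simpa using hv
  have hodd : g (-v) = - g v := by simp [g, ← sub_eq_add_neg]
  have hpre := isPreconnected_sphere hrank (0 : F) (r / 2)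
  obtain ⟨w, hw, hw0⟩ : ∃ w ∈ Metric.sphere (0 : F) (r / 2), g w = 0 := by
    rcases le_total (g v) 0 with h | h
    · exact hpre.intermediate_value hv hv' hg ⟨h, by rw [hodd]; linarith⟩
    · exact hpre.intermediate_value hv' hv hg ⟨by rw [hodd]; linarith, h⟩
  have h1 := hinj (hmem w hw).1 (hmem w hw).2 (sub_eq_zero.1 hw0)
  have h2 : w = 0 := by
    have h3 : (2 : ℝ) • w = 0 := by
      rw [two_smul, ← sub_self (b + w)]
      nth_rw 2 [h1]
      abel
    simpa using h3
  rw [h2, mem_sphere_zero_iff_norm, norm_zero] at hw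
  linarith

omit [I'.Boundaryless] in
-- In the normal form of the submersion the complement directions sweep out a slice of the fibre. A
-- continuous function injective on fibres restricts to an injective function on an open subset of
-- the complement, which therefore has dimension at most one.
lemma finrank_le_of_isSubmersion [FiniteDimensional ℝ E] [FiniteDimensional ℝ E']
    {π : M → M'} (hπ : IsSubmersion I I' ∞ π) (x : M)
    {u : M → ℝ} (hu : Continuous u) (hinj : ∀ x y, π x = π y → u x = u y → x = y) :
    Module.finrank ℝ E ≤ Module.finrank ℝ E' + 1 := by
  have h := hπ.isSubmersionAt x
  have : FiniteDimensional ℝ (E' × h.complement) :=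
    Module.Finite.equiv h.equiv.toLinearEquiv
  have : FiniteDimensional ℝ h.complement :=
    Module.Finite.of_surjective (LinearMap.snd ℝ E' h.complement) LinearMap.snd_surjective
  rw [h.equiv.toLinearEquiv.finrank_eq, Module.finrank_prod]
  gcongr
  set y₀ := h.domChart.extend I x
  set a := (h.equiv y₀).1
  set j : h.complement → E := fun b ↦ h.equiv.symm (a, b)
  have hj : Continuous j := by fun_prop
  have hopen : IsOpen (h.domChart.extend I).target := h.domChart.isOpen_extend_target
  have hsrc (y : E) (hy : y ∈ (h.domChart.extend I).target) :
      (h.domChart.extend I).symm y ∈ h.domChart.source := by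
    have := (h.domChart.extend I).map_target hy
    rwa [h.domChart.extend_source] at this
  refine finrank_le_one_of_injOn (U := j ⁻¹' (h.domChart.extend I).target) (hopen.preimage hj)
    (b := (h.equiv y₀).2) (k := fun b ↦ u ((h.domChart.extend I).symm (j b))) ?_ ?_ ?_
  · have : j (h.equiv y₀).2 = y₀ := by simp [j, a]
    rw [Set.mem_preimage, this]
    exact (h.domChart.extend I).map_source
      (by rw [h.domChart.extend_source]; exact h.mem_domChart_source)
  · refine hu.comp_continuousOn ?_
    exact (h.domChart.continuousOn_extend_symm (I := I)).comp hj.continuousOn fun b hb ↦ hb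
  · have hcod (b : h.complement) (hb : j b ∈ (h.domChart.extend I).target) :
        (h.codChart.extend I') (π ((h.domChart.extend I).symm (j b))) = a := by
      refine (h.writtenInCharts hb).trans ?_
      simp [j]
    intro b hb b' hb' hbb
    have h1 : π ((h.domChart.extend I).symm (j b)) = π ((h.domChart.extend I).symm (j b')) := by
      refine (h.codChart.extend I').injOn ?_ ?_ ((hcod b hb).trans (hcod b' hb').symm)
      · rw [h.codChart.extend_source]
        exact h.source_subset_preimage_source (hsrc _ hb)
      · rw [h.codChart.extend_source]
        exact h.source_subset_preimage_source (hsrc _ hb')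
    have h2 := (h.domChart.extend I).symm.injOn hb hb' (hinj _ _ h1 hbb)
    simpa [j] using h2

omit [I'.Boundaryless] in
lemma mfderiv_surjective_of_isSubmersion [IsManifold I ∞ M] [IsManifold I' ∞ M']
    {π : M → M'} (hπ : IsSubmersion I I' ∞ π) (x : M) :
    Function.Surjective (mfderiv I I' π x) := by
  have h := hπ.isSubmersionAt x
  set y₀ := h.domChart.extend I x with hy₀
  have hx0 : x ∈ (h.domChart.extend I).source := by
    rw [h.domChart.extend_source]; exact h.mem_domChart_source
  have hπx : π x ∈ (h.codChart.extend I').source := by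
    rw [h.codChart.extend_source]; exact h.mem_codChart_source
  have hy : y₀ ∈ (h.domChart.extend I).target := (h.domChart.extend I).map_source hx0
  have hyx : (h.domChart.extend I).symm y₀ = x := (h.domChart.extend I).left_inv hx0
  have hopen : IsOpen (h.domChart.extend I).target := h.domChart.isOpen_extend_target
  -- Freezing the complement coordinate at its value at x gives a smooth local section of π through
  -- x. Differentiating π ∘ section = id then provides preimages of tangent vectors.
  set j : M' → E := fun c ↦ h.equiv.symm (h.codChart.extend I' c, (h.equiv y₀).2)
  have hjx : j (π x) = y₀ := by
    have h1 := h.writtenInCharts hy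
    simp only [Function.comp_apply, hyx] at h1
    simp only [j, h1, Prod.mk.eta, ContinuousLinearEquiv.symm_apply_apply]
  have hj : ContMDiffAt I' 𝓘(ℝ, E) ∞ j (π x) := by
    have h1 : ContMDiffAt I' 𝓘(ℝ, E') ∞ (h.codChart.extend I') (π x) :=
      h.codChart.contMDiffAt_extend h.codChart_mem_maximalAtlas h.mem_codChart_source
    have h2 : ContDiff ℝ ∞ (fun a : E' ↦ h.equiv.symm (a, (h.equiv y₀).2)) := by fun_prop
    exact h2.contMDiff.contMDiffAt.comp (π x) h1
  have hs : ContMDiffAt I' I ∞ (fun c ↦ (h.domChart.extend I).symm (j c)) (π x) := by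
    refine ContMDiffAt.comp (g := (h.domChart.extend I).symm) (π x) ?_ hj
    rw [hjx]
    exact (contMDiffOn_extend_symm h.domChart_mem_maximalAtlas).contMDiffAt (by
      rw [← h.domChart.extend_target']; exact hopen.mem_nhds hy)
  have hsec : (π ∘ fun c ↦ (h.domChart.extend I).symm (j c)) =ᶠ[nhds (π x)] id := by
    have h1 : ∀ᶠ c in nhds (π x), j c ∈ (h.domChart.extend I).target :=
      hj.continuousAt.eventually (by rw [hjx]; exact hopen.mem_nhds hy)
    have h2 : ∀ᶠ c in nhds (π x), c ∈ (h.codChart.extend I').source :=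
      (h.codChart.isOpen_extend_source).mem_nhds hπx
    filter_upwards [h1, h2] with c hc hc'
    refine (h.codChart.extend I').injOn ?_ hc' ((h.writtenInCharts hc).trans ?_)
    · rw [h.codChart.extend_source]
      refine h.source_subset_preimage_source ?_
      have := (h.domChart.extend I).map_target hc
      rwa [h.domChart.extend_source] at this
    · simp [j]
  intro w
  have hx : (h.domChart.extend I).symm (j (π x)) = x := by rw [hjx, hyx]
  have h1 := mfderiv_comp_of_eq (x := π x) (y := x) (f := fun c ↦ (h.domChart.extend I).symm (j c))
    (hπ.contMDiff.contMDiffAt.mdifferentiableAt (by simp)) (hs.mdifferentiableAt (by simp)) hx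
  rw [hsec.mfderiv_eq, mfderiv_id] at h1
  exact ⟨_, (mfderiv_congr_base π hx _).symm.trans (DFunLike.congr_fun h1 w).symm⟩

end Submersion

/-! ### Orbit quotients and the trivialization by log|ρ| -/

section OrbitQuotient

variable {E H : Type*} [NormedAddCommGroup E] [NormedSpace ℝ E] [TopologicalSpace H]
  {I : ModelWithCorners ℝ E H}
  {M : Type*} [TopologicalSpace M] [ChartedSpace H M]
  {E' H' : Type*} [NormedAddCommGroup E'] [NormedSpace ℝ E'] [TopologicalSpace H']
  {I' : ModelWithCorners ℝ E' H'}
  {M' : Type*} [TopologicalSpace M'] [ChartedSpace H' M']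
  {D : VField I M} {π : M → M'} {ρ : M → ℝ}

lemma HasMFDerivAt.comp_curve {γ : ℝ → M} {t : ℝ} {v : TangentSpace I (γ t)} {f : M → M'}
    (hγ : HasMFDerivAt 𝓘(ℝ, ℝ) I γ t ((1 : ℝ →L[ℝ] ℝ).smulRight v))
    (hf : MDifferentiableAt I I' f (γ t)) :
    HasMFDerivAt 𝓘(ℝ, ℝ) I' (f ∘ γ) t
      ((1 : ℝ →L[ℝ] ℝ).smulRight (mfderiv I I' f (γ t) v)) := by
  have h := hf.hasMFDerivAt.comp t hγ
  have heq : (mfderiv I I' f (γ t)).comp ((1 : ℝ →L[ℝ] ℝ).smulRight v) =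
      (1 : ℝ →L[ℝ] ℝ).smulRight (mfderiv I I' f (γ t) v) :=
    ContinuousLinearMap.ext fun (s : ℝ) ↦ (mfderiv I I' f (γ t)).map_smul s v
  exact heq ▸ h

lemma IsScalingFunction.hasDerivAt_comp (hρ : IsScalingFunction I D ρ) {γ : ℝ → M}
    (hγ : IsMIntegralCurve γ D) (t : ℝ) : HasDerivAt (fun t ↦ ρ (γ t)) (ρ (γ t)) t := by
  have h := HasMFDerivAt.comp_curve (I' := 𝓘(ℝ, ℝ)) (hγ t)
    ((hρ.smooth (γ t)).mdifferentiableAt (by simp))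
  have h1 : HasFDerivAt (fun t ↦ ρ (γ t))
      ((1 : ℝ →L[ℝ] ℝ).smulRight (lieFun I D ρ (γ t))) t := hasMFDerivAt_iff_hasFDerivAt.1 h
  exact h1.hasDerivAt.congr_deriv ((one_smul ℝ _).trans (hρ.eq (γ t)))

/-- The function e^{-t} ρ(γ(t)) has zero derivative. -/
lemma IsScalingFunction.comp_integralCurve (hρ : IsScalingFunction I D ρ) {γ : ℝ → M}
    (hγ : IsMIntegralCurve γ D) (t : ℝ) : ρ (γ t) = Real.exp t * ρ (γ 0) := by
  have h (s : ℝ) : HasDerivAt (fun t ↦ Real.exp (-t) * ρ (γ t)) 0 s :=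
    ((hasDerivAt_neg s).exp.fun_mul (hρ.hasDerivAt_comp hγ s)).congr_deriv (by ring)
  have h1 := is_const_of_deriv_eq_zero (fun s ↦ (h s).differentiableAt) (fun s ↦ (h s).deriv) t 0
  simp only [neg_zero, Real.exp_zero, one_mul] at h1
  rw [← h1, ← mul_assoc, ← Real.exp_add, add_neg_cancel, Real.exp_zero, one_mul]

lemma IsScalingFunction.log_comp_integralCurve (hρ : IsScalingFunction I D ρ)
    (hρ0 : ∀ m, ρ m ≠ 0) {γ : ℝ → M} (hγ : IsMIntegralCurve γ D) (t : ℝ) :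
    Real.log (ρ (γ t)) = Real.log (ρ (γ 0)) + t := by
  rw [hρ.comp_integralCurve hγ, Real.log_mul (Real.exp_pos t).ne' (hρ0 _), Real.log_exp, add_comm]

lemma IsOrbitQuotient.exists_integralCurve (hπ : IsOrbitQuotient I I' D π) (m : M) :
    ∃ γ : ℝ → M, IsMIntegralCurve γ D ∧ γ 0 = m := by
  obtain ⟨γ, h, h0, -⟩ := (hπ.fibres m m).1 rfl
  exact ⟨γ, h, h0⟩

lemma IsOrbitQuotient.comp_integralCurve (hπ : IsOrbitQuotient I I' D π) {γ : ℝ → M}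
    (hγ : IsMIntegralCurve γ D) (t : ℝ) : π (γ t) = π (γ 0) :=
  ((hπ.fibres (γ 0) (γ t)).2 ⟨γ, hγ, rfl, t, rfl⟩).symm

lemma IsOrbitQuotient.contMDiff [IsManifold I ∞ M] [IsManifold I' ∞ M']
    (hπ : IsOrbitQuotient I I' D π) : ContMDiff I I' ∞ π :=
  IsSubmersion.contMDiff hπ.submersion

lemma IsOrbitQuotient.mfderiv_apply_self [IsManifold I ∞ M] [IsManifold I' ∞ M']
    (hπ : IsOrbitQuotient I I' D π) (m : M) :
    mfderiv I I' π m (D m) = 0 := by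
  obtain ⟨γ, hγ, rfl⟩ := hπ.exists_integralCurve m
  have h := HasMFDerivAt.comp_curve (I' := I') (hγ 0)
    ((hπ.contMDiff (γ 0)).mdifferentiableAt (by simp))
  have h1 : π ∘ γ = fun _ ↦ π (γ 0) := funext fun t ↦ hπ.comp_integralCurve hγ t
  have h2 : HasMFDerivAt 𝓘(ℝ, ℝ) I' (π ∘ γ) 0 0 := by
    rw [h1]; exact hasMFDerivAt_const _ _
  have h3 := hasMFDerivAt_unique h h2
  exact (one_smul ℝ _).symm.trans (DFunLike.congr_fun h3 (1 : ℝ))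

/-- On an orbit, log|ρ| increases by exactly the elapsed time, so equal values force elapsed time
zero. No uniqueness theorem for integral curves is needed. -/
lemma IsOrbitQuotient.eq_of_log_eq (hπ : IsOrbitQuotient I I' D π)
    (hρ : IsScalingFunction I D ρ) (hρ0 : ∀ m, ρ m ≠ 0) {x y : M} (h : π x = π y)
    (hl : Real.log (ρ x) = Real.log (ρ y)) : x = y := by
  obtain ⟨γ, hγ, rfl, t, rfl⟩ := (hπ.fibres x y).1 h
  rw [hρ.log_comp_integralCurve hρ0 hγ t] at hl
  rw [show t = 0 by linarith]

lemma IsScalingFunction.ne_zero (hρ : IsScalingFunction I D ρ) (hρ0 : ∀ m, ρ m ≠ 0) (m : M) :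
    D m ≠ 0 := by
  intro h
  have := hρ.eq m
  rw [lieFun, dFun_apply, h, map_zero] at this
  exact hρ0 m this.symm

lemma IsScalingFunction.contMDiff_log (hρ : IsScalingFunction I D ρ) (hρ0 : ∀ m, ρ m ≠ 0) :
    ContMDiff I 𝓘(ℝ, ℝ) ∞ (fun m ↦ Real.log (ρ m)) := fun m ↦
  (Real.contDiffAt_log.2 (hρ0 m)).contMDiffAt.comp m (hρ.smooth m)

lemma dFun_log {f : M → ℝ} {m : M} (hf : MDifferentiableAt I 𝓘(ℝ, ℝ) f m)
    (h0 : f m ≠ 0) (v : TangentSpace I m) :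
    dFun I (fun m ↦ Real.log (f m)) m ![v] = (f m)⁻¹ * dFun I f m ![v] := by
  have h1 := (Real.hasDerivAt_log h0).hasFDerivAt.hasMFDerivAt.comp m hf.hasMFDerivAt
  have h2 := DFunLike.congr_fun h1.mfderiv v
  refine Eq.trans h2 ?_
  exact mul_comm _ _

/-- The kernel of the differential of an orbit projection is spanned by the vector field. -/
lemma IsOrbitQuotient.exists_smul_eq [I.Boundaryless] [FiniteDimensional ℝ E]
    [FiniteDimensional ℝ E']
    [IsManifold I ∞ M] [IsManifold I' ∞ M'] (hπ : IsOrbitQuotient I I' D π)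
    (hρ : IsScalingFunction I D ρ) (hρ0 : ∀ m, ρ m ≠ 0) (m : M) :
    Module.finrank ℝ E = Module.finrank ℝ E' + 1 ∧
    ∀ v : TangentSpace I m, mfderiv I I' π m v = 0 → ∃ c : ℝ, v = c • D m := by
  let A₀ : E →L[ℝ] E' := mfderiv I I' π m
  let A : E →ₗ[ℝ] E' := A₀
  have hsurj : Function.Surjective A := mfderiv_surjective_of_isSubmersion hπ.submersion m
  have hD0 : (D m : E) ≠ 0 := hρ.ne_zero hρ0 m
  have hDA : (D m : E) ∈ LinearMap.ker A := hπ.mfderiv_apply_self m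
  -- This bounds the dimension of ker dπ above by one; the nonzero vector D m in the kernel bounds
  -- it below by one.
  have hle := finrank_le_of_isSubmersion hπ.submersion m (hρ.contMDiff_log hρ0).continuous
    (fun x y h h' ↦ hπ.eq_of_log_eq hρ hρ0 h h')
  have hrn := A.finrank_range_add_finrank_ker
  rw [LinearMap.range_eq_top.2 hsurj, finrank_top] at hrn
  have hpos : 0 < Module.finrank ℝ (LinearMap.ker A) := by
    have : Nontrivial (LinearMap.ker A) :=
      ⟨⟨⟨D m, hDA⟩, 0, fun h ↦ hD0 (congrArg Subtype.val h)⟩⟩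
    exact Module.finrank_pos
  have h1 : Module.finrank ℝ (LinearMap.ker A) = 1 := by omega
  refine ⟨by omega, fun v hv ↦ ?_⟩
  obtain ⟨c, hc⟩ := exists_smul_eq_of_finrank_eq_one h1
    (x := (⟨D m, hDA⟩ : LinearMap.ker A)) (fun h ↦ hD0 (congrArg Subtype.val h))
    (⟨v, hv⟩ : LinearMap.ker A)
  exact ⟨c, (congrArg Subtype.val hc).symm⟩

/-- A scaling function trivializes the orbit projection. -/
theorem IsOrbitQuotient.exists_trivialization [I.Boundaryless] [I'.Boundaryless]
    [FiniteDimensional ℝ E] [FiniteDimensional ℝ E']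
    [IsManifold I ∞ M] [IsManifold I' ∞ M'] (hπ : IsOrbitQuotient I I' D π)
    (hρ : IsScalingFunction I D ρ) (hρ0 : ∀ m, ρ m ≠ 0) :
    ∃ Θ : Diffeomorph I (I'.prod 𝓘(ℝ, ℝ)) M (M' × ℝ) ∞,
      ∀ m, Θ m = (π m, Real.log (ρ m)) := by
  have hlog := hρ.contMDiff_log hρ0
  have hf : ContMDiff I (I'.prod 𝓘(ℝ, ℝ)) ∞ (fun m ↦ (π m, Real.log (ρ m))) :=
    hπ.contMDiff.prodMk hlog
  suffices h : Function.Bijective (fun m ↦ (π m, Real.log (ρ m))) ∧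
      ∀ m, ∃ e : E ≃L[ℝ] E' × ℝ, ∀ v : E,
        (mfderiv I (I'.prod 𝓘(ℝ, ℝ)) (fun m ↦ (π m, Real.log (ρ m))) m v : E' × ℝ) = e v by
    obtain ⟨Θ, hΘ⟩ := exists_diffeomorph_of_bijective hf h.1 h.2
    exact ⟨Θ, fun m ↦ congrFun hΘ m⟩
  refine ⟨⟨?_, ?_⟩, ?_⟩
  · intro x y h
    exact hπ.eq_of_log_eq hρ hρ0 (congrArg Prod.fst h) (congrArg Prod.snd h)
  · rintro ⟨c, u⟩
    obtain ⟨x, rfl⟩ := hπ.surjective c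
    obtain ⟨γ, hγ, rfl⟩ := hπ.exists_integralCurve x
    -- Flow along the orbit for exactly the time needed to bring log|ρ| to the value u.
    refine ⟨γ (u - Real.log (ρ (γ 0))), ?_⟩
    rw [Prod.mk.injEq]
    exact ⟨hπ.comp_integralCurve hγ _, by rw [hρ.log_comp_integralCurve hρ0 hγ]; ring⟩
  · intro m
    obtain ⟨hdim, hker⟩ := hπ.exists_smul_eq hρ hρ0 m
    -- A vector in ker dπ is c·D, and its derivative of log|ρ| is c; hence the differential of (π,
    -- log|ρ|) is injective, and the dimensions match.
    have hzero (v : TangentSpace I m) (hv : mfderiv I I' π m v = 0)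
        (hv' : dFun I (fun m ↦ Real.log (ρ m)) m ![v] = 0) : v = 0 := by
      obtain ⟨c, rfl⟩ := hker v hv
      have h3 : dFun I ρ m ![c • D m] = c * ρ m :=
        (map_smul (mfderiv I 𝓘(ℝ, ℝ) ρ m) c (D m)).trans (congrArg (c * ·) (hρ.eq m))
      rw [dFun_log ((hρ.smooth m).mdifferentiableAt (by simp)) (hρ0 m), h3] at hv'
      have hc0 : c = 0 := by simpa [hρ0 m] using hv'
      rw [hc0, zero_smul]
    let B : E →L[ℝ] E' × ℝ := mfderiv I (I'.prod 𝓘(ℝ, ℝ)) (fun m ↦ (π m, Real.log (ρ m))) m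
    have hB (v : E) : B v = ((mfderiv I I' π m v : E'),
        dFun I (fun m ↦ Real.log (ρ m)) m ![(v : TangentSpace I m)]) :=
      DFunLike.congr_fun (mfderiv_prodMk ((hπ.contMDiff m).mdifferentiableAt (by simp))
        ((hlog m).mdifferentiableAt (by simp))) v
    have hinj : Function.Injective (B : E →ₗ[ℝ] E' × ℝ) := by
      rw [← LinearMap.ker_eq_bot, LinearMap.ker_eq_bot']
      intro v hv
      have hv' : B v = 0 := hv
      rw [hB] at hv'
      exact hzero v (congrArg Prod.fst hv') (congrArg Prod.snd hv')
    refine ⟨(LinearEquiv.ofInjectiveOfFinrankEq (B : E →ₗ[ℝ] E' × ℝ) hinj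
      (by rw [hdim, Module.finrank_prod, Module.finrank_self])).toContinuousLinearEquiv,
      fun v ↦ rfl⟩

end OrbitQuotient

/-! ### Tangent vectors and charts of ℝ × M -/

section Product

variable {E H : Type*} [NormedAddCommGroup E] [NormedSpace ℝ E] [TopologicalSpace H]
  {I : ModelWithCorners ℝ E H}
  {M : Type*} [TopologicalSpace M] [ChartedSpace H M]

/-- The tangent vector `a ∂_t + w` of `ℝ × M`. -/
def prodVec (p : ℝ × M) (a : ℝ) (w : TangentSpace I p.2) :
    TangentSpace (𝓘(ℝ, ℝ).prod I) p :=
  (a, w)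

lemma exists_eq_prodVec (p : ℝ × M) (v : TangentSpace (𝓘(ℝ, ℝ).prod I) p) :
    ∃ a w, v = prodVec p a w := ⟨v.1, v.2, rfl⟩

lemma mfderiv_fst_prodVec (p : ℝ × M) (a : ℝ) (w : TangentSpace I p.2) :
    mfderiv (𝓘(ℝ, ℝ).prod I) 𝓘(ℝ, ℝ) Prod.fst p (prodVec p a w) = a := by
  rw [mfderiv_fst]; rfl

lemma mfderiv_snd_prodVec (p : ℝ × M) (a : ℝ) (w : TangentSpace I p.2) :
    mfderiv (𝓘(ℝ, ℝ).prod I) I Prod.snd p (prodVec p a w) = w := by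
  rw [mfderiv_snd]; rfl

lemma extChartAt_prod_symm_apply (u : ℝ) (c : M) (z : ℝ × E) :
    (extChartAt (𝓘(ℝ, ℝ).prod I) (u, c)).symm z = (z.1, (extChartAt I c).symm z.2) := by
  rw [extChartAt_prod]
  simp only [PartialEquiv.prod_coe_symm, extChartAt_model_space_eq_id, PartialEquiv.refl_symm,
    PartialEquiv.refl_coe, id]

lemma extChartAt_prod_self_apply (u : ℝ) (c : M) :
    extChartAt (𝓘(ℝ, ℝ).prod I) (u, c) (u, c) = (u, extChartAt I c c) := by
  rw [extChartAt_prod]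
  simp only [PartialEquiv.prod_coe, extChartAt_model_space_eq_id, PartialEquiv.refl_coe, id]

/-- The chart of the factor ℝ is the identity at every point, so one chart serves along the whole
line ℝ × {c}. -/
lemma chartRep_prod_congr {k : ℕ} (B : DForm (𝓘(ℝ, ℝ).prod I) (ℝ × M) k) (u : ℝ) (c : M) :
    chartRep (𝓘(ℝ, ℝ).prod I) B (u, c) = chartRep (𝓘(ℝ, ℝ).prod I) B (0, c) := by
  have : extChartAt (𝓘(ℝ, ℝ).prod I) (u, c) = extChartAt (𝓘(ℝ, ℝ).prod I) (0, c) := by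
    rw [extChartAt_prod, extChartAt_prod, extChartAt_model_space_eq_id,
      extChartAt_model_space_eq_id]
  funext y
  unfold chartRep
  rw [this]

lemma mfderiv_chart_symm_prod [I.Boundaryless] [IsManifold I ∞ M] (u : ℝ) (c : M) {z : ℝ × E}
    (hz : z ∈ (extChartAt (𝓘(ℝ, ℝ).prod I) (u, c)).target) :
    mfderiv 𝓘(ℝ, ℝ × E) (𝓘(ℝ, ℝ).prod I) (extChartAt (𝓘(ℝ, ℝ).prod I) (u, c)).symm z
      ((1 : ℝ), (0 : E)) = prodVec _ 1 0 := by
  have hz2 : z.2 ∈ (extChartAt I c).target := by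
    rw [extChartAt_prod] at hz
    exact hz.2
  have hσ : ⇑(extChartAt (𝓘(ℝ, ℝ).prod I) (u, c)).symm =
      fun z : ℝ × E ↦ (z.1, (extChartAt I c).symm z.2) :=
    funext fun z ↦ extChartAt_prod_symm_apply u c z
  have hτ := (contMDiffAt_chart_symm hz2).mdifferentiableAt (n := ∞) (by simp)
  have hs : HasMFDerivAt 𝓘(ℝ, ℝ × E) 𝓘(ℝ, E) (Prod.snd : ℝ × E → E) z
      (ContinuousLinearMap.snd ℝ ℝ E) := hasFDerivAt_snd.hasMFDerivAt
  have hf : HasMFDerivAt 𝓘(ℝ, ℝ × E) 𝓘(ℝ, ℝ) (Prod.fst : ℝ × E → ℝ) z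
      (ContinuousLinearMap.fst ℝ ℝ E) := hasFDerivAt_fst.hasMFDerivAt
  have h1 := hf.prodMk (hτ.hasMFDerivAt.comp z hs)
  have h2 := DFunLike.congr_fun h1.mfderiv ((1 : ℝ), (0 : E))
  rw [hσ]
  refine h2.trans ?_
  exact Prod.ext rfl (map_zero (mfderiv 𝓘(ℝ, E) I (extChartAt I c).symm z.2))

end Product

/-! ### Horizontal invariant one-forms on a cylinder -/

section Cylinder

variable {E H : Type*} [NormedAddCommGroup E] [NormedSpace ℝ E] [TopologicalSpace H]
  {I : ModelWithCorners ℝ E H} [I.Boundaryless]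
  {M : Type*} [TopologicalSpace M] [ChartedSpace H M]

/-- A one-form on a cylinder that is horizontal and invariant is constant along the cylinder. -/
lemma apply_prodVec_eq_of_invariant [IsManifold I ∞ M]
    {B : DForm (𝓘(ℝ, ℝ).prod I) (ℝ × M) 1} (hB : IsSmoothForm (𝓘(ℝ, ℝ).prod I) B)
    (h0 : ∀ p, B p ![prodVec p 1 0] = 0)
    (h1 : ∀ p w, extD (𝓘(ℝ, ℝ).prod I) B p ![prodVec p 1 0, w] = 0) (u : ℝ) (c : M)
    (w : TangentSpace I c) :
    B (u, c) ![prodVec (u, c) 0 w] = B (0, c) ![prodVec (0, c) 0 w] := by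
  set A := chartRep (𝓘(ℝ, ℝ).prod I) B (0, c) with hA
  have hpt (u : ℝ) : (u, extChartAt I c c) ∈
      (extChartAt (𝓘(ℝ, ℝ).prod I) ((0 : ℝ), c)).target := by
    rw [extChartAt_prod, extChartAt_model_space_eq_id]
    exact ⟨trivial, mem_extChartAt_target c⟩
  have hA0 {y : ℝ × E} (hy : y ∈ (extChartAt (𝓘(ℝ, ℝ).prod I) ((0 : ℝ), c)).target) :
      A y ![((1 : ℝ), (0 : E))] = 0 := by
    refine (chartRep_apply_one B (0, c) y ((1 : ℝ), (0 : E))).trans ?_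
    refine Eq.trans ?_ (h0 ((extChartAt (𝓘(ℝ, ℝ).prod I) ((0 : ℝ), c)).symm y))
    exact congrArg (fun v ↦ B ((extChartAt (𝓘(ℝ, ℝ).prod I) ((0 : ℝ), c)).symm y) ![v])
      (mfderiv_chart_symm_prod 0 c hy)
  have hself (u : ℝ) (v : ℝ × E) : A (u, extChartAt I c c) ![v] = B (u, c) ![v] := by
    rw [hA, ← chartRep_prod_congr B u c, ← extChartAt_prod_self_apply]
    exact chartRep_self B (u, c) ![v]
  have hdiff (u : ℝ) : DifferentiableAt ℝ A (u, extChartAt I c c) :=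
    (hB.contDiffAt (hpt u)).differentiableAt (by simp)
  have hext (u : ℝ) (w : ℝ × E) :
      extDeriv A (u, extChartAt I c c) ![((1 : ℝ), (0 : E)), w] = 0 := by
    have := extD_apply (I := 𝓘(ℝ, ℝ).prod I) B (u, c) ![((1 : ℝ), (0 : E)), w]
    rw [extChartAt_prod_self_apply, chartRep_prod_congr B u c] at this
    exact this.symm.trans (h1 (u, c) w)
  have heval (u : ℝ) (x : ℝ × E) : HasFDerivAt (fun y ↦ A y ![x])
      ((ContinuousAlternatingMap.apply ℝ (ℝ × E) ℝ ![x]).comp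
        (fderiv ℝ A (u, extChartAt I c c))) (u, extChartAt I c c) :=
    (ContinuousAlternatingMap.apply ℝ (ℝ × E) ℝ ![x]).hasFDerivAt.comp _
      (hdiff u).hasFDerivAt
  -- The ∂_t-coefficient of the form vanishes on the whole chart domain, hence so do its
  -- derivatives. In i_{∂_t} dB = 0 only the t-derivative of the remaining coefficients survives.
  have hzero (u : ℝ) (w : ℝ × E) :
      fderiv ℝ A (u, extChartAt I c c) w ![((1 : ℝ), (0 : E))] = 0 := by
    have h : (fun y ↦ A y ![((1 : ℝ), (0 : E))]) =ᶠ[nhds (u, extChartAt I c c)] fun _ ↦ 0 := by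
      filter_upwards [eventually_mem_chart_target (hpt u)] with y hy using hA0 hy
    have h' := (heval u _).unique ((hasFDerivAt_const (0 : ℝ) _).congr_of_eventuallyEq h)
    exact DFunLike.congr_fun h' w
  have hder (u : ℝ) : HasDerivAt (fun u ↦ A (u, extChartAt I c c) ![((0 : ℝ), (w : E))]) 0 u := by
    have hγ : HasDerivAt (fun u : ℝ ↦ (u, extChartAt I c c)) ((1 : ℝ), (0 : E)) u :=
      (hasDerivAt_id u).prodMk (hasDerivAt_const u _)
    refine ((heval u ((0 : ℝ), (w : E))).comp_hasDerivAt u hγ).congr_deriv ?_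
    have h := hext u ((0 : ℝ), (w : E))
    rw [extDeriv_one, hzero, sub_zero] at h
    exact h
  have h2 := is_const_of_deriv_eq_zero (fun s ↦ (hder s).differentiableAt)
    (fun s ↦ (hder s).deriv) u 0
  rw [hself, hself] at h2
  exact h2

end Cylinder

/-! ### Linear algebra of alternating one- and two-forms -/

section Linear

variable {V : Type*} [AddCommGroup V] [Module ℝ V] [TopologicalSpace V]

omit [AddCommGroup V] [Module ℝ V] [TopologicalSpace V] in
lemma update_fin_one (v w : V) : Function.update ![v] 0 w = ![w] := by
  funext i; fin_cases i; rfl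

omit [AddCommGroup V] [Module ℝ V] [TopologicalSpace V] in
lemma update_fin_two_zero (u v w : V) : Function.update ![u, v] 0 w = ![w, v] := by
  funext i; fin_cases i <;> rfl

omit [AddCommGroup V] [Module ℝ V] [TopologicalSpace V] in
lemma update_fin_two_one (u v w : V) : Function.update ![u, v] 1 w = ![u, w] := by
  funext i; fin_cases i <;> rfl

lemma one_add (a : V [⋀^Fin 1]→L[ℝ] ℝ) (v w : V) : a ![v + w] = a ![v] + a ![w] := by
  have h := a.map_update_add ![v] 0 v w
  rwa [update_fin_one, update_fin_one, update_fin_one] at h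

lemma one_smul (a : V [⋀^Fin 1]→L[ℝ] ℝ) (c : ℝ) (v : V) : a ![c • v] = c * a ![v] := by
  have h := a.map_update_smul ![v] 0 c v
  rwa [update_fin_one, update_fin_one] at h

lemma one_zero (a : V [⋀^Fin 1]→L[ℝ] ℝ) : a ![0] = 0 := by
  rw [← zero_smul ℝ (0 : V), one_smul, zero_mul]

lemma one_neg (a : V [⋀^Fin 1]→L[ℝ] ℝ) (v : V) : a ![-v] = -a ![v] := by
  rw [← neg_one_smul ℝ v, one_smul, neg_one_mul]

lemma one_sub (a : V [⋀^Fin 1]→L[ℝ] ℝ) (v w : V) : a ![v - w] = a ![v] - a ![w] := by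
  rw [sub_eq_add_neg, one_add, one_neg, ← sub_eq_add_neg]

lemma two_add_left (b : V [⋀^Fin 2]→L[ℝ] ℝ) (u v w : V) :
    b ![u + v, w] = b ![u, w] + b ![v, w] := by
  have h := b.map_update_add ![u, w] 0 u v
  rwa [update_fin_two_zero, update_fin_two_zero, update_fin_two_zero] at h

lemma two_smul_left (b : V [⋀^Fin 2]→L[ℝ] ℝ) (c : ℝ) (v w : V) :
    b ![c • v, w] = c * b ![v, w] := by
  have h := b.map_update_smul ![v, w] 0 c v
  rwa [update_fin_two_zero, update_fin_two_zero] at h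

lemma two_neg_left (b : V [⋀^Fin 2]→L[ℝ] ℝ) (v w : V) : b ![-v, w] = -b ![v, w] := by
  rw [← neg_one_smul ℝ v, two_smul_left, neg_one_mul]

lemma two_sub_left (b : V [⋀^Fin 2]→L[ℝ] ℝ) (u v w : V) :
    b ![u - v, w] = b ![u, w] - b ![v, w] := by
  rw [sub_eq_add_neg, two_add_left, two_neg_left, ← sub_eq_add_neg]

lemma two_self (b : V [⋀^Fin 2]→L[ℝ] ℝ) (v : V) : b ![v, v] = 0 :=
  b.map_eq_zero_of_eq ![v, v] (i := 0) (j := 1) rfl (by decide)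

lemma two_add_right (b : V [⋀^Fin 2]→L[ℝ] ℝ) (u v w : V) :
    b ![u, v + w] = b ![u, v] + b ![u, w] := by
  have h := b.map_update_add ![u, v] 1 v w
  rwa [update_fin_two_one, update_fin_two_one, update_fin_two_one] at h

lemma two_smul_right (b : V [⋀^Fin 2]→L[ℝ] ℝ) (c : ℝ) (v w : V) :
    b ![v, c • w] = c * b ![v, w] := by
  have h := b.map_update_smul ![v, w] 1 c w
  rwa [update_fin_two_one, update_fin_two_one] at h

lemma two_swap (b : V [⋀^Fin 2]→L[ℝ] ℝ) (v w : V) : b ![w, v] = -b ![v, w] := by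
  have h := two_self b (v + w)
  rw [two_add_left, two_add_right, two_add_right, two_self, two_self] at h
  linarith

lemma one_ext {a b : V [⋀^Fin 1]→L[ℝ] ℝ} (h : ∀ v, a ![v] = b ![v]) : a = b :=
  ContinuousAlternatingMap.ext fun v ↦ by
    rw [show v = ![v 0] by ext i; fin_cases i; rfl, h]

lemma two_ext {a b : V [⋀^Fin 2]→L[ℝ] ℝ} (h : ∀ v w, a ![v, w] = b ![v, w]) : a = b :=
  ContinuousAlternatingMap.ext fun v ↦ by
    rw [show v = ![v 0, v 1] by ext i; fin_cases i <;> rfl, h]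

end Linear

/-! ### Functoriality of pullback -/

section Pullback

variable {E H : Type*} [NormedAddCommGroup E] [NormedSpace ℝ E] [TopologicalSpace H]
  {I : ModelWithCorners ℝ E H}
  {M : Type*} [TopologicalSpace M] [ChartedSpace H M]
  {E' H' : Type*} [NormedAddCommGroup E'] [NormedSpace ℝ E'] [TopologicalSpace H']
  {I' : ModelWithCorners ℝ E' H'}
  {M' : Type*} [TopologicalSpace M'] [ChartedSpace H' M']
  {E'' H'' : Type*} [NormedAddCommGroup E''] [NormedSpace ℝ E''] [TopologicalSpace H'']
  {I'' : ModelWithCorners ℝ E'' H''}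
  {M'' : Type*} [TopologicalSpace M''] [ChartedSpace H'' M'']

lemma pullback_comp {k : ℕ} {g : M' → M''} {f : M → M'} (α : DForm I'' M'' k)
    (hg : ContMDiff I' I'' ∞ g) (hf : ContMDiff I I' ∞ f) :
    pullback I I'' (g ∘ f) α = pullback I I' f (pullback I' I'' g α) := by
  funext x
  have h := mfderiv_comp x ((hg (f x)).mdifferentiableAt (by simp))
    ((hf x).mdifferentiableAt (by simp))
  refine ContinuousAlternatingMap.ext fun (v : Fin k → E) ↦ ?_
  exact congrArg (α (g (f x))) (funext fun i ↦ DFunLike.congr_fun h (v i))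

lemma pullback_id {k : ℕ} (α : DForm I M k) : pullback I I id α = α := by
  funext x
  have h := mfderiv_id (I := I) (x := x)
  refine ContinuousAlternatingMap.ext fun (v : Fin k → E) ↦ ?_
  exact congrArg (α x) (funext fun i ↦ DFunLike.congr_fun h (v i))

lemma pullback_apply_one (f : M → M') (α : DForm I' M' 1) (x : M) (v : TangentSpace I x) :
    pullback I I' f α x ![v] = α (f x) ![mfderiv I I' f x v] :=
  congrArg (α (f x)) (by funext i; fin_cases i; rfl)

lemma pullback_apply_two (f : M → M') (α : DForm I' M' 2) (x : M) (v w : TangentSpace I x) :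
    pullback I I' f α x ![v, w] = α (f x) ![mfderiv I I' f x v, mfderiv I I' f x w] :=
  congrArg (α (f x)) (by funext i; fin_cases i <;> rfl)

lemma pullback_dFun {f : M → M'} {g : M' → ℝ} (hg : ContMDiff I' 𝓘(ℝ, ℝ) ∞ g)
    (hf : ContMDiff I I' ∞ f) : pullback I I' f (dFun I' g) = dFun I (g ∘ f) := by
  funext x
  have h := mfderiv_comp x ((hg (f x)).mdifferentiableAt (by simp))
    ((hf x).mdifferentiableAt (by simp))
  refine one_ext fun v ↦ ?_
  exact (pullback_apply_one _ _ _ _).trans (DFunLike.congr_fun h v).symm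

end Pullback

/-! ### Basic forms on a cylinder are pullbacks from the base -/

section Basic

variable {E H : Type*} [NormedAddCommGroup E] [NormedSpace ℝ E] [TopologicalSpace H]
  {I : ModelWithCorners ℝ E H}
  {M : Type*} [TopologicalSpace M] [ChartedSpace H M]
  {E' H' : Type*} [NormedAddCommGroup E'] [NormedSpace ℝ E'] [TopologicalSpace H']
  {I' : ModelWithCorners ℝ E' H'}
  {M' : Type*} [TopologicalSpace M'] [ChartedSpace H' M']
  {D : VField I M} {π : M → M'} {ρ : M → ℝ}

lemma prodVec_eq (p : ℝ × M) (a : ℝ) (w : TangentSpace I p.2) :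
    prodVec p a w = a • prodVec p 1 0 + prodVec p 0 w := by
  refine Prod.ext ?_ ?_
  · change a = a * 1 + 0
    ring
  · exact ((congrArg (· + w) (smul_zero a)).trans (zero_add w)).symm

lemma mfderiv_zero_prodMk (c : M) (w : TangentSpace I c) :
    mfderiv I (𝓘(ℝ, ℝ).prod I) (fun c : M ↦ ((0 : ℝ), c)) c w = prodVec (0, c) 0 w := by
  have h := (hasMFDerivAt_const (I := I) (I' := 𝓘(ℝ, ℝ)) (0 : ℝ) c).prodMk
    (hasMFDerivAt_id (I := I) c)
  exact DFunLike.congr_fun h.mfderiv w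

/-- The form ignores ∂_t and its other coefficients are constant in t, so it is recovered from its
restriction to the slice t = 0. -/
lemma eq_pullback_of_invariant [I.Boundaryless] [IsManifold I ∞ M]
    {B : DForm (𝓘(ℝ, ℝ).prod I) (ℝ × M) 1} (hB : IsSmoothForm (𝓘(ℝ, ℝ).prod I) B)
    (h0 : ∀ p, B p ![prodVec p 1 0] = 0)
    (h1 : ∀ p w, extD (𝓘(ℝ, ℝ).prod I) B p ![prodVec p 1 0, w] = 0) :
    pullback (𝓘(ℝ, ℝ).prod I) I Prod.snd
      (pullback I (𝓘(ℝ, ℝ).prod I) (fun c ↦ ((0 : ℝ), c)) B) = B := by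
  funext p
  refine one_ext fun v ↦ ?_
  obtain ⟨a, w, rfl⟩ := exists_eq_prodVec (I := I) p v
  have h2 : B p ![prodVec p a w] = B p ![prodVec p 0 w] := by
    rw [prodVec_eq p a w, one_add, one_smul, h0, mul_zero, zero_add]
  rw [h2]
  refine (pullback_apply_one _ _ _ _).trans ((pullback_apply_one _ _ _ _).trans ?_)
  rw [mfderiv_snd_prodVec, mfderiv_zero_prodMk]
  exact (apply_prodVec_eq_of_invariant hB h0 h1 p.1 p.2 w).symm

end Basic

/-! ### Consequences of the trivialization: projection, descent of forms, flow -/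

section Trivialization

variable {E H : Type*} [NormedAddCommGroup E] [NormedSpace ℝ E] [TopologicalSpace H]
  {I : ModelWithCorners ℝ E H}
  {M : Type*} [TopologicalSpace M] [ChartedSpace H M]
  {E' H' : Type*} [NormedAddCommGroup E'] [NormedSpace ℝ E'] [TopologicalSpace H']
  {I' : ModelWithCorners ℝ E' H'}
  {M' : Type*} [TopologicalSpace M'] [ChartedSpace H' M']
  {D : VField I M} {π : M → M'} {ρ : M → ℝ}
  {Θ : Diffeomorph I (I'.prod 𝓘(ℝ, ℝ)) M (M' × ℝ) ∞}

lemma trivialization_symm_apply (hΘ : ∀ m, Θ m = (π m, Real.log (ρ m))) (c : M') (u : ℝ) :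
    π (Θ.symm (c, u)) = c ∧ Real.log (ρ (Θ.symm (c, u))) = u := by
  have h := hΘ (Θ.symm (c, u))
  rw [Θ.apply_symm_apply, Prod.mk.injEq] at h
  exact ⟨h.1.symm, h.2.symm⟩

lemma trivialization_symm_self (hΘ : ∀ m, Θ m = (π m, Real.log (ρ m))) (m : M) :
    Θ.symm (π m, Real.log (ρ m)) = m := by
  rw [← hΘ, Θ.symm_apply_apply]

/-- The diffeomorphism `Θ = (π, log |ρ|)` identifies the integral curves of `D` with the lines
`{c} × ℝ`. -/
structure IsTrivialization (D : VField I M) (π : M → M') (ρ : M → ℝ)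
    (Θ : Diffeomorph I (I'.prod 𝓘(ℝ, ℝ)) M (M' × ℝ) ∞) : Prop where
  apply : ∀ m, Θ m = (π m, Real.log (ρ m))
  curve : ∀ m, IsMIntegralCurve (fun t ↦ Θ.symm (π m, Real.log (ρ m) + t)) D

lemma IsOrbitQuotient.isTrivialization (hπ : IsOrbitQuotient I I' D π)
    (hρ : IsScalingFunction I D ρ) (hρ0 : ∀ m, ρ m ≠ 0)
    (hΘ : ∀ m, Θ m = (π m, Real.log (ρ m))) : IsTrivialization D π ρ Θ where
  apply := hΘ
  curve m := by
    obtain ⟨γ, hγ, rfl⟩ := hπ.exists_integralCurve m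
    have h : (fun t ↦ Θ.symm (π (γ 0), Real.log (ρ (γ 0)) + t)) = γ := by
      funext t
      rw [← hπ.comp_integralCurve hγ t, ← hρ.log_comp_integralCurve hρ0 hγ t,
        trivialization_symm_self hΘ]
    rwa [h]

namespace IsTrivialization

lemma proj_symm (hΘ : IsTrivialization D π ρ Θ) (c : M') (u : ℝ) : π (Θ.symm (c, u)) = c :=
  (trivialization_symm_apply hΘ.apply c u).1

lemma log_symm (hΘ : IsTrivialization D π ρ Θ) (c : M') (u : ℝ) :
    Real.log (ρ (Θ.symm (c, u))) = u :=
  (trivialization_symm_apply hΘ.apply c u).2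

lemma symm_self (hΘ : IsTrivialization D π ρ Θ) (m : M) :
    Θ.symm (π m, Real.log (ρ m)) = m :=
  trivialization_symm_self hΘ.apply m

lemma contMDiff_proj (hΘ : IsTrivialization D π ρ Θ) : ContMDiff I I' ∞ π := by
  have h : π = fun m ↦ (Θ m).1 := funext fun m ↦ by rw [hΘ.apply]
  rw [h]
  exact contMDiff_fst.comp Θ.contMDiff

lemma contMDiff_symm (u : ℝ) : ContMDiff I' I ∞ (fun c ↦ Θ.symm (c, u)) :=
  Θ.symm.contMDiff.comp (contMDiff_id.prodMk contMDiff_const)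

lemma mfderiv_proj_surjective (hΘ : IsTrivialization D π ρ Θ) (m : M) :
    Function.Surjective (mfderiv I I' π m) := by
  intro w
  have h1 : (π ∘ fun c ↦ Θ.symm (c, Real.log (ρ m))) = id :=
    funext fun c ↦ hΘ.proj_symm c _
  have h2 := mfderiv_comp_of_eq (x := π m) (y := m) (g := π)
    (f := fun c ↦ Θ.symm (c, Real.log (ρ m)))
    ((hΘ.contMDiff_proj m).mdifferentiableAt (by simp))
    ((contMDiff_symm (Θ := Θ) _ (π m)).mdifferentiableAt (by simp)) (hΘ.symm_self m)
  rw [h1, mfderiv_id] at h2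
  exact ⟨_, (mfderiv_congr_base π (hΘ.symm_self m) _).symm.trans (DFunLike.congr_fun h2 w).symm⟩

lemma proj_curve (hΘ : IsTrivialization D π ρ Θ) (m : M) :
    mfderiv I I' π m (D m) = 0 := by
  have h0 := hΘ.curve m 0
  have hm : Θ.symm (π m, Real.log (ρ m) + 0) = m := by rw [add_zero, hΘ.symm_self]
  have h := HasMFDerivAt.comp_curve (I' := I') h0
    ((hΘ.contMDiff_proj _).mdifferentiableAt (by simp))
  have h1 : (π ∘ fun t ↦ Θ.symm (π m, Real.log (ρ m) + t)) = fun _ ↦ π m :=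
    funext fun t ↦ hΘ.proj_symm _ _
  have h2 : HasMFDerivAt 𝓘(ℝ, ℝ) I' (π ∘ fun t ↦ Θ.symm (π m, Real.log (ρ m) + t)) 0 0 := by
    rw [h1]; exact hasMFDerivAt_const _ _
  have h3 := hasMFDerivAt_unique h h2
  have h4 : mfderiv I I' π (Θ.symm (π m, Real.log (ρ m) + 0))
      (D (Θ.symm (π m, Real.log (ρ m) + 0))) = 0 :=
    (_root_.one_smul ℝ _).symm.trans (DFunLike.congr_fun h3 (1 : ℝ))
  rwa [hm] at h4

end IsTrivialization

lemma contMDiff_trivialization_symm :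
    ContMDiff (𝓘(ℝ, ℝ).prod I') I ∞ (fun q : ℝ × M' ↦ Θ.symm (q.2, q.1)) :=
  Θ.symm.contMDiff.comp (contMDiff_snd.prodMk contMDiff_fst)

/-- The inverse trivialization carries lines to integral curves of D, hence ∂_t to D. The factors
are swapped to match the cylinder convention ℝ × M'. -/
lemma IsTrivialization.mfderiv_trivialization_symm [IsManifold I ∞ M] [IsManifold I' ∞ M']
    (hΘ : IsTrivialization D π ρ Θ) (p : ℝ × M') :
    mfderiv (𝓘(ℝ, ℝ).prod I') I (fun q : ℝ × M' ↦ Θ.symm (q.2, q.1)) p (prodVec p 1 0) =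
      D (Θ.symm (p.2, p.1)) := by
  have h0 := hΘ.curve (Θ.symm (p.2, 0))
  have hfun : (fun t ↦ Θ.symm (π (Θ.symm (p.2, 0)), Real.log (ρ (Θ.symm (p.2, 0))) + t)) =
      fun t ↦ Θ.symm (p.2, t) := by
    funext t
    rw [hΘ.proj_symm, hΘ.log_symm, zero_add]
  rw [hfun] at h0
  have h1 := h0 p.1
  have h2 : HasMFDerivAt 𝓘(ℝ, ℝ) (𝓘(ℝ, ℝ).prod I') (fun t : ℝ ↦ (t, p.2)) p.1
      ((1 : ℝ →L[ℝ] ℝ).smulRight (prodVec (I := I') p 1 0)) := by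
    have h3 := (hasMFDerivAt_id (I := 𝓘(ℝ, ℝ)) p.1).prodMk
      (hasMFDerivAt_const (I := 𝓘(ℝ, ℝ)) (I' := I') p.2 p.1)
    refine h3.congr_mfderiv (ContinuousLinearMap.ext fun (s : ℝ) ↦ ?_)
    refine Prod.ext ?_ ?_
    · exact (mul_one s).symm
    · exact (smul_zero s).symm
  have h4 := HasMFDerivAt.comp_curve h2
    ((contMDiff_trivialization_symm (Θ := Θ) (p.1, p.2)).mdifferentiableAt (by simp))
  have h5 := hasMFDerivAt_unique h4 h1
  have h6 := DFunLike.congr_fun h5 (1 : ℝ)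
  exact ((_root_.one_smul ℝ _).symm.trans h6).trans (_root_.one_smul ℝ _)

/-- A horizontal invariant one-form descends along an orbit projection. -/
lemma IsTrivialization.pullback_pullback [I'.Boundaryless] [IsManifold I ∞ M] [IsManifold I' ∞ M']
    [I.Boundaryless] (hΘ : IsTrivialization D π ρ Θ) {μ : DForm I M 1} (hμ : IsSmoothForm I μ)
    (h0 : ∀ m, μ m ![D m] = 0) (h1 : ∀ m w, extD I μ m ![D m, w] = 0) :
    pullback I I' π (pullback I' I (fun c ↦ Θ.symm (c, 0)) μ) = μ := by
  have hF := contMDiff_trivialization_symm (Θ := Θ)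
  set F := fun q : ℝ × M' ↦ Θ.symm (q.2, q.1) with hFdef
  have hDF := hΘ.mfderiv_trivialization_symm
  have key := eq_pullback_of_invariant (hμ.pullback hF)
    (fun p ↦ by rw [pullback_apply_one, hDF, h0])
    (fun p w ↦ by rw [extD_pullback hμ hF, pullback_apply_two, hDF, h1])
  have hin : ContMDiff I' (𝓘(ℝ, ℝ).prod I') ∞ (fun c : M' ↦ ((0 : ℝ), c)) :=
    contMDiff_const.prodMk contMDiff_id
  have hG : ContMDiff I (𝓘(ℝ, ℝ).prod I') ∞ (fun m ↦ ((Θ m).2, (Θ m).1)) :=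
    (contMDiff_snd.comp Θ.contMDiff).prodMk (contMDiff_fst.comp Θ.contMDiff)
  have hFG : F ∘ (fun m ↦ ((Θ m).2, (Θ m).1)) = id := by
    funext m
    exact Θ.symm_apply_apply m
  -- The cylinder statement is transported back to M by the inverse of `F`, under which the
  -- projection to the base becomes π and the slice t = 0 becomes the section c ↦ Θ⁻¹(c, 0).
  have h2 := congrArg (pullback I (𝓘(ℝ, ℝ).prod I') (fun m ↦ ((Θ m).2, (Θ m).1))) key
  rw [← pullback_comp _ hF hG, hFG, pullback_id, ← pullback_comp _ contMDiff_snd hG,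
    ← pullback_comp _ hF hin] at h2
  have h3 : (Prod.snd ∘ fun m ↦ ((Θ m).2, (Θ m).1)) = π := by
    funext m
    simp only [Function.comp_apply, hΘ.apply]
  rw [h3] at h2
  exact h2

/-- The flow of a vector field, in terms of a trivialization of its orbit projection. -/
lemma IsTrivialization.isFlow (hΘ : IsTrivialization D π ρ Θ) :
    IsFlow I D (fun s m ↦ Θ.symm (π m, Real.log (ρ m) + s)) where
  smooth := by
    have h : (fun q : ℝ × M ↦ Θ.symm (π q.2, Real.log (ρ q.2) + q.1)) =
        fun q ↦ Θ.symm ((Θ q.2).1, (Θ q.2).2 + q.1) := by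
      funext q; rw [hΘ.apply]
    rw [h]
    refine Θ.symm.contMDiff.comp ?_
    have h1 : ContMDiff (𝓘(ℝ, ℝ).prod I) (I'.prod 𝓘(ℝ, ℝ)) ∞ (fun q : ℝ × M ↦ Θ q.2) :=
      Θ.contMDiff.comp contMDiff_snd
    exact (contMDiff_fst.comp h1).prodMk ((contMDiff_snd.comp h1).add contMDiff_fst)
  zero x := by rw [add_zero, hΘ.symm_self]
  add s t x := by
    rw [hΘ.proj_symm, hΘ.log_symm]
    congr 2
    ring
  generator x := hΘ.curve x

end Trivialization

/-! ### The extended form, field and flow on ℝ × M -/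

section Extended

variable {E H : Type*} [NormedAddCommGroup E] [NormedSpace ℝ E] [TopologicalSpace H]
  {I : ModelWithCorners ℝ E H}
  {M : Type*} [TopologicalSpace M] [ChartedSpace H M]
  {D : VField I M}

lemma extendedField_apply (D : VField I M) (p : ℝ × M) :
    extendedField I D p = prodVec p 1 (D p.2) := rfl

lemma extendedForm_apply (lam : DForm I M 1) (ρ : M → ℝ) (p : ℝ × M) (a : ℝ)
    (w : TangentSpace I p.2) :
    extendedForm I lam ρ p ![prodVec p a w] =
      Real.exp (-p.1) * (lam p.2 ![w] + dFun I ρ p.2 ![w]) - a := by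
  have h1 : extendedForm I lam ρ p ![prodVec p a w] =
      Real.exp (-p.1) * pullback (𝓘(ℝ, ℝ).prod I) I Prod.snd (lam + dFun I ρ) p ![prodVec p a w]
        - dFun (𝓘(ℝ, ℝ).prod I) Prod.fst p ![prodVec p a w] := rfl
  rw [h1, pullback_apply_one, mfderiv_snd_prodVec, dFun_apply, mfderiv_fst_prodVec]
  rfl

lemma IsFlow.extendedField {φ : ℝ → M → M} (hφ : IsFlow I D φ) :
    IsFlow (𝓘(ℝ, ℝ).prod I) (extendedField I D) (fun s p ↦ (p.1 + s, φ s p.2)) where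
  smooth := by
    have h1 : ContMDiff (𝓘(ℝ, ℝ).prod (𝓘(ℝ, ℝ).prod I)) (𝓘(ℝ, ℝ).prod I) ∞
        (fun q : ℝ × ℝ × M ↦ (q.1, q.2.2)) :=
      contMDiff_fst.prodMk (contMDiff_snd.comp contMDiff_snd)
    exact ((contMDiff_fst.comp contMDiff_snd).add contMDiff_fst).prodMk (hφ.smooth.comp h1)
  zero p := by rw [add_zero, hφ.zero]
  add s t p := by
    rw [hφ.add, add_assoc, add_comm t s]
  generator p t := by
    have h1 : HasMFDerivAt 𝓘(ℝ, ℝ) 𝓘(ℝ, ℝ) (fun s : ℝ ↦ p.1 + s) t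
        (ContinuousLinearMap.id ℝ ℝ) :=
      ((hasFDerivAt_id t).const_add p.1).hasMFDerivAt
    have h2 := h1.prodMk (hφ.generator p.2 t)
    refine h2.congr_mfderiv (ContinuousLinearMap.ext fun (s : ℝ) ↦ ?_)
    exact Prod.ext (mul_one s).symm rfl

lemma mfderiv_translate_prodMap [IsManifold I ∞ M] {f : M → M} (hf : ContMDiff I I ∞ f) (s : ℝ)
    (p : ℝ × M) (a : ℝ) (w : TangentSpace I p.2) :
    mfderiv (𝓘(ℝ, ℝ).prod I) (𝓘(ℝ, ℝ).prod I) (fun p : ℝ × M ↦ (p.1 + s, f p.2)) p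
      (prodVec p a w) = prodVec (p.1 + s, f p.2) a (mfderiv I I f p.2 w) := by
  have h0 : HasMFDerivAt 𝓘(ℝ, ℝ) 𝓘(ℝ, ℝ) (fun t : ℝ ↦ t + s) p.1
        (ContinuousLinearMap.id ℝ ℝ) :=
      ((hasFDerivAt_id p.1).add_const s).hasMFDerivAt
  have h1 := h0.comp p (hasMFDerivAt_fst (I := 𝓘(ℝ, ℝ)) (I' := I) p)
  have h2 := ((hf p.2).mdifferentiableAt (by simp)).hasMFDerivAt.comp p
    (hasMFDerivAt_snd (I := 𝓘(ℝ, ℝ)) (I' := I) p)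
  exact DFunLike.congr_fun (h1.prodMk h2).mfderiv (prodVec p a w)

lemma IsFlow.contMDiff {φ : ℝ → M → M} (hφ : IsFlow I D φ) (s : ℝ) :
    ContMDiff I I ∞ (φ s) :=
  hφ.smooth.comp (contMDiff_const.prodMk contMDiff_id)

/-- Translating t by s multiplies e^{-t} by e^{-s}, which cancels the common factor e^s acquired by
λ and dρ; dt is unchanged. -/
lemma pullback_extendedForm [IsManifold I ∞ M] {lam : DForm I M 1} {ρ : M → ℝ} {f : M → M}
    (hf : ContMDiff I I ∞ f) (s : ℝ) (hlam : ∀ m, pullback I I f lam m = Real.exp s • lam m)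
    (hρ : ContMDiff I 𝓘(ℝ, ℝ) ∞ ρ) (hρf : ∀ m, ρ (f m) = Real.exp s * ρ m) :
    pullback (𝓘(ℝ, ℝ).prod I) (𝓘(ℝ, ℝ).prod I) (fun p : ℝ × M ↦ (p.1 + s, f p.2))
      (extendedForm I lam ρ) = extendedForm I lam ρ := by
  funext p
  refine one_ext fun v ↦ ?_
  obtain ⟨a, w, rfl⟩ := exists_eq_prodVec (I := I) p v
  rw [pullback_apply_one, mfderiv_translate_prodMap hf, extendedForm_apply, extendedForm_apply]
  have h1 : lam (f p.2) ![mfderiv I I f p.2 w] = Real.exp s * lam p.2 ![w] :=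
    (pullback_apply_one f lam p.2 w).symm.trans (DFunLike.congr_fun (hlam p.2) ![w])
  have h2 : dFun I ρ (f p.2) ![mfderiv I I f p.2 w] = Real.exp s * dFun I ρ p.2 ![w] := by
    rw [← pullback_apply_one, pullback_dFun hρ hf,
      show ρ ∘ f = fun m ↦ Real.exp s * ρ m from funext hρf]
    have h3 := ((hρ p.2).mdifferentiableAt (by simp)).hasMFDerivAt.const_smul (Real.exp s)
    exact DFunLike.congr_fun h3.mfderiv w
  simp only
  rw [h1, h2, neg_add, Real.exp_add, Real.exp_neg s]
  field_simp

/-- A product vector field with smooth components is smooth. -/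
lemma isSmoothVField_prodVec [I.Boundaryless] [IsManifold I ∞ M] {a : ℝ × M → ℝ}
    (ha : ContMDiff (𝓘(ℝ, ℝ).prod I) 𝓘(ℝ, ℝ) ∞ a) {X : VField I M} (hX : IsSmoothVField I X) :
    IsSmoothVField (𝓘(ℝ, ℝ).prod I) (fun p : ℝ × M ↦ prodVec p (a p) (X p.2)) := by
  refine isSmoothVField_iff.2 ?_
  rintro ⟨u, c⟩ y hy
  have hy2 : y.2 ∈ (extChartAt I c).target := by
    rw [extChartAt_prod] at hy
    exact hy.2
  have h1 : ContDiffAt ℝ ∞ (vfRep I X c) y.2 :=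
    (isSmoothVField_iff.1 hX c).contDiffAt ((isOpen_extChartAt_target c).mem_nhds hy2)
  have h2 : ContDiffAt ℝ ∞ (fun y : ℝ × E ↦
      (a ((extChartAt (𝓘(ℝ, ℝ).prod I) (u, c)).symm y), vfRep I X c y.2)) y :=
    (contDiffAt_comp_chart_symm ha hy).prodMk (h1.comp y contDiffAt_snd)
  refine (h2.congr_of_eventuallyEq ?_).contDiffWithinAt
  filter_upwards [eventually_mem_chart_target hy] with z hz
  have hz2 : z.2 ∈ (extChartAt I c).target := by
    rw [extChartAt_prod] at hz
    exact hz.2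
  set q := (extChartAt (𝓘(ℝ, ℝ).prod I) (u, c)).symm z with hq
  have hq2 : q.2 = (extChartAt I c).symm z.2 := by rw [hq, extChartAt_prod_symm_apply]
  have hqs : q.2 ∈ (extChartAt I c).source := by
    rw [hq2]; exact (extChartAt I c).map_target hz2
  have hσ : ⇑(extChartAt (𝓘(ℝ, ℝ).prod I) (u, c)) =
      fun p : ℝ × M ↦ (p.1, extChartAt I c p.2) := by
    rw [extChartAt_prod, extChartAt_model_space_eq_id]
    rfl
  have h3 : HasMFDerivAt (𝓘(ℝ, ℝ).prod I) 𝓘(ℝ, ℝ × E) (fun p : ℝ × M ↦ (p.1, extChartAt I c p.2)) q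
      ((ContinuousLinearMap.fst ℝ ℝ E).prod ((mfderiv I 𝓘(ℝ, E) (extChartAt I c) q.2).comp
        (ContinuousLinearMap.snd ℝ ℝ E))) := by
    rw [modelWithCornersSelf_prod, ← chartedSpaceSelf_prod]
    exact (hasMFDerivAt_fst (I := 𝓘(ℝ, ℝ)) (I' := I) q).prodMk
      (((contMDiffAt_chart hqs).mdifferentiableAt (n := ∞) (by simp)).hasMFDerivAt.comp q
        (hasMFDerivAt_snd (I := 𝓘(ℝ, ℝ)) (I' := I) q))
  have h4 : vfRep (𝓘(ℝ, ℝ).prod I) (fun p : ℝ × M ↦ prodVec p (a p) (X p.2)) (u, c) z =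
      mfderiv (𝓘(ℝ, ℝ).prod I) 𝓘(ℝ, ℝ × E) (fun p : ℝ × M ↦ (p.1, extChartAt I c p.2)) q
        (prodVec q (a q) (X q.2)) := by
    rw [← hσ]; rfl
  refine h4.trans ((DFunLike.congr_fun h3.mfderiv _).trans ?_)
  refine Prod.ext rfl ?_
  change (mfderiv I 𝓘(ℝ, E) (extChartAt I c) q.2 (X q.2) : E) = vfRep I X c z.2
  rw [hq2]
  rfl

end Extended

/-! ### Differentials of functions on ℝ × M -/

section Differential

variable {E H : Type*} [NormedAddCommGroup E] [NormedSpace ℝ E] [TopologicalSpace H]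
  {I : ModelWithCorners ℝ E H}
  {M : Type*} [TopologicalSpace M] [ChartedSpace H M]

lemma dFun_comp_real {φ : ℝ → ℝ} {φ' : ℝ} {f : M → ℝ} {x : M} (hφ : HasDerivAt φ φ' (f x))
    (hf : MDifferentiableAt I 𝓘(ℝ, ℝ) f x) (v : TangentSpace I x) :
    dFun I (fun x ↦ φ (f x)) x ![v] = φ' * dFun I f x ![v] := by
  have h := hφ.hasFDerivAt.hasMFDerivAt.comp x hf.hasMFDerivAt
  refine (DFunLike.congr_fun h.mfderiv v).trans ?_
  exact mul_comm (dFun I f x ![v]) φ'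

lemma dFun_mul {f g : M → ℝ} {x : M} (hf : MDifferentiableAt I 𝓘(ℝ, ℝ) f x)
    (hg : MDifferentiableAt I 𝓘(ℝ, ℝ) g x) (v : TangentSpace I x) :
    dFun I (fun x ↦ f x * g x) x ![v] = f x * dFun I g x ![v] + g x * dFun I f x ![v] :=
  DFunLike.congr_fun (hf.hasMFDerivAt.mul hg.hasMFDerivAt).mfderiv v

lemma dFun_fst (p : ℝ × M) (a : ℝ) (w : TangentSpace I p.2) :
    dFun (𝓘(ℝ, ℝ).prod I) Prod.fst p ![prodVec p a w] = a :=
  mfderiv_fst_prodVec p a w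

lemma dFun_comp_snd [IsManifold I ∞ M] {f : M → ℝ} (hf : ContMDiff I 𝓘(ℝ, ℝ) ∞ f) (p : ℝ × M)
    (a : ℝ) (w : TangentSpace I p.2) :
    dFun (𝓘(ℝ, ℝ).prod I) (fun p : ℝ × M ↦ f p.2) p ![prodVec p a w] = dFun I f p.2 ![w] := by
  have h := congrFun (pullback_dFun (I := 𝓘(ℝ, ℝ).prod I) (I' := I) hf contMDiff_snd) p
  refine (DFunLike.congr_fun h ![prodVec p a w]).symm.trans ?_
  rw [pullback_apply_one, mfderiv_snd_prodVec]

lemma contMDiff_exp_neg_fst :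
    ContMDiff (𝓘(ℝ, ℝ).prod I) 𝓘(ℝ, ℝ) ∞ (fun p : ℝ × M ↦ Real.exp (-p.1)) :=
  (Real.contDiff_exp.comp contDiff_neg).contMDiff.comp contMDiff_fst

lemma dFun_exp_neg_fst [IsManifold I ∞ M] (p : ℝ × M) (a : ℝ) (w : TangentSpace I p.2) :
    dFun (𝓘(ℝ, ℝ).prod I) (fun p : ℝ × M ↦ Real.exp (-p.1)) p ![prodVec p a w] =
      -Real.exp (-p.1) * a := by
  have h := dFun_comp_real (I := 𝓘(ℝ, ℝ).prod I) (f := Prod.fst) (x := p) (hasDerivAt_neg p.1).exp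
    ((contMDiff_fst (I := 𝓘(ℝ, ℝ)) (J := I) (n := ∞) p).mdifferentiableAt (by simp)) (prodVec p a w)
  rw [h, dFun_fst]
  ring

lemma dFun_extendedHamiltonian [IsManifold I ∞ M] {f : M → ℝ} (hf : ContMDiff I 𝓘(ℝ, ℝ) ∞ f)
    (p : ℝ × M) (a : ℝ) (w : TangentSpace I p.2) :
    dFun (𝓘(ℝ, ℝ).prod I) (extendedHamiltonian f) p ![prodVec p a w] =
      Real.exp (-p.1) * (dFun I f p.2 ![w] - a * f p.2) := by
  have h := dFun_mul (I := 𝓘(ℝ, ℝ).prod I) (x := p)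
    ((contMDiff_exp_neg_fst (I := I) p).mdifferentiableAt (by simp))
    (g := fun p ↦ f p.2) (((hf.comp contMDiff_snd) p).mdifferentiableAt (by simp))
    (prodVec p a w)
  refine h.trans ?_
  rw [dFun_comp_snd hf, dFun_exp_neg_fst]
  ring

lemma contMDiff_extendedHamiltonian {f : M → ℝ} (hf : ContMDiff I 𝓘(ℝ, ℝ) ∞ f) :
    ContMDiff (𝓘(ℝ, ℝ).prod I) 𝓘(ℝ, ℝ) ∞ (extendedHamiltonian f) :=
  contMDiff_exp_neg_fst.mul (hf.comp contMDiff_snd)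

lemma extD_sub [I.Boundaryless] [IsManifold I ∞ M] {k : ℕ} {α β : DForm I M k}
    (hα : IsSmoothForm I α) (hβ : IsSmoothForm I β) : extD I (α - β) = extD I α - extD I β := by
  have h := extD_add (hα.sub hβ) hβ
  rw [sub_add_cancel] at h
  rw [h, add_sub_cancel_right]

end Differential

/-! ### The extended form is contact -/

section ExtendedForm

variable {E H : Type*} [NormedAddCommGroup E] [NormedSpace ℝ E] [TopologicalSpace H]
  {I : ModelWithCorners ℝ E H} [I.Boundaryless]
  {M : Type*} [TopologicalSpace M] [ChartedSpace H M] [IsManifold I ∞ M]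
  {lam : DForm I M 1} {ρ : M → ℝ} {Ω : DForm I M 2} {D : VField I M} {h : M → ℝ}

lemma isSmoothForm_smul_pullback_snd (hlam : IsSmoothForm I lam)
    (hρ : ContMDiff I 𝓘(ℝ, ℝ) ∞ ρ) : IsSmoothForm (𝓘(ℝ, ℝ).prod I) (fun p : ℝ × M ↦
      Real.exp (-p.1) • pullback (𝓘(ℝ, ℝ).prod I) I Prod.snd (lam + dFun I ρ) p) :=
  IsSmoothForm.smul contMDiff_exp_neg_fst
    ((hlam.add (isSmoothForm_dFun hρ)).pullback contMDiff_snd)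

lemma isSmoothForm_extendedForm (hlam : IsSmoothForm I lam) (hρ : ContMDiff I 𝓘(ℝ, ℝ) ∞ ρ) :
    IsSmoothForm (𝓘(ℝ, ℝ).prod I) (extendedForm I lam ρ) :=
  (isSmoothForm_smul_pullback_snd hlam hρ).sub (isSmoothForm_dFun contMDiff_fst)

/-- Since dt and dρ are closed, dη = e^{-t}(dλ - dt∧(λ+dρ)); this is that formula evaluated on two
vectors. -/
lemma extD_extendedForm_apply (hlam : IsSmoothForm I lam) (hρ : ContMDiff I 𝓘(ℝ, ℝ) ∞ ρ)
    (p : ℝ × M) (a b : ℝ) (v w : TangentSpace I p.2) :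
    extD (𝓘(ℝ, ℝ).prod I) (extendedForm I lam ρ) p ![prodVec p a v, prodVec p b w] =
      Real.exp (-p.1) * (b * (lam p.2 ![v] + dFun I ρ p.2 ![v]) -
        a * (lam p.2 ![w] + dFun I ρ p.2 ![w]) + extD I lam p.2 ![v, w]) := by
  have hβ : IsSmoothForm I (lam + dFun I ρ) := hlam.add (isSmoothForm_dFun hρ)
  have hdβ : extD I (lam + dFun I ρ) = extD I lam := by
    rw [extD_add hlam (isSmoothForm_dFun hρ), extD_dFun hρ, add_zero]
  have h1 : extD (𝓘(ℝ, ℝ).prod I) (extendedForm I lam ρ) =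
      extD (𝓘(ℝ, ℝ).prod I) (fun p : ℝ × M ↦
        Real.exp (-p.1) • pullback (𝓘(ℝ, ℝ).prod I) I Prod.snd (lam + dFun I ρ) p) := by
    refine (extD_sub (isSmoothForm_smul_pullback_snd hlam hρ)
      (isSmoothForm_dFun contMDiff_fst)).trans ?_
    rw [extD_dFun contMDiff_fst, sub_zero]
  rw [h1, extD_smul_apply contMDiff_exp_neg_fst (hβ.pullback contMDiff_snd),
    extD_pullback hβ contMDiff_snd, hdβ, pullback_apply_two, pullback_apply_one,
    pullback_apply_one, mfderiv_snd_prodVec, mfderiv_snd_prodVec, dFun_exp_neg_fst,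
    dFun_exp_neg_fst]
  have h2 (u : TangentSpace I p.2) :
      (lam + dFun I ρ) p.2 ![u] = lam p.2 ![u] + dFun I ρ p.2 ![u] := rfl
  rw [h2, h2]
  ring

/-- η(∂_t) = -1, so ker η projects isomorphically onto TM. On ker η the dt∧(λ+dρ) term vanishes, and
dη reduces to e^{-t}dλ. -/
lemma isContactForm_extendedForm (hlam : IsSmoothForm I lam) (hρ : ContMDiff I 𝓘(ℝ, ℝ) ∞ ρ)
    (hΩ : ∀ (x : M) (v : TangentSpace I x), (∀ w, extD I lam x ![v, w] = 0) → v = 0) :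
    IsContactForm (𝓘(ℝ, ℝ).prod I) (extendedForm I lam ρ) where
  smooth := isSmoothForm_extendedForm hlam hρ
  ne_zero p hp := by
    have h1 := extendedForm_apply lam ρ p 1 0
    rw [hp, one_zero, one_zero, add_zero, mul_zero, zero_sub] at h1
    exact absurd (h1.symm.trans rfl) (by norm_num : (-1 : ℝ) ≠ 0)
  nondegenerate p v hv hvw := by
    obtain ⟨a, y, rfl⟩ := exists_eq_prodVec (I := I) p v
    rw [extendedForm_apply, sub_eq_zero] at hv
    have hy : y = 0 := hΩ p.2 y fun w ↦ by
      -- The ∂_t-component is the unique one placing the lift of w in ker η.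
      have h1 := hvw (prodVec p (Real.exp (-p.1) * (lam p.2 ![w] + dFun I ρ p.2 ![w])) w)
        (by rw [extendedForm_apply, sub_self])
      rw [extD_extendedForm_apply hlam hρ, ← hv] at h1
      have h2 : Real.exp (-p.1) * extD I lam p.2 ![y, w] = 0 := by linarith
      exact (mul_eq_zero.1 h2).resolve_left (Real.exp_pos _).ne'
    rw [hy, one_zero, one_zero, add_zero, mul_zero] at hv
    rw [hy, ← hv]
    rfl

end ExtendedForm

/-! ### Symplectic identities; the Reeb and contact Hamiltonian fields on N -/

section Symplectic

variable {E H : Type*} [NormedAddCommGroup E] [NormedSpace ℝ E] [TopologicalSpace H]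
  {I : ModelWithCorners ℝ E H} [I.Boundaryless]
  {M : Type*} [TopologicalSpace M] [ChartedSpace H M] [IsManifold I ∞ M]
  {Ω : DForm I M 2} {D Xh Xr : VField I M} {h ρ : M → ℝ}

omit [I.Boundaryless] in
lemma IsScalingSymmetry.isScalingFunction (hD : IsScalingSymmetry I Ω h D 1)
    (hh : ContMDiff I 𝓘(ℝ, ℝ) ∞ h) : IsScalingFunction I D h :=
  ⟨hh, fun x ↦ (hD.fn x).trans (one_mul _)⟩

lemma IsSymplecticForm.exists_isHamiltonianVField [FiniteDimensional ℝ E]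
    (hΩ : IsSymplecticForm I Ω) (hh : ContMDiff I 𝓘(ℝ, ℝ) ∞ h) :
    ∃ X, IsHamiltonianVField I Ω h X := by
  obtain ⟨X, hX, hXe⟩ := hΩ.exists_interior_eq (isSmoothForm_dFun hh).neg
  exact ⟨X, hX, hXe⟩

lemma IsScalingSymmetry.isSmoothForm (hΩ : IsSymplecticForm I Ω)
    (hD : IsScalingSymmetry I Ω h D 1) : IsSmoothForm I (interior I D Ω) :=
  hΩ.smooth.interior hD.smooth

omit [I.Boundaryless] in
-- In L_Dω = i_D dω + d i_Dω the first term vanishes, as ω is closed; thus ω = dλ is exact.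
lemma IsScalingSymmetry.extD_interior (hΩ : IsSymplecticForm I Ω)
    (hD : IsScalingSymmetry I Ω h D 1) : extD I (interior I D Ω) = Ω := by
  have h1 : interior I D (extD I Ω) = 0 := by
    rw [hΩ.closed]
    funext x
    exact two_ext fun v w ↦ rfl
  have h2 := hD.form
  rwa [lieForm, h1, zero_add] at h2

omit [I.Boundaryless] [IsManifold I ∞ M] in
lemma interior_apply_self (m : M) : interior I D Ω m ![D m] = 0 :=
  two_self (Ω m) (D m)

/-- Here i_{D̃}η = e^{-t}ρ - 1, and d(e^{-t}ρ) = e^{-t}(dρ - ρ dt) is the negative of i_{D̃}dη. -/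
lemma lieForm_extendedForm (hΩ : IsSymplecticForm I Ω) (hD : IsScalingSymmetry I Ω h D 1)
    (hρ : IsScalingFunction I D ρ) :
    lieForm (𝓘(ℝ, ℝ).prod I) (extendedField I D) (extendedForm I (interior I D Ω) ρ) = 0 := by
  have hlam := hD.isSmoothForm hΩ
  have hg : (fun p ↦ extendedForm I (interior I D Ω) ρ p ![extendedField I D p]) =
      fun p ↦ extendedHamiltonian ρ p - 1 := by
    funext p
    rw [extendedField_apply, extendedForm_apply, interior_apply_self,
      show dFun I ρ p.2 ![D p.2] = ρ p.2 from hρ.eq p.2, zero_add]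
    rfl
  have hgs : ContMDiff (𝓘(ℝ, ℝ).prod I) 𝓘(ℝ, ℝ) ∞ (fun p ↦ extendedHamiltonian ρ p - 1) :=
    (contMDiff_extendedHamiltonian hρ.smooth).sub contMDiff_const
  funext p
  refine one_ext fun v ↦ ?_
  obtain ⟨b, w, rfl⟩ := exists_eq_prodVec (I := I) p v
  have h1 : dFun (𝓘(ℝ, ℝ).prod I) (fun p ↦ extendedHamiltonian ρ p - 1) p ![prodVec p b w] =
      dFun (𝓘(ℝ, ℝ).prod I) (extendedHamiltonian ρ) p ![prodVec p b w] := by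
    refine (dFun_comp_real (φ := fun x ↦ x - 1) ((hasDerivAt_id _).sub_const 1)
      ((contMDiff_extendedHamiltonian hρ.smooth p).mdifferentiableAt (by simp)) _).trans ?_
    rw [one_mul]
  have h2 : lieForm (𝓘(ℝ, ℝ).prod I) (extendedField I D) (extendedForm I (interior I D Ω) ρ) p
      ![prodVec p b w] =
      extD (𝓘(ℝ, ℝ).prod I) (extendedForm I (interior I D Ω) ρ) p
        ![prodVec p 1 (D p.2), prodVec p b w] +
      extD (𝓘(ℝ, ℝ).prod I) (interior (𝓘(ℝ, ℝ).prod I) (extendedField I D)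
        (extendedForm I (interior I D Ω) ρ)) p ![prodVec p b w] := rfl
  rw [h2, extD_interior_one (by rw [hg]; exact hgs), hg, h1, dFun_extendedHamiltonian hρ.smooth,
    extD_extendedForm_apply hlam hρ.smooth, hD.extD_interior hΩ, interior_apply_self,
    interior_apply_one, show dFun I ρ p.2 ![D p.2] = ρ p.2 from hρ.eq p.2]
  refine Eq.trans ?_ (show (0 : ℝ) = _ from rfl)
  ring

omit [I.Boundaryless] in
lemma IsHamiltonianVField.apply (hXh : IsHamiltonianVField I Ω h Xh) (m : M)
    (w : TangentSpace I m) : Ω m ![Xh m, w] = -dFun I h m ![w] :=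
  DFunLike.congr_fun (congrFun hXh.eq m) ![w]

omit [I.Boundaryless] in
lemma IsHamiltonianVField.dFun_self (hXh : IsHamiltonianVField I Ω h Xh) (m : M) :
    dFun I h m ![Xh m] = 0 := by
  have h1 := hXh.apply m (Xh m)
  rw [two_self] at h1
  linarith

omit [I.Boundaryless] in
lemma IsHamiltonianVField.dFun_swap (hXh : IsHamiltonianVField I Ω h Xh)
    (hXr : IsHamiltonianVField I Ω ρ Xr) (m : M) :
    dFun I h m ![Xr m] = -dFun I ρ m ![Xh m] := by
  have h1 := hXh.apply m (Xr m)
  have h2 := hXr.apply m (Xh m)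
  rw [two_swap] at h1
  linarith

omit [I.Boundaryless] in
-- λ(X_h) = ω(D, X_h) = dh(D) = h by homogeneity. It is applied both to the Hamiltonian and to ρ.
lemma IsHamiltonianVField.interior_scaling (hXh : IsHamiltonianVField I Ω h Xh)
    (hh : IsScalingFunction I D h) (m : M) : interior I D Ω m ![Xh m] = h m := by
  have h1 := hXh.apply m (D m)
  rw [interior_apply_one, two_swap, h1, neg_neg]
  exact hh.eq m

/-- The Reeb vector field of the extended contact form. -/
lemma isReebVField_extendedForm (hΩ : IsSymplecticForm I Ω) (hD : IsScalingSymmetry I Ω h D 1)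
    (hρ : IsScalingFunction I D ρ) (hXr : IsHamiltonianVField I Ω ρ Xr)
    (hXD : IsSmoothVField I (fun m ↦ Xr m - D m)) :
    IsReebVField (𝓘(ℝ, ℝ).prod I) (extendedForm I (interior I D Ω) ρ)
      (fun p ↦ prodVec p (-1) (Xr p.2 - D p.2)) where
  smooth := isSmoothVField_prodVec contMDiff_const hXD
  interior_d := by
    funext p
    refine one_ext fun v ↦ ?_
    obtain ⟨b, w, rfl⟩ := exists_eq_prodVec (I := I) p v
    -- The terms cancel: (λ+dρ)(X_ρ - D) = ρ - ρ = 0, while ω(X_ρ - D, ·) = -(dρ + λ) offsets the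
    -- contribution of -∂_t.
    rw [interior_apply_one, extD_extendedForm_apply (hD.isSmoothForm hΩ) hρ.smooth,
      hD.extD_interior hΩ, one_sub, one_sub, two_sub_left, hXr.interior_scaling hρ,
      interior_apply_self, hXr.dFun_self, hXr.apply, interior_apply_one,
      show dFun I ρ p.2 ![D p.2] = ρ p.2 from hρ.eq p.2]
    refine Eq.trans ?_ (show (0 : ℝ) = _ from rfl)
    ring
  eta p := by
    rw [extendedForm_apply, one_sub, one_sub, hXr.interior_scaling hρ,
      interior_apply_self, hXr.dFun_self, show dFun I ρ p.2 ![D p.2] = ρ p.2 from hρ.eq p.2]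
    ring

/-- The contact Hamiltonian vector field of the extended Hamiltonian. -/
lemma isContactHamiltonianVField_extendedForm (hΩ : IsSymplecticForm I Ω)
    (hD : IsScalingSymmetry I Ω h D 1) (hh : ContMDiff I 𝓘(ℝ, ℝ) ∞ h)
    (hρ : IsScalingFunction I D ρ) (hXr : IsHamiltonianVField I Ω ρ Xr)
    (hXD : IsSmoothVField I (fun m ↦ Xr m - D m)) (hXh : IsHamiltonianVField I Ω h Xh)
    (hXhn : IsSmoothVField I (fun m ↦ -Xh m))
    (hg : ContMDiff I 𝓘(ℝ, ℝ) ∞ (fun m ↦ dFun I ρ m ![Xh m])) :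
    IsContactHamiltonianVField (𝓘(ℝ, ℝ).prod I) (extendedForm I (interior I D Ω) ρ)
      (extendedHamiltonian h)
      (fun p ↦ prodVec p (-(Real.exp (-p.1) * dFun I ρ p.2 ![Xh p.2])) (-Xh p.2)) where
  smooth := isSmoothVField_prodVec (contMDiff_extendedHamiltonian hg).neg hXhn
  -- The ∂_t-component is chosen so that -dt cancels the term -e^{-t}dρ(X_H), leaving -e^{-t}λ(X_H)
  -- = -K.
  eta p := by
    rw [extendedForm_apply, one_neg, one_neg, hXh.interior_scaling (hD.isScalingFunction hh),
      extendedHamiltonian]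
    ring
  interior_d := by
    refine ⟨_, isReebVField_extendedForm hΩ hD hρ hXr hXD, fun p ↦ ?_⟩
    refine one_ext fun v ↦ ?_
    obtain ⟨b, w, rfl⟩ := exists_eq_prodVec (I := I) p v
    have h1 : (dFun (𝓘(ℝ, ℝ).prod I) (extendedHamiltonian h) p -
        lieFun (𝓘(ℝ, ℝ).prod I) (fun p ↦ prodVec p (-1) (Xr p.2 - D p.2))
          (extendedHamiltonian h) p • extendedForm I (interior I D Ω) ρ p) ![prodVec p b w] =
        dFun (𝓘(ℝ, ℝ).prod I) (extendedHamiltonian h) p ![prodVec p b w] -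
        dFun (𝓘(ℝ, ℝ).prod I) (extendedHamiltonian h) p ![prodVec p (-1) (Xr p.2 - D p.2)] *
          extendedForm I (interior I D Ω) ρ p ![prodVec p b w] := rfl
    -- The Reeb derivative of K is e^{-t}(X_ρ(H) - H + H) = -e^{-t}X_H(ρ), which is the
    -- ∂_t-component of the field itself.
    rw [h1, interior_apply_one, extD_extendedForm_apply (hD.isSmoothForm hΩ) hρ.smooth,
      hD.extD_interior hΩ, dFun_extendedHamiltonian hh, dFun_extendedHamiltonian hh,
      extendedForm_apply, one_neg, one_neg, two_neg_left, hXh.apply,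
      hXh.interior_scaling (hD.isScalingFunction hh), one_sub, hXh.dFun_swap hXr,
      show dFun I h p.2 ![D p.2] = h p.2 from (hD.isScalingFunction hh).eq p.2]
    ring

end Symplectic

/-! ### Smoothness of sums, contractions and projections of vector fields -/

section VField

variable {E H : Type*} [NormedAddCommGroup E] [NormedSpace ℝ E] [TopologicalSpace H]
  {I : ModelWithCorners ℝ E H} [I.Boundaryless]
  {M : Type*} [TopologicalSpace M] [ChartedSpace H M] [IsManifold I ∞ M]
  {E' H' : Type*} [NormedAddCommGroup E'] [NormedSpace ℝ E'] [TopologicalSpace H']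
  {I' : ModelWithCorners ℝ E' H'}
  {M' : Type*} [TopologicalSpace M'] [ChartedSpace H' M'] [IsManifold I' ∞ M']

omit [I.Boundaryless] in
lemma IsSmoothVField.sub {X Y : VField I M} (hX : IsSmoothVField I X) (hY : IsSmoothVField I Y) :
    IsSmoothVField I (fun x ↦ X x - Y x) :=
  isSmoothVField_iff.2 fun x₀ ↦
    ((isSmoothVField_iff.1 hX x₀).sub (isSmoothVField_iff.1 hY x₀)).congr fun y _ ↦
      map_sub (mfderiv I 𝓘(ℝ, E) (extChartAt I x₀) ((extChartAt I x₀).symm y)) _ _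

omit [I.Boundaryless] in
lemma IsSmoothVField.neg {X : VField I M} (hX : IsSmoothVField I X) :
    IsSmoothVField I (fun x ↦ -X x) :=
  isSmoothVField_iff.2 fun x₀ ↦
    (isSmoothVField_iff.1 hX x₀).neg.congr fun y _ ↦
      map_neg (mfderiv I 𝓘(ℝ, E) (extChartAt I x₀) ((extChartAt I x₀).symm y)) _

/-- The contraction of a one-form and a vector field is smooth. -/
lemma IsSmoothForm.contMDiff_apply {α : DForm I M 1} {X : VField I M} (hα : IsSmoothForm I α)
    (hX : IsSmoothVField I X) : ContMDiff I 𝓘(ℝ, ℝ) ∞ (fun x ↦ α x ![X x]) := by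
  intro x
  have h1 : ContDiffAt ℝ ∞ (fun y ↦ toLin E (chartRep I α x y) (vfRep I X x y))
      (extChartAt I x x) :=
    ((toLin E).contDiff.contDiffAt.comp _ (hα.contDiffAt (mem_extChartAt_target x))).clm_apply
      ((isSmoothVField_iff.1 hX x).contDiffAt
        ((isOpen_extChartAt_target x).mem_nhds (mem_extChartAt_target x)))
  refine ((contMDiffAt_iff_contDiffAt.2 h1).comp x
    (contMDiffAt_extChartAt (n := ∞))).congr_of_eventuallyEq ?_
  filter_upwards [extChartAt_source_mem_nhds (I := I) x] with z hz
  have hz' := (extChartAt I x).map_source hz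
  have hzz := (extChartAt I x).left_inv hz
  refine Eq.symm ((toLin_apply _ _).trans ((chartRep_apply_one _ _ _ _).trans ?_))
  rw [vfRep, mfderiv_symm_mfderiv_chart hz', hzz]

omit [IsManifold I' ∞ M'] in
lemma totalSpace_mk_congr {p q : M'} (h : p = q) (v : E') :
    (⟨p, v⟩ : TangentBundle I' M') = ⟨q, v⟩ := by
  subst h; rfl

omit [I.Boundaryless] in
/-- The image of a vector field under a map, along a smooth section of that map. -/
lemma isSmoothVField_mfderiv_comp {f : M → M'} {s : M' → M} {X : VField I M}
    (hf : ContMDiff I I' ∞ f) (hs : ContMDiff I' I ∞ s) (hfs : ∀ c, f (s c) = c)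
    (hX : IsSmoothVField I X) {Y : VField I' M'}
    (hY : ∀ c, (Y c : E') = mfderiv I I' f (s c) (X (s c))) : IsSmoothVField I' Y := by
  have h1 : ContMDiff I I'.tangent ∞ (fun x ↦ tangentMap I I' f ⟨x, X x⟩) :=
    (hf.contMDiff_tangentMap le_rfl).comp hX
  have h2 := h1.comp hs
  refine h2.congr fun c ↦ ?_
  exact (totalSpace_mk_congr (E' := E') (hfs c).symm (Y c)).trans
    (congrArg (fun v : E' ↦ (⟨f (s c), v⟩ : TangentBundle I' M')) (hY c))

end VField

/-! ### Contact forms separate tangent vectors -/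

section Contact

variable {E H : Type*} [NormedAddCommGroup E] [NormedSpace ℝ E] [TopologicalSpace H]
  {I : ModelWithCorners ℝ E H}
  {M : Type*} [TopologicalSpace M] [ChartedSpace H M]

/-- A tangent vector is determined by its pairings with a contact form and its differential. -/
lemma IsContactForm.ext {α : DForm I M 1} (hα : IsContactForm I α) {x : M}
    {v v' : TangentSpace I x} (h : α x ![v] = α x ![v'])
    (h' : ∀ w, extD I α x ![v, w] = extD I α x ![v', w]) : v = v' :=
  sub_eq_zero.1 <| hα.nondegenerate x _ (by rw [one_sub, h, sub_self])
    fun w _ ↦ by rw [two_sub_left, h', sub_self]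

lemma vfield_congr (X : VField I M) {p q : M} (h : p = q) : (X p : E) = X q := by
  subst h; rfl

end Contact

/-! ### The contact Hamiltonian system on the orbit space -/

section Quotient

variable {E H : Type*} [NormedAddCommGroup E] [NormedSpace ℝ E] [TopologicalSpace H]
  {I : ModelWithCorners ℝ E H}
  {M : Type*} [TopologicalSpace M] [ChartedSpace H M] [IsManifold I ∞ M]
  {E' H' : Type*} [NormedAddCommGroup E'] [NormedSpace ℝ E'] [TopologicalSpace H']
  {I' : ModelWithCorners ℝ E' H'}
  {M' : Type*} [TopologicalSpace M'] [ChartedSpace H' M'] [IsManifold I' ∞ M']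
  {Ω : DForm I M 2} {h ρ : M → ℝ} {D Xh Xr : VField I M} {π : M → M'}
  {Θ : Diffeomorph I (I'.prod 𝓘(ℝ, ℝ)) M (M' × ℝ) ∞}

/-- A vector field whose images satisfy a condition with at most one solution descends. -/
lemma IsTrivialization.exists_isRelated (hΘ : IsTrivialization D π ρ Θ) {X : VField I M}
    (hX : IsSmoothVField I X) (Q : ∀ c, TangentSpace I' c → Prop)
    (huniq : ∀ c v v', Q c v → Q c v' → v = v') (hQ : ∀ m, Q (π m) (mfderiv I I' π m (X m))) :
    ∃ Y : VField I' M', IsSmoothVField I' Y ∧ IsRelated I I' π X Y ∧ ∀ c, Q c (Y c) := by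
  have hex (c : M') : ∃ v, Q c v := by
    rw [← hΘ.proj_symm c 0]
    exact ⟨_, hQ _⟩
  choose Y hY using hex
  -- Uniqueness makes the projected vectors agree at all points of a fibre, which replaces a proof
  -- that the field is invariant under D.
  have hrel : IsRelated I I' π X Y := fun m ↦ huniq _ _ _ (hQ m) (hY _)
  refine ⟨Y, isSmoothVField_mfderiv_comp hΘ.contMDiff_proj (contMDiff_symm (Θ := Θ) 0)
    (fun c ↦ hΘ.proj_symm c 0) hX fun c ↦ ?_, hrel, hY⟩
  exact (vfield_congr Y (hΘ.proj_symm c 0).symm).trans (hrel _).symm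

omit [IsManifold I ∞ M] [IsManifold I' ∞ M'] in
lemma IsTrivialization.scaling_apply (hΘ : IsTrivialization D π ρ Θ) {f : M → ℝ}
    (hf : IsScalingFunction I D f) (m : M) (u : ℝ) :
    f (Θ.symm (π m, Real.log (ρ m) + u)) = Real.exp u * f m := by
  have h1 := hf.comp_integralCurve (hΘ.curve m) u
  simp only [add_zero, hΘ.symm_self] at h1
  exact h1

lemma extD_inv_smul_apply [I.Boundaryless] {lam : DForm I M 1} (hlam : IsSmoothForm I lam)
    (hρ : ContMDiff I 𝓘(ℝ, ℝ) ∞ ρ) (hρ0 : ∀ m, ρ m ≠ 0) (m : M) (v w : TangentSpace I m) :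
    extD I (fun m ↦ (ρ m)⁻¹ • lam m) m ![v, w] = (ρ m)⁻¹ * extD I lam m ![v, w] -
      (ρ m ^ 2)⁻¹ * (dFun I ρ m ![v] * lam m ![w] - dFun I ρ m ![w] * lam m ![v]) := by
  have hd (v : TangentSpace I m) :
      dFun I (fun m ↦ (ρ m)⁻¹) m ![v] = -(ρ m ^ 2)⁻¹ * dFun I ρ m ![v] :=
    dFun_comp_real (hasDerivAt_inv (hρ0 m)) ((hρ m).mdifferentiableAt (by simp)) v
  rw [extD_smul_apply (hρ.inv₀ hρ0) hlam, hd, hd]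
  ring

omit [IsManifold I ∞ M] in
lemma dFun_neg_div {f : M → ℝ} (hf : ContMDiff I 𝓘(ℝ, ℝ) ∞ f)
    (hρ : ContMDiff I 𝓘(ℝ, ℝ) ∞ ρ) (hρ0 : ∀ m, ρ m ≠ 0) (m : M) (v : TangentSpace I m) :
    dFun I (fun m ↦ -f m / ρ m) m ![v] =
      -(ρ m)⁻¹ * dFun I f m ![v] + f m * (ρ m ^ 2)⁻¹ * dFun I ρ m ![v] := by
  have h1 : dFun I (fun m ↦ -(ρ m)⁻¹) m ![v] = (ρ m ^ 2)⁻¹ * dFun I ρ m ![v] :=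
    dFun_comp_real (φ := fun x ↦ -x⁻¹)
      ((hasDerivAt_inv (hρ0 m)).neg.congr_deriv (neg_neg _))
      ((hρ m).mdifferentiableAt (by simp)) v
  have h2 := dFun_mul (f := f) (g := fun m ↦ -(ρ m)⁻¹) ((hf m).mdifferentiableAt (by simp))
    (((hρ.inv₀ hρ0).neg m).mdifferentiableAt (by simp)) v
  rw [h1] at h2
  have h3 : (fun m ↦ -f m / ρ m) = fun m ↦ f m * -(ρ m)⁻¹ := by
    funext m; ring
  rw [h3, h2]
  ring

variable [I.Boundaryless] [I'.Boundaryless]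

/-- The form λ/ρ is horizontal and invariant, hence descends. For nondegeneracy, X_ρ spans a
complement of ker λ; if ω(v, ·) vanishes on ker λ then it is a multiple of λ = ω(D, ·), so v is a
multiple of D and projects to zero. -/
lemma IsTrivialization.exists_contactForm (hΩ : IsSymplecticForm I Ω)
    (hD : IsScalingSymmetry I Ω h D 1) (hρ : IsScalingFunction I D ρ) (hρ0 : ∀ m, ρ m ≠ 0)
    (hΘ : IsTrivialization D π ρ Θ) (hXr : IsHamiltonianVField I Ω ρ Xr) :
    ∃ α : DForm I' M' 1, IsContactForm I' α ∧
      (∀ m v, α (π m) ![mfderiv I I' π m v] = (ρ m)⁻¹ * interior I D Ω m ![v]) ∧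
      ∀ m v w, extD I' α (π m) ![mfderiv I I' π m v, mfderiv I I' π m w] =
        (ρ m)⁻¹ * Ω m ![v, w] - (ρ m ^ 2)⁻¹ *
          (dFun I ρ m ![v] * interior I D Ω m ![w] - dFun I ρ m ![w] * interior I D Ω m ![v]) := by
  have hlam := hD.isSmoothForm hΩ
  set lam := interior I D Ω with hlamdef
  set μ : DForm I M 1 := fun m ↦ (ρ m)⁻¹ • lam m with hμdef
  have hμ : IsSmoothForm I μ := IsSmoothForm.smul (hρ.smooth.inv₀ hρ0) hlam
  have hμv (m : M) (v : TangentSpace I m) : μ m ![v] = (ρ m)⁻¹ * lam m ![v] := rfl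
  have hlamD (m : M) : lam m ![D m] = 0 := interior_apply_self m
  have hdρD (m : M) : dFun I ρ m ![D m] = ρ m := hρ.eq m
  have hdμ (m : M) (v w : TangentSpace I m) : extD I μ m ![v, w] = (ρ m)⁻¹ * Ω m ![v, w] -
      (ρ m ^ 2)⁻¹ * (dFun I ρ m ![v] * lam m ![w] - dFun I ρ m ![w] * lam m ![v]) := by
    rw [hμdef, extD_inv_smul_apply hlam hρ.smooth hρ0, hD.extD_interior hΩ]
  have hpull := hΘ.pullback_pullback hμ (fun m ↦ by rw [hμv, hlamD, mul_zero])
    (fun m w ↦ by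
      rw [hdμ, hlamD, hdρD, hlamdef, interior_apply_one]
      field_simp [hρ0 m]
      ring)
  set α := pullback I' I (fun c ↦ Θ.symm (c, 0)) μ
  have hα : IsSmoothForm I' α := hμ.pullback (contMDiff_symm 0)
  have hαv (m : M) (v : TangentSpace I m) :
      α (π m) ![mfderiv I I' π m v] = (ρ m)⁻¹ * lam m ![v] := by
    rw [← pullback_apply_one, hpull, hμv]
  have hdα (m : M) (v w : TangentSpace I m) :
      extD I' α (π m) ![mfderiv I I' π m v, mfderiv I I' π m w] = (ρ m)⁻¹ * Ω m ![v, w] -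
      (ρ m ^ 2)⁻¹ * (dFun I ρ m ![v] * lam m ![w] - dFun I ρ m ![w] * lam m ![v]) := by
    rw [← pullback_apply_two, ← extD_pullback hα hΘ.contMDiff_proj, hpull, hdμ]
  have hlamXr (m : M) : lam m ![Xr m] = ρ m := hXr.interior_scaling hρ m
  refine ⟨α, ⟨hα, fun c hc ↦ ?_, fun c v' hv hvw ↦ ?_⟩, hαv, hdα⟩
  · obtain ⟨m, rfl⟩ : ∃ m, π m = c := ⟨_, hΘ.proj_symm c 0⟩
    -- The vector X_ρ witnesses nonvanishing: λ(X_ρ)/ρ = 1.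
    have h1 := hαv m (Xr m)
    rw [hc, hlamXr, inv_mul_cancel₀ (hρ0 m)] at h1
    exact zero_ne_one h1
  · obtain ⟨m, rfl⟩ : ∃ m, π m = c := ⟨_, hΘ.proj_symm c 0⟩
    obtain ⟨v, rfl⟩ := hΘ.mfderiv_proj_surjective m v'
    rw [hαv] at hv
    have hv0 : lam m ![v] = 0 := (mul_eq_zero.1 hv).resolve_left (inv_ne_zero (hρ0 m))
    have hker (w : TangentSpace I m) (hw : lam m ![w] = 0) : Ω m ![v, w] = 0 := by
      have h1 := hvw (mfderiv I I' π m w) (by rw [hαv, hw, mul_zero])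
      rw [hdα, hw, hv0, mul_zero, mul_zero, sub_zero, mul_zero, sub_zero] at h1
      exact (mul_eq_zero.1 h1).resolve_left (inv_ne_zero (hρ0 m))
    set k := Ω m ![v, Xr m] / ρ m with hk
    have hvk : v - k • D m = 0 := hΩ.nondegenerate m _ fun w ↦ by
      -- This is the component of w in ker λ along X_ρ; `k` is the resulting factor in ω(v, ·) = k
      -- λ.
      have h1 := hker (w - (lam m ![w] / ρ m) • Xr m) (by
        rw [one_sub, one_smul, hlamXr, div_mul_cancel₀ _ (hρ0 m), sub_self])
      rw [sub_eq_add_neg, ← neg_smul, two_add_right, two_smul_right] at h1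
      rw [two_sub_left, two_smul_left, hk, ← interior_apply_one D Ω m w, ← hlamdef]
      linear_combination h1
    rw [sub_eq_zero.1 hvk, map_smul, hΘ.proj_curve, smul_zero]

/-- The contact Hamiltonian system on the orbit space of a scaling symmetry of degree one. -/
theorem IsTrivialization.exists_contactHamiltonian (hΩ : IsSymplecticForm I Ω)
    (hD : IsScalingSymmetry I Ω h D 1) (hh : ContMDiff I 𝓘(ℝ, ℝ) ∞ h)
    (hρ : IsScalingFunction I D ρ) (hρ0 : ∀ m, ρ m ≠ 0)
    (hΘ : IsTrivialization D π ρ Θ) (hXr : IsHamiltonianVField I Ω ρ Xr)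
    (hXh : IsHamiltonianVField I Ω h Xh) :
    ∃ (α : DForm I' M' 1) (f : M' → ℝ) (X : VField I' M'), IsContactForm I' α ∧
      (∀ m v, α (π m) ![mfderiv I I' π m v] = (ρ m)⁻¹ * interior I D Ω m ![v]) ∧
      ContMDiff I' 𝓘(ℝ, ℝ) ∞ f ∧ (∀ m, f (π m) = -h m / ρ m) ∧
      IsContactHamiltonianVField I' α f X ∧ IsRelated I I' π Xh X := by
  obtain ⟨α, hα, hαv, hdα⟩ := hΘ.exists_contactForm hΩ hD hρ hρ0 hXr
  have hhs := hD.isScalingFunction hh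
  have hquot : ContMDiff I 𝓘(ℝ, ℝ) ∞ (fun m ↦ -h m / ρ m) := hh.neg.div₀ hρ.smooth hρ0
  let f : M' → ℝ := fun c ↦ -h (Θ.symm (c, 0)) / ρ (Θ.symm (c, 0))
  have hf : ContMDiff I' 𝓘(ℝ, ℝ) ∞ f := hquot.comp (contMDiff_symm (Θ := Θ) 0)
  have hfπ (m : M) : f (π m) = -h m / ρ m := by
    -- Time -log|ρ(m)| moves m to the slice |ρ| = 1. Both H and ρ change by the same factor, so the
    -- quotient defining f does not.
    have h1 := hΘ.scaling_apply hhs m (-Real.log (ρ m))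
    have h2 := hΘ.scaling_apply hρ m (-Real.log (ρ m))
    rw [add_neg_cancel] at h1 h2
    simp only [f]
    rw [h1, h2, ← mul_neg, mul_div_mul_left _ _ (Real.exp_pos _).ne']
  have hdf (m : M) (v : TangentSpace I m) : dFun I' f (π m) ![mfderiv I I' π m v] =
      -(ρ m)⁻¹ * dFun I h m ![v] + h m * (ρ m ^ 2)⁻¹ * dFun I ρ m ![v] := by
    rw [← pullback_apply_one, pullback_dFun hf hΘ.contMDiff_proj,
      show f ∘ π = fun m ↦ -h m / ρ m from funext hfπ, dFun_neg_div hh hρ.smooth hρ0]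
  -- The Reeb field on the orbit space is the projection of X_ρ; the Reeb equations are the
  -- condition with at most one solution.
  obtain ⟨R, hR, hRrel, hRQ⟩ := hΘ.exists_isRelated hXr.smooth
    (fun c v ↦ α c ![v] = 1 ∧ ∀ w, extD I' α c ![v, w] = 0)
    (fun c v v' h1 h2 ↦ hα.ext (h1.1.trans h2.1.symm) fun w ↦ (h1.2 w).trans (h2.2 w).symm)
    (fun m ↦ by
      refine ⟨by rw [hαv, hXr.interior_scaling hρ, inv_mul_cancel₀ (hρ0 m)], fun w' ↦ ?_⟩
      obtain ⟨w, rfl⟩ := hΘ.mfderiv_proj_surjective m w'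
      rw [hdα, hXr.apply, hXr.dFun_self, hXr.interior_scaling hρ]
      field_simp [hρ0 m]
      ring)
  have hReeb : IsReebVField I' α R :=
    ⟨hR, funext fun c ↦ one_ext fun w ↦ (interior_apply_one R _ c w).trans ((hRQ c).2 w),
      fun c ↦ (hRQ c).1⟩
  -- The same descent for X_H, with the contact Hamiltonian equations as the determining condition;
  -- X_ρ(H) = -X_H(ρ) makes the Reeb derivative match.
  obtain ⟨X, hX, hXrel, hXQ⟩ := hΘ.exists_isRelated hXh.smooth
    (fun c v ↦ α c ![v] = -f c ∧ ∀ w, extD I' α c ![v, w] =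
      dFun I' f c ![w] - dFun I' f c ![R c] * α c ![w])
    (fun c v v' h1 h2 ↦ hα.ext (h1.1.trans h2.1.symm) fun w ↦ (h1.2 w).trans (h2.2 w).symm)
    (fun m ↦ by
      refine ⟨by rw [hαv, hXh.interior_scaling hhs, hfπ]; ring, fun w' ↦ ?_⟩
      obtain ⟨w, rfl⟩ := hΘ.mfderiv_proj_surjective m w'
      rw [hdα, hdf, ← hRrel, hdf, hαv, hXr.dFun_self, hXh.dFun_swap hXr, hXh.apply,
        hXh.interior_scaling hhs]
      ring)
  exact ⟨α, f, X, hα, hαv, hf, hfπ,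
    ⟨hX, fun c ↦ (hXQ c).1, R, hReeb, fun c ↦ one_ext fun w ↦
      (interior_apply_one X _ c w).trans ((hXQ c).2 w)⟩, hXrel⟩

end Quotient

/-! ### Graphs as embedded submanifolds -/

section Graph

variable {E H : Type*} [NormedAddCommGroup E] [NormedSpace ℝ E] [TopologicalSpace H]
  {I : ModelWithCorners ℝ E H}
  {M : Type*} [TopologicalSpace M] [ChartedSpace H M]

/-- The diffeomorphism `(t, m) ↦ (t - g m, m)`. -/
def shear {g : M → ℝ} (hg : ContMDiff I 𝓘(ℝ, ℝ) ∞ g) :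
    Diffeomorph (𝓘(ℝ, ℝ).prod I) (𝓘(ℝ, ℝ).prod I) (ℝ × M) (ℝ × M) ∞ where
  toFun p := (p.1 - g p.2, p.2)
  invFun p := (p.1 + g p.2, p.2)
  left_inv _ := Prod.ext (sub_add_cancel _ _) rfl
  right_inv _ := Prod.ext (add_sub_cancel_right _ _) rfl
  contMDiff_toFun := (contMDiff_fst.sub (hg.comp contMDiff_snd)).prodMk contMDiff_snd
  contMDiff_invFun := (contMDiff_fst.add (hg.comp contMDiff_snd)).prodMk contMDiff_snd

/-- A chart of the target of a diffeomorphism induces a chart of its source. -/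
lemma Diffeomorph.trans_chart_mem_maximalAtlas [IsManifold I ∞ M] (Ψ : Diffeomorph I I M M ∞)
    (x : M) : Ψ.toHomeomorph.toOpenPartialHomeomorph.trans (chartAt H x) ∈
      IsManifold.maximalAtlas I ∞ M := by
  refine OpenPartialHomeomorph.mem_maximalAtlas_of_contMDiffOn _ ?_ ?_
  · refine (contMDiffOn_chart (x := x)).comp Ψ.contMDiff.contMDiffOn fun y hy ↦ ?_
    exact hy.2
  · refine Ψ.symm.contMDiff.comp_contMDiffOn ((contMDiffOn_chart_symm (x := x)).mono fun y hy ↦ ?_)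
    exact hy.1

/-- The shear by g straightens the graph to {0} × M, so in sheared charts the map reads y ↦ (0, y),
the normal form of an immersion with complement ℝ. -/
lemma isSmoothEmbedding_graph [IsManifold I ∞ M] {g : M → ℝ} (hg : ContMDiff I 𝓘(ℝ, ℝ) ∞ g) :
    IsSmoothEmbedding I (𝓘(ℝ, ℝ).prod I) ∞ (fun m ↦ (g m, m)) where
  isEmbedding := Function.LeftInverse.isEmbedding (g := fun m ↦ (g m, m)) (f := Prod.snd)
    (fun _ ↦ rfl) continuous_snd (hg.continuous.prodMk continuous_id)
  isImmersion := by
    refine IsImmersionOfComplement.isImmersion (F := ℝ) fun x ↦ ?_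
    refine IsImmersionAtOfComplement.mk_of_continuousAt
      (hg.continuous.prodMk continuous_id).continuousAt (ContinuousLinearEquiv.prodComm ℝ E ℝ)
      (chartAt H x) ((shear hg).toHomeomorph.toOpenPartialHomeomorph.trans
        (chartAt (ModelProd ℝ H) ((0 : ℝ), x))) (mem_chart_source H x) ?_
      (IsManifold.chart_mem_maximalAtlas x) (Diffeomorph.trans_chart_mem_maximalAtlas _ _) ?_
    · refine ⟨trivial, ?_⟩
      rw [prodChartedSpace_chartAt]
      exact ⟨trivial, mem_chart_source H x⟩
    · intro y hy
      have h1 : extChartAt I x ((extChartAt I x).symm y) = y := (extChartAt I x).right_inv hy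
      change extChartAt (𝓘(ℝ, ℝ).prod I) ((0 : ℝ), x)
        (g ((extChartAt I x).symm y) - g ((extChartAt I x).symm y), (extChartAt I x).symm y) =
          ((0 : ℝ), y)
      rw [extChartAt_prod, extChartAt_model_space_eq_id, sub_self]
      exact Prod.ext rfl h1

end Graph

/-! ### The zero level J₀ and related vector fields -/

section ZeroLevel

variable {E H : Type*} [NormedAddCommGroup E] [NormedSpace ℝ E] [TopologicalSpace H]
  {I : ModelWithCorners ℝ E H}
  {M : Type*} [TopologicalSpace M] [ChartedSpace H M] [IsManifold I ∞ M]
  {E' H' : Type*} [NormedAddCommGroup E'] [NormedSpace ℝ E'] [TopologicalSpace H']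
  {I' : ModelWithCorners ℝ E' H'}
  {M' : Type*} [TopologicalSpace M'] [ChartedSpace H' M'] [IsManifold I' ∞ M']
  {E'' H'' : Type*} [NormedAddCommGroup E''] [NormedSpace ℝ E''] [TopologicalSpace H'']
  {I'' : ModelWithCorners ℝ E'' H''}
  {M'' : Type*} [TopologicalSpace M''] [ChartedSpace H'' M''] [IsManifold I'' ∞ M'']
  {lam : DForm I M 1} {ρ : M → ℝ} {D : VField I M}

omit [IsManifold I ∞ M] in
-- The pairing is e^{-t}ρ - 1 = e^{log ρ - t} - 1; this is where positivity of ρ enters.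
lemma extendedForm_apply_extendedField (hρ : IsScalingFunction I D ρ)
    (hlam : ∀ m, lam m ![D m] = 0) (hρ0 : ∀ m, 0 < ρ m) (p : ℝ × M) :
    extendedForm I lam ρ p ![extendedField I D p] = 0 ↔ p.1 = Real.log (ρ p.2) := by
  rw [extendedField_apply, extendedForm_apply, hlam,
    show dFun I ρ p.2 ![D p.2] = ρ p.2 from hρ.eq p.2, zero_add]
  nth_rw 1 [← Real.exp_log (hρ0 p.2)]
  rw [← Real.exp_add, sub_eq_zero, Real.exp_eq_one_iff]
  constructor <;> intro h <;> linarith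

omit [IsManifold I ∞ M] in
lemma mfderiv_graph {g : M → ℝ} (hg : ContMDiff I 𝓘(ℝ, ℝ) ∞ g) (m : M) (v : TangentSpace I m) :
    mfderiv I (𝓘(ℝ, ℝ).prod I) (fun m ↦ (g m, m)) m v = prodVec (g m, m) (dFun I g m ![v]) v := by
  have h := ((hg m).mdifferentiableAt (by simp)).hasMFDerivAt.prodMk (hasMFDerivAt_id (I := I) m)
  exact DFunLike.congr_fun h.mfderiv v

omit [IsManifold I ∞ M] in
lemma IsScalingFunction.dFun_log_apply (hρ : IsScalingFunction I D ρ) (hρ0 : ∀ m, ρ m ≠ 0)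
    (m : M) : dFun I (fun m ↦ Real.log (ρ m)) m ![D m] = 1 := by
  rw [dFun_log ((hρ.smooth m).mdifferentiableAt (by simp)) (hρ0 m),
    show dFun I ρ m ![D m] = ρ m from hρ.eq m, inv_mul_cancel₀ (hρ0 m)]

omit [IsManifold I' ∞ M'] in
/-- The graph of `log ρ` is the zero level of `i_X η`, and its quotient is `M / D`. -/
lemma isZeroLevelQuotient_graph (hD : IsSmoothVField I D) (hρ : IsScalingFunction I D ρ)
    (hlam : ∀ m, lam m ![D m] = 0) (hρ0 : ∀ m, 0 < ρ m) {π : M → M'}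
    (hπ : IsOrbitQuotient I I' D π) :
    IsZeroLevelQuotient (𝓘(ℝ, ℝ).prod I) I I' (extendedForm I lam ρ) (extendedField I D)
      (fun m ↦ (Real.log (ρ m), m)) π where
  embedding := isSmoothEmbedding_graph (hρ.contMDiff_log fun m ↦ (hρ0 m).ne')
  range := by
    ext p
    rw [Set.mem_ofPred_eq, extendedForm_apply_extendedField hρ hlam hρ0]
    constructor
    · rintro ⟨m, rfl⟩
      rfl
    · exact fun h ↦ ⟨p.2, Prod.ext h.symm rfl⟩
  quotient := by
    refine ⟨D, hD, fun m ↦ ?_, hπ⟩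
    refine (mfderiv_graph (hρ.contMDiff_log fun m ↦ (hρ0 m).ne') m (D m)).trans ?_
    rw [hρ.dFun_log_apply fun m ↦ (hρ0 m).ne']
    rfl

omit [IsManifold I ∞ M] [IsManifold I'' ∞ M''] in
-- J₀ is a graph over M, so the second component of the inclusion is bijective for every realization
-- of J₀.
lemma IsZeroLevelQuotient.exists_diffeomorph (hρ : IsScalingFunction I D ρ)
    (hlam : ∀ m, lam m ![D m] = 0) (hρ0 : ∀ m, 0 < ρ m) {ι₀ : M' → ℝ × M} {π₀ : M' → M''}
    (hJ : IsZeroLevelQuotient (𝓘(ℝ, ℝ).prod I) I' I'' (extendedForm I lam ρ) (extendedField I D)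
      ι₀ π₀) :
    ∃ j : Diffeomorph I' I M' M ∞, ∀ y, ι₀ y = (Real.log (ρ (j y)), j y) := by
  have hι := hJ.embedding.contMDiff
  have hg : ContMDiff I (𝓘(ℝ, ℝ).prod I) ∞ (fun m ↦ (Real.log (ρ m), m)) :=
    (hρ.contMDiff_log fun m ↦ (hρ0 m).ne').prodMk contMDiff_id
  have hmem (p : ℝ × M) : p ∈ Set.range ι₀ ↔ p.1 = Real.log (ρ p.2) := by
    rw [hJ.range, Set.mem_ofPred_eq, extendedForm_apply_extendedField hρ hlam hρ0]
  have hι' (y : M') : ι₀ y = (Real.log (ρ (ι₀ y).2), (ι₀ y).2) :=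
    Prod.ext ((hmem _).1 ⟨y, rfl⟩) rfl
  have hex (m : M) : ∃ y, ι₀ y = (Real.log (ρ m), m) := (hmem _).2 rfl
  choose k hk using hex
  have hkι : ι₀ ∘ k = fun m ↦ (Real.log (ρ m), m) := funext hk
  -- A map into an embedded submanifold is smooth once its composite with the inclusion is; here the
  -- composite is the graph map.
  have hks : ContMDiff I I' ∞ k := by
    rw [ContMDiff.iff_comp_isImmersion hJ.embedding.isImmersion, hkι]
    refine ⟨?_, hg⟩
    rw [hJ.embedding.isEmbedding.continuous_iff, hkι]
    exact hg.continuous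
  refine ⟨⟨⟨fun y ↦ (ι₀ y).2, k, fun y ↦ ?_, fun m ↦ ?_⟩, contMDiff_snd.comp hι, hks⟩, hι'⟩
  · refine hJ.embedding.isEmbedding.injective ?_
    rw [hk, ← hι']
  · exact congrArg Prod.snd (hk m)

omit [IsManifold I ∞ M] [IsManifold I' ∞ M'] in
lemma IsRelated.comp_integralCurve {f : M → M'} {X : VField I M} {Y : VField I' M'}
    (hf : ContMDiff I I' ∞ f) (hXY : IsRelated I I' f X Y) {γ : ℝ → M}
    (hγ : IsMIntegralCurve γ X) : IsMIntegralCurve (f ∘ γ) Y := fun t ↦ by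
  have h := HasMFDerivAt.comp_curve (hγ t) ((hf (γ t)).mdifferentiableAt (by simp))
  rw [hXY] at h
  exact h

omit [IsManifold I ∞ M] [IsManifold I' ∞ M'] in
lemma IsRelated.symm {Φ : Diffeomorph I I' M M' ∞} {X : VField I M} {Y : VField I' M'}
    (hXY : IsRelated I I' Φ X Y) : IsRelated I' I Φ.symm Y X := fun y ↦ by
  obtain ⟨x, rfl⟩ : ∃ x, Φ x = y := ⟨Φ.symm y, Φ.apply_symm_apply y⟩
  have h := mfderiv_comp x ((Φ.symm.contMDiff (Φ x)).mdifferentiableAt (by simp))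
    ((Φ.contMDiff x).mdifferentiableAt (by simp))
  have h1 : Φ.symm ∘ Φ = id := funext Φ.symm_apply_apply
  rw [h1, mfderiv_id] at h
  rw [← hXY]
  exact (DFunLike.congr_fun h (X x)).symm.trans (vfield_congr X (Φ.symm_apply_apply x).symm)

omit [IsManifold I ∞ M] [IsManifold I' ∞ M'] [IsManifold I'' ∞ M''] in
lemma IsRelated.comp {f : M → M'} {g : M' → M''} {X : VField I M} {Y : VField I' M'}
    {Z : VField I'' M''} (hg : ContMDiff I' I'' ∞ g) (hf : ContMDiff I I' ∞ f)
    (hYZ : IsRelated I' I'' g Y Z) (hXY : IsRelated I I' f X Y) :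
    IsRelated I I'' (g ∘ f) X Z := fun x ↦ by
  have h := mfderiv_comp x ((hg (f x)).mdifferentiableAt (by simp))
    ((hf x).mdifferentiableAt (by simp))
  exact (DFunLike.congr_fun h (X x)).trans
    ((congrArg (mfderiv I' I'' g (f x)) (hXY x)).trans (hYZ (f x)))

omit [IsManifold I ∞ M] [IsManifold I' ∞ M'] in
lemma IsRelated.neg {f : M → M'} {X : VField I M} {Y : VField I' M'}
    (hXY : IsRelated I I' f X Y) :
    IsRelated I I' f (fun x ↦ -X x) (fun y ↦ -Y y) := fun x ↦ by
  rw [map_neg, hXY]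

/-- The image of a vector field under a diffeomorphism. -/
lemma Diffeomorph.exists_isRelated (Φ : Diffeomorph I I' M M' ∞) {X : VField I M}
    (hX : IsSmoothVField I X) : ∃ Y : VField I' M', IsSmoothVField I' Y ∧ IsRelated I I' Φ X Y := by
  let g : M → E' := fun x ↦ mfderiv I I' Φ x (X x)
  let Y : VField I' M' := fun y ↦ g (Φ.symm y)
  exact ⟨Y, isSmoothVField_mfderiv_comp Φ.contMDiff Φ.symm.contMDiff Φ.apply_symm_apply hX
    fun _ ↦ rfl, fun x ↦ (congrArg g (Φ.symm_apply_apply x)).symm⟩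

end ZeroLevel

/-! ### Comparison of the reduced system on P₀ with the system on C -/

section Reduction

variable {E H : Type*} [NormedAddCommGroup E] [NormedSpace ℝ E] [TopologicalSpace H]
  {I : ModelWithCorners ℝ E H}
  {M : Type*} [TopologicalSpace M] [ChartedSpace H M] [IsManifold I ∞ M]
  {E' H' : Type*} [NormedAddCommGroup E'] [NormedSpace ℝ E'] [TopologicalSpace H']
  {I' : ModelWithCorners ℝ E' H'}
  {M' : Type*} [TopologicalSpace M'] [ChartedSpace H' M'] [IsManifold I' ∞ M']
  {E'' H'' : Type*} [NormedAddCommGroup E''] [NormedSpace ℝ E''] [TopologicalSpace H'']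
  {I'' : ModelWithCorners ℝ E'' H''}
  {M'' : Type*} [TopologicalSpace M''] [ChartedSpace H'' M''] [IsManifold I'' ∞ M'']
  {Ω : DForm I M 2} {h ρ : M → ℝ} {D Xh : VField I M} {π : M → M'} {π' : M → M''}
  {Θ : Diffeomorph I (I'.prod 𝓘(ℝ, ℝ)) M (M' × ℝ) ∞}
  {Θ' : Diffeomorph I (I''.prod 𝓘(ℝ, ℝ)) M (M'' × ℝ) ∞}

omit [IsManifold I ∞ M] [IsManifold I' ∞ M'] [IsManifold I'' ∞ M''] in
/-- Two trivializations of the same orbit space differ by a diffeomorphism. -/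
lemma IsTrivialization.exists_diffeomorph (hΘ : IsTrivialization D π ρ Θ)
    (hΘ' : IsTrivialization D π' ρ Θ')
    (hπ : ∀ γ : ℝ → M, IsMIntegralCurve γ D → ∀ t, π (γ t) = π (γ 0))
    (hπ' : ∀ γ : ℝ → M, IsMIntegralCurve γ D → ∀ t, π' (γ t) = π' (γ 0)) :
    ∃ Φ : Diffeomorph I' I'' M' M'' ∞, ∀ m, Φ (π m) = π' m := by
  -- Sliding m along its orbit to the slice log|ρ| = 0 does not change its class, so the slice
  -- section followed by π' is the comparison map.
  have h1 (m : M) : π' (Θ.symm (π m, 0)) = π' m := by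
    have h2 := hπ' _ (hΘ.curve m) (-Real.log (ρ m))
    simpa only [add_neg_cancel, add_zero, hΘ.symm_self] using h2
  have h1' (m : M) : π (Θ'.symm (π' m, 0)) = π m := by
    have h2 := hπ _ (hΘ'.curve m) (-Real.log (ρ m))
    simpa only [add_neg_cancel, add_zero, hΘ'.symm_self] using h2
  refine ⟨⟨⟨fun c ↦ π' (Θ.symm (c, 0)), fun c ↦ π (Θ'.symm (c, 0)), fun c ↦ ?_, fun c ↦ ?_⟩,
    hΘ'.contMDiff_proj.comp (contMDiff_symm (Θ := Θ) 0),
    hΘ.contMDiff_proj.comp (contMDiff_symm (Θ := Θ') 0)⟩, h1⟩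
  · simp only [h1', hΘ.proj_symm]
  · simp only [h1, hΘ'.proj_symm]

/-- The contact Hamiltonian vector field of the opposite function. -/
lemma IsContactHamiltonianVField.neg {α : DForm I M 1} {f : M → ℝ} {X : VField I M}
    (hX : IsContactHamiltonianVField I α f X) :
    IsContactHamiltonianVField I α (fun x ↦ -f x) (fun x ↦ -X x) where
  smooth := hX.smooth.neg
  eta x := by rw [one_neg, hX.eta]
  interior_d := by
    obtain ⟨R, hR, hRX⟩ := hX.interior_d
    have hneg (x : M) (v : TangentSpace I x) :
        dFun I (fun x ↦ -f x) x ![v] = -dFun I f x ![v] :=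
      DFunLike.congr_fun (mfderiv_neg (f := f) (x := x)) v
    refine ⟨R, hR, fun x ↦ one_ext fun w ↦ ?_⟩
    have h1 : extD I α x ![X x, w] = dFun I f x ![w] - dFun I f x ![R x] * α x ![w] :=
      DFunLike.congr_fun (hRX x) ![w]
    have h2 : (dFun I (fun x ↦ -f x) x - lieFun I R (fun x ↦ -f x) x • α x) ![w] =
      dFun I (fun x ↦ -f x) x ![w] - dFun I (fun x ↦ -f x) x ![R x] * α x ![w] := rfl
    rw [h2, interior_apply_one, two_neg_left, h1, hneg, hneg]
    ring

omit [IsManifold I ∞ M] [IsManifold I' ∞ M'] in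
/-- The form `i_D Ω` is rescaled by the flow of `D`. -/
lemma IsTrivialization.pullback_flow_interior (hρ : IsScalingFunction I D ρ)
    (hρ0 : ∀ m, ρ m ≠ 0) (hΘ : IsTrivialization D π ρ Θ) {α : DForm I' M' 1}
    (hα : ∀ m v, α (π m) ![mfderiv I I' π m v] = (ρ m)⁻¹ * interior I D Ω m ![v]) (s : ℝ) (m : M) :
    pullback I I (fun m ↦ Θ.symm (π m, Real.log (ρ m) + s)) (interior I D Ω) m =
      Real.exp s • interior I D Ω m := by
  set φ := fun m ↦ Θ.symm (π m, Real.log (ρ m) + s) with hφ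
  have hφs : ContMDiff I I ∞ φ := hΘ.isFlow.contMDiff s
  have hπφ : π ∘ φ = π := funext fun m ↦ hΘ.proj_symm _ _
  refine one_ext fun v ↦ ?_
  rw [pullback_apply_one]
  -- As π ∘ φ = π, the form λ/ρ = π^*α is invariant under φ; since ρ ∘ φ = e^s ρ, λ is multiplied by
  -- e^s.
  have h1 := congrFun (pullback_comp α hΘ.contMDiff_proj hφs) m
  rw [hπφ] at h1
  have h2 := DFunLike.congr_fun h1 ![v]
  rw [pullback_apply_one, pullback_apply_one, pullback_apply_one, hα, hα,
    show ρ (φ m) = _ from hΘ.scaling_apply hρ m s] at h2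
  have h3 := hρ0 m
  have h4 := (Real.exp_pos s).ne'
  field_simp at h2
  exact h2.symm.trans (mul_comm _ _)

omit [IsManifold I' ∞ M'] in
/-- The flow of the extended field preserves the extended form and the extended Hamiltonian. -/
theorem IsTrivialization.exists_isFlow_extendedField
    (hD : IsScalingSymmetry I Ω h D 1) (hh : ContMDiff I 𝓘(ℝ, ℝ) ∞ h)
    (hρ : IsScalingFunction I D ρ) (hρ0 : ∀ m, ρ m ≠ 0)
    (hΘ : IsTrivialization D π ρ Θ) {α : DForm I' M' 1}
    (hα : ∀ m v, α (π m) ![mfderiv I I' π m v] = (ρ m)⁻¹ * interior I D Ω m ![v]) :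
    ∃ ψ : ℝ → ℝ × M → ℝ × M, IsFlow (𝓘(ℝ, ℝ).prod I) (extendedField I D) ψ ∧
      (∀ s, pullback (𝓘(ℝ, ℝ).prod I) (𝓘(ℝ, ℝ).prod I) (ψ s)
        (extendedForm I (interior I D Ω) ρ) = extendedForm I (interior I D Ω) ρ) ∧
      ∀ s p, extendedHamiltonian h (ψ s p) = extendedHamiltonian h p := by
  refine ⟨_, hΘ.isFlow.extendedField, fun s ↦ pullback_extendedForm (hΘ.isFlow.contMDiff s) s
    (hΘ.pullback_flow_interior hρ hρ0 hα s) hρ.smooth (hΘ.scaling_apply hρ · s),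
    fun s p ↦ ?_⟩
  simp only [extendedHamiltonian]
  rw [hΘ.scaling_apply (hD.isScalingFunction hh), ← mul_assoc, ← Real.exp_add]
  congr 2
  ring

variable [I'.Boundaryless] [I''.Boundaryless]

omit [IsManifold I ∞ M] in
/-- Every realization of the quotient of the zero level is a quotient of `M` by `D`. -/
theorem IsZeroLevelQuotient.exists_trivialization [FiniteDimensional ℝ E']
    [FiniteDimensional ℝ E''] {lam : DForm I M 1} (hρ : IsScalingFunction I D ρ)
    (hlam : ∀ m, lam m ![D m] = 0) (hρ0 : ∀ m, 0 < ρ m) {ι₀ : M' → ℝ × M} {π₀ : M' → M''}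
    (hJ : IsZeroLevelQuotient (𝓘(ℝ, ℝ).prod I) I' I'' (extendedForm I lam ρ) (extendedField I D)
      ι₀ π₀) :
    ∃ (j : Diffeomorph I' I M' M ∞) (Θ' : Diffeomorph I (I''.prod 𝓘(ℝ, ℝ)) M (M'' × ℝ) ∞),
      (∀ y, ι₀ y = (Real.log (ρ (j y)), j y)) ∧ IsTrivialization D (π₀ ∘ j.symm) ρ Θ' ∧
      (∀ γ : ℝ → M, IsMIntegralCurve γ D → ∀ t, π₀ (j.symm (γ t)) = π₀ (j.symm (γ 0))) := by
  obtain ⟨j, hj⟩ := hJ.exists_diffeomorph hρ hlam hρ0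
  obtain ⟨X₀, hX₀, hX₀rel, hπ₀⟩ := hJ.quotient
  have hjι : (j : M' → M) = Prod.snd ∘ ι₀ := funext fun y ↦ by rw [Function.comp_apply, hj]
  have hrel : IsRelated I' I j X₀ D := by
    rw [hjι]
    exact IsRelated.comp contMDiff_snd hJ.embedding.contMDiff
      (fun p ↦ mfderiv_snd_prodVec p 1 (D p.2)) hX₀rel
  -- The scaling function transported to J₀ allows the trivialization theorem to be used for the
  -- given quotient J₀ → P₀; the result is then carried back to M by `j`.
  have hρj : IsScalingFunction I' X₀ (ρ ∘ j) := by
    refine ⟨hρ.smooth.comp j.contMDiff, fun y ↦ ?_⟩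
    rw [lieFun, ← pullback_dFun hρ.smooth j.contMDiff, pullback_apply_one, hrel]
    exact hρ.eq _
  obtain ⟨Θ₀, hΘ₀⟩ := hπ₀.exists_trivialization hρj fun y ↦ (hρ0 (j y)).ne'
  have hΘ₀t := hπ₀.isTrivialization hρj (fun y ↦ (hρ0 (j y)).ne') hΘ₀
  refine ⟨j, j.symm.trans Θ₀, hj, ⟨fun m ↦ ?_, fun m ↦ ?_⟩, fun γ hγ t ↦ ?_⟩
  · refine (hΘ₀ (j.symm m)).trans ?_
    simp only [Function.comp_apply, j.apply_symm_apply]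
  · have h1 := hrel.comp_integralCurve j.contMDiff (hΘ₀t.curve (j.symm m))
    simp only [Function.comp_apply, j.apply_symm_apply] at h1
    exact h1
  · exact hπ₀.comp_integralCurve (hrel.symm.comp_integralCurve j.symm.contMDiff hγ) t

variable [I.Boundaryless]

/-- The contact Hamiltonian system of `K` reduces to that of `h` with the opposite sign. -/
theorem IsTrivialization.exists_reduction [FiniteDimensional ℝ E'] {C EC HC : Type*}
    [NormedAddCommGroup EC] [NormedSpace ℝ EC] [TopologicalSpace HC] [TopologicalSpace C]
    [ChartedSpace HC C] {IC : ModelWithCorners ℝ EC HC} [IC.Boundaryless] [IsManifold IC ∞ C]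
    {πC : M → C} {ΘC : Diffeomorph I (IC.prod 𝓘(ℝ, ℝ)) M (C × ℝ) ∞}
    {αC : DForm IC C 1} {fC : C → ℝ} {XC : VField IC C} {Xr : VField I M}
    [FiniteDimensional ℝ E''] (hΩ : IsSymplecticForm I Ω)
    (hD : IsScalingSymmetry I Ω h D 1) (hh : ContMDiff I 𝓘(ℝ, ℝ) ∞ h)
    (hρ : IsScalingFunction I D ρ) (hρ0 : ∀ m, 0 < ρ m)
    (hΘC : IsTrivialization D πC ρ ΘC)
    (hπC : ∀ γ : ℝ → M, IsMIntegralCurve γ D → ∀ t, πC (γ t) = πC (γ 0))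
    (hXr : IsHamiltonianVField I Ω ρ Xr) (hXh : IsHamiltonianVField I Ω h Xh)
    (hαC : ∀ m v, αC (πC m) ![mfderiv I IC πC m v] = (ρ m)⁻¹ * interior I D Ω m ![v])
    (hfC : ∀ m, fC (πC m) = -h m / ρ m) (hXC : IsRelated I IC πC Xh XC)
    {ι₀ : M' → ℝ × M} {π₀ : M' → M''}
    (hJ : IsZeroLevelQuotient (𝓘(ℝ, ℝ).prod I) I' I'' (extendedForm I (interior I D Ω) ρ)
      (extendedField I D) ι₀ π₀) :
    ∃ (αP : DForm I'' M'' 1) (fP : M'' → ℝ) (XP : VField I'' M'')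
      (Φ : Diffeomorph IC I'' C M'' ∞),
      IsContactForm I'' αP ∧
      pullback I' I'' π₀ αP =
        pullback I' (𝓘(ℝ, ℝ).prod I) ι₀ (extendedForm I (interior I D Ω) ρ) ∧
      ContMDiff I'' 𝓘(ℝ, ℝ) ∞ fP ∧
      (∀ y, fP (π₀ y) = extendedHamiltonian h (ι₀ y)) ∧
      IsContactHamiltonianVField I'' αP fP XP ∧
      (∃ XJ : VField I' M', IsSmoothVField I' XJ ∧
        IsRelated I' (𝓘(ℝ, ℝ).prod I) ι₀ XJ
          (fun p ↦ prodVec p (-(Real.exp (-p.1) * dFun I ρ p.2 ![Xh p.2])) (-Xh p.2)) ∧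
        IsRelated I' I'' π₀ XJ XP) ∧
      (∀ y, Φ (πC (ι₀ y).2) = π₀ y) ∧
      pullback IC I'' Φ αP = αC ∧
      (∀ c, fP (Φ c) = -fC c) ∧
      IsRelated IC I'' Φ XC (-XP) := by
  have hρ0' (m : M) : ρ m ≠ 0 := (hρ0 m).ne'
  obtain ⟨j, ΘP, hj, hΘP, hinv⟩ := hJ.exists_trivialization hρ (fun m ↦ interior_apply_self m) hρ0
  set πP : M → M'' := π₀ ∘ j.symm with hπP
  have hπPj (y : M') : πP (j y) = π₀ y := congrArg π₀ (j.symm_apply_apply y)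
  have hπ₀ : π₀ = πP ∘ j := funext fun y ↦ (hπPj y).symm
  -- P₀ is also an orbit space of D on M, so it carries the same system as C, built from λ/ρ and
  -- -H/ρ. The reduced system of K is this one with function and field negated.
  obtain ⟨α, f, X, hα, hαv, hf, hfv, hX, hXrel⟩ :=
    hΘP.exists_contactHamiltonian hΩ hD hh hρ hρ0' hXr hXh
  obtain ⟨Φ, hΦ⟩ := hΘC.exists_diffeomorph hΘP hπC hinv
  have hΦπ : Φ ∘ πC = πP := funext hΦ
  have hlog := hρ.contMDiff_log hρ0'
  have hιj : ι₀ = (fun m ↦ (Real.log (ρ m), m)) ∘ j := funext hj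
  have hgraph : ContMDiff I (𝓘(ℝ, ℝ).prod I) ∞ (fun m ↦ (Real.log (ρ m), m)) :=
    hlog.prodMk contMDiff_id
  have hexp (m : M) : Real.exp (-Real.log (ρ m)) = (ρ m)⁻¹ := by
    rw [Real.exp_neg, Real.exp_log (hρ0 m)]
  have hdlog (m : M) (v : TangentSpace I m) :
      dFun I (fun m ↦ Real.log (ρ m)) m ![v] = (ρ m)⁻¹ * dFun I ρ m ![v] :=
    dFun_log ((hρ.smooth m).mdifferentiableAt (by simp)) (hρ0' m) v
  have hsurjC (c : C) : ∃ m, πC m = c := ⟨_, hΘC.proj_symm c 0⟩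
  refine ⟨α, fun c ↦ -f c, fun c ↦ -X c, Φ, hα, ?_, hf.neg, ?_, hX.neg, ?_, ?_, ?_, ?_, ?_⟩
  -- On the graph of log ρ, e^{-t} = 1/ρ and dt pulls back to dρ/ρ, so the dρ-terms cancel and η
  -- becomes λ/ρ.
  · have hpull : pullback I I'' πP α =
        pullback I (𝓘(ℝ, ℝ).prod I) (fun m ↦ (Real.log (ρ m), m))
          (extendedForm I (interior I D Ω) ρ) := by
      funext m
      refine one_ext fun v ↦ ?_
      rw [pullback_apply_one, pullback_apply_one, hαv, mfderiv_graph hlog, extendedForm_apply,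
        hdlog]
      simp only
      rw [hexp]
      ring
    rw [hιj, hπ₀, pullback_comp _ hΘP.contMDiff_proj j.contMDiff,
      pullback_comp _ hgraph j.contMDiff, hpull]
  · intro y
    change -f (π₀ y) = _
    rw [← hπPj, hfv, hj, extendedHamiltonian, hexp]
    ring
  -- The field on J₀ is -X_H transported from M. Its image on the graph has ∂_t-component
  -- -dρ(X_H)/ρ, which is that of X_K there; hence X_K is tangent to J₀.
  · obtain ⟨XJ, hXJ, hXJrel⟩ := Diffeomorph.exists_isRelated j.symm hXh.smooth.neg
    have hjrel : IsRelated I' I j XJ (fun m ↦ -Xh m) := hXJrel.symm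
    refine ⟨XJ, hXJ, ?_, ?_⟩
    · rw [hιj]
      refine IsRelated.comp hgraph j.contMDiff (fun m ↦ ?_) hjrel
      rw [mfderiv_graph hlog, one_neg, hdlog, ← hexp]
    · rw [hπ₀]
      exact IsRelated.comp hΘP.contMDiff_proj j.contMDiff hXrel.neg hjrel
  · intro y
    rw [hj, hΦ, hπPj]
  · funext c
    obtain ⟨m, rfl⟩ := hsurjC c
    refine one_ext fun w ↦ ?_
    obtain ⟨v, rfl⟩ := hΘC.mfderiv_proj_surjective m w
    rw [hαC, ← pullback_apply_one, ← pullback_comp _ Φ.contMDiff hΘC.contMDiff_proj, hΦπ,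
      pullback_apply_one, hαv]
  · intro c
    obtain ⟨m, rfl⟩ := hsurjC c
    change -f (Φ (πC m)) = _
    rw [hΦ, hfv, hfC]
  · intro c
    obtain ⟨m, rfl⟩ := hsurjC c
    have h1 := mfderiv_comp m ((Φ.contMDiff (πC m)).mdifferentiableAt (by simp))
      ((hΘC.contMDiff_proj m).mdifferentiableAt (by simp))
    rw [hΦπ] at h1
    rw [← hXC]
    exact (DFunLike.congr_fun h1 (Xh m)).symm.trans ((hXrel m).trans
      ((vfield_congr X (hΦ m).symm).trans (neg_neg (X (Φ (πC m)))).symm))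

end Reduction

end ContactReduction

end

/-! ### The main theorem -/

open ContactReduction in
theorem mainTheorem11
    {E : Type*} [NormedAddCommGroup E] [NormedSpace ℝ E] [FiniteDimensional ℝ E]
    {M : Type*} [TopologicalSpace M] [T2Space M] [ChartedSpace E M] [IsManifold 𝓘(ℝ, E) ∞ M]
    {EC : Type*} [NormedAddCommGroup EC] [NormedSpace ℝ EC] [FiniteDimensional ℝ EC]
    {C : Type*} [TopologicalSpace C] [ChartedSpace EC C] [IsManifold 𝓘(ℝ, EC) ∞ C]
    -- the Hamiltonian system and its scaling symmetry `D` of degree one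
    (Ω : DForm 𝓘(ℝ, E) M 2) (hΩ : IsSymplecticForm 𝓘(ℝ, E) Ω)
    (h : M → ℝ) (hh : ContMDiff 𝓘(ℝ, E) 𝓘(ℝ, ℝ) ∞ h)
    (D : VField 𝓘(ℝ, E) M) (hD : IsScalingSymmetry 𝓘(ℝ, E) Ω h D 1)
    (hDc : IsCompleteVField 𝓘(ℝ, E) D)
    -- the quotient manifold `C = M / D`
    (π : M → C) (hπ : IsOrbitQuotient 𝓘(ℝ, E) 𝓘(ℝ, EC) D π)
    -- the scaling function
    (ρ : M → ℝ) (hρ : IsScalingFunction 𝓘(ℝ, E) D ρ) (hρ0 : ∀ m, ρ m ≠ 0) :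
    let IN := 𝓘(ℝ, ℝ).prod 𝓘(ℝ, E)
    let lam : DForm 𝓘(ℝ, E) M 1 := interior 𝓘(ℝ, E) D Ω
    let η : DForm IN (ℝ × M) 1 := extendedForm 𝓘(ℝ, E) lam ρ
    let Dt : VField IN (ℝ × M) := extendedField 𝓘(ℝ, E) D
    let K : ℝ × M → ℝ := extendedHamiltonian h
    -- (i) `η` is a contact form, `Dt` generates an action by exact contactomorphisms
    (IsContactForm IN η ∧ lieForm IN Dt η = 0 ∧
      ∃ ψ : ℝ → ℝ × M → ℝ × M, IsFlow IN Dt ψ ∧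
        (∀ s, pullback IN IN (ψ s) η = η) ∧
        -- (ii) and `K` is invariant under this action
        (∀ s p, K (ψ s p) = K p)) ∧
    -- the contact Hamiltonian vector field of `K`, and the contact Hamiltonian system on `C`
    ∃ (XK : VField IN (ℝ × M)) (ηC : DForm 𝓘(ℝ, EC) C 1) (hC : C → ℝ) (XC : VField 𝓘(ℝ, EC) C),
      IsContactHamiltonianVField IN η K XK ∧
      IsContactForm 𝓘(ℝ, EC) ηC ∧
      (∀ m, pullback 𝓘(ℝ, E) 𝓘(ℝ, EC) π ηC m = (ρ m)⁻¹ • lam m) ∧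
      (∀ (m : M) (w : TangentSpace 𝓘(ℝ, EC) (π m)), ηC (π m) ![w] = 0 ↔
        ∃ v : TangentSpace 𝓘(ℝ, E) m, lam m ![v] = 0 ∧ mfderiv 𝓘(ℝ, E) 𝓘(ℝ, EC) π m v = w) ∧
      ContMDiff 𝓘(ℝ, EC) 𝓘(ℝ, ℝ) ∞ hC ∧
      (∀ m, hC (π m) = - h m / ρ m) ∧
      IsContactHamiltonianVField 𝓘(ℝ, EC) ηC hC XC ∧
      (∃ Xh : VField 𝓘(ℝ, E) M, IsHamiltonianVField 𝓘(ℝ, E) Ω h Xh ∧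
        IsRelated 𝓘(ℝ, E) 𝓘(ℝ, EC) π Xh XC) ∧
      -- (iii) for positive `ρ`: the manifolds `J₀` and `P₀ = J₀ / Dt` exist, and for all
      -- realizations of them the reduced contact system on `P₀` is identified with that on `C`
      ((∀ m, 0 < ρ m) →
        (∃ (ι₀ : M → ℝ × M) (π₀ : M → C),
          IsZeroLevelQuotient IN 𝓘(ℝ, E) 𝓘(ℝ, EC) η Dt ι₀ π₀) ∧
        ∀ {EJ : Type*} [NormedAddCommGroup EJ] [NormedSpace ℝ EJ] [FiniteDimensional ℝ EJ]
          {J : Type*} [TopologicalSpace J] [ChartedSpace EJ J] [IsManifold 𝓘(ℝ, EJ) ∞ J]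
          {EP : Type*} [NormedAddCommGroup EP] [NormedSpace ℝ EP] [FiniteDimensional ℝ EP]
          {P : Type*} [TopologicalSpace P] [ChartedSpace EP P] [IsManifold 𝓘(ℝ, EP) ∞ P]
          (ι₀ : J → ℝ × M) (π₀ : J → P),
          IsZeroLevelQuotient IN 𝓘(ℝ, EJ) 𝓘(ℝ, EP) η Dt ι₀ π₀ →
          ∃ (ηP : DForm 𝓘(ℝ, EP) P 1) (hP : P → ℝ) (XP : VField 𝓘(ℝ, EP) P)
            (Φ : Diffeomorph 𝓘(ℝ, EC) 𝓘(ℝ, EP) C P ∞),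
            -- the reduced contact system on `P₀`
            IsContactForm 𝓘(ℝ, EP) ηP ∧
            pullback 𝓘(ℝ, EJ) 𝓘(ℝ, EP) π₀ ηP = pullback 𝓘(ℝ, EJ) IN ι₀ η ∧
            ContMDiff 𝓘(ℝ, EP) 𝓘(ℝ, ℝ) ∞ hP ∧
            (∀ j, hP (π₀ j) = K (ι₀ j)) ∧
            IsContactHamiltonianVField 𝓘(ℝ, EP) ηP hP XP ∧
            (∃ XJ : VField 𝓘(ℝ, EJ) J, IsSmoothVField 𝓘(ℝ, EJ) XJ ∧
              IsRelated 𝓘(ℝ, EJ) IN ι₀ XJ XK ∧ IsRelated 𝓘(ℝ, EJ) 𝓘(ℝ, EP) π₀ XJ XP) ∧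
            -- the contactomorphism `C ≅ P₀` and the correspondence of the dynamics
            (∀ j, Φ (π (ι₀ j).2) = π₀ j) ∧
            pullback 𝓘(ℝ, EC) 𝓘(ℝ, EP) Φ ηP = ηC ∧
            (∀ c, hP (Φ c) = - hC c) ∧
            IsRelated 𝓘(ℝ, EC) 𝓘(ℝ, EP) Φ XC (-XP)) := by
  intro IN lam η Dt K
  obtain ⟨Θ, hΘ'⟩ := hπ.exists_trivialization hρ hρ0
  have hΘ := hπ.isTrivialization hρ hρ0 hΘ'
  obtain ⟨Xh, hXh⟩ := hΩ.exists_isHamiltonianVField hh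
  obtain ⟨Xr, hXr⟩ := hΩ.exists_isHamiltonianVField hρ.smooth
  have hlam : IsSmoothForm 𝓘(ℝ, E) lam := hD.isSmoothForm hΩ
  have hlamD (m : M) : lam m ![D m] = 0 := interior_apply_self m
  obtain ⟨ηC, hC, XC, hηC, hηCv, hhC, hhCv, hXC, hXCrel⟩ :=
    hΘ.exists_contactHamiltonian hΩ hD hh hρ hρ0 hXr hXh
  refine ⟨⟨isContactForm_extendedForm hlam hρ.smooth ?_, lieForm_extendedForm hΩ hD hρ,
    hΘ.exists_isFlow_extendedField hD hh hρ hρ0 hηCv⟩, _, ηC, hC, XC,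
    isContactHamiltonianVField_extendedForm hΩ hD hh hρ hXr (hXr.smooth.sub hD.smooth) hXh
      hXh.smooth.neg ((isSmoothForm_dFun hρ.smooth).contMDiff_apply hXh.smooth), hηC, ?_, ?_,
    -- Existence of J₀ and P₀ is realized by M itself, embedded as the graph of log ρ, with quotient
    -- map π onto C.
    hhC, hhCv, hXC, ⟨Xh, hXh, hXCrel⟩, fun hpos ↦ ⟨⟨_, π,
      isZeroLevelQuotient_graph hD.smooth hρ hlamD hpos hπ⟩, ?_⟩⟩
  · have hdlam : extD 𝓘(ℝ, E) lam = Ω := hD.extD_interior hΩ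
    rw [hdlam]
    exact hΩ.nondegenerate
  · exact fun m ↦ one_ext fun v ↦ (pullback_apply_one π ηC m v).trans (hηCv m v)
  · intro m w
    constructor
    · intro hw
      obtain ⟨v, rfl⟩ := hΘ.mfderiv_proj_surjective m w
      rw [hηCv] at hw
      exact ⟨v, (mul_eq_zero.1 hw).resolve_left (inv_ne_zero (hρ0 m)), rfl⟩
    · rintro ⟨v, hv, rfl⟩
      rw [hηCv, show interior 𝓘(ℝ, E) D Ω m ![v] = 0 from hv, mul_zero]
  · intro EJ _ _ _ J _ _ _ EP _ _ _ P _ _ _ ι₀ π₀ hJ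
    exact hΘ.exists_reduction hΩ hD hh hρ hpos (fun γ hγ t ↦ hπ.comp_integralCurve hγ t) hXr hXh
      hηCv hhCv hXCrel hJ
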